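/- Let $n\ge 5$ be odd and $k=\frac{n+1}{2}$. For a partition $\lambda$ of $n$, let $\chi_\lambda$ denote the irreducible complex character of the symmetric group $S_n$ indexed by $\lambda$ (the character of the Specht module $S^\lambda$; so $\chi_{(n)}$ is trivial and $\chi_{(1^n)}$ is the sign character). For a character $\chi$ of a finite group $G$, let $\mathrm{ccn}(\chi;G)$ denote the least positive integer $m$ (if it exists) such that every irreducible complex character of $G$ is a constituent of $\chi^m$. Then $\mathrm{ccn}(\chi_{(k,k-1)};S_n)$ and $\mathrm{ccn}(\chi_{(2^{k-1},1)};S_n)$ exist, and $$\mathrm{ccn}(\chi_{(k,k-1)};S_n)=\mathrm{ccn}(\chi_{(2^{k-1},1)};S_n)=\lceil\log_2 n\rceil .$$ -/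

import Mathlib

noncomputable section

namespace CharCovering

/-! ### Irreducible characters, constituents and covering numbers -/

section Characters

variable {G : Type*} [Group G] [Fintype G]

/-- `Irr(G)`: the characters of the irreducible finite-dimensional complex representations
of `G`, as functions `G → ℂ`. -/
def Irr (G : Type*) [Group G] : Set (G → ℂ) :=
  {φ | ∃ (V : Type) (_ : AddCommGroup V) (_ : Module ℂ V) (_ : FiniteDimensional ℂ V)
      (ρ : Representation ℂ G V), ρ.IsIrreducible ∧ φ = ρ.character}

/-- The inner product `⟨φ, ψ⟩ = |G|⁻¹ ∑ g, φ(g) ψ(g⁻¹)`. If `φ` is a character and `ψ` an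
irreducible one, this is the multiplicity of `ψ` in `φ`. -/
def charInner (φ ψ : G → ℂ) : ℂ :=
  (Fintype.card G : ℂ)⁻¹ * ∑ g : G, φ g * ψ g⁻¹

/-- `c(χ)`: the set of irreducible constituents of the character `χ`. -/
def constituents (χ : G → ℂ) : Set (G → ℂ) :=
  {φ | φ ∈ Irr G ∧ charInner χ φ ≠ 0}

/-- `m` is the covering number of the character `χ`: the least positive integer `m`
for which every irreducible character of `G` is a constituent of `χ ^ m` (pointwise power, the
character of the `m`-fold tensor power). In particular such a positive integer exists. -/
def IsCoveringNumber (χ : G → ℂ) (m : ℕ) : Prop :=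
  IsLeast {j : ℕ | 0 < j ∧ constituents (χ ^ j) = Irr G} m

end Characters

/-! ### Specht modules and the characters `χ_λ` of the symmetric group -/

/-- The Young diagram of a partition: row `i` has length the `i`-th largest part. -/
def diagram {n : ℕ} (lam : n.Partition) : YoungDiagram :=
  YoungDiagram.ofRowLens (lam.parts.sort (· ≥ ·)) (Multiset.pairwise_sort _ _).sortedGE

/-- A (bijective) tableau of shape `lam`, encoded by the map which sends each entry
to its cell `(row, column)`. -/
abbrev Tableau {n : ℕ} (lam : n.Partition) : Type :=
  Fin n ≃ (diagram lam).cells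

/-- A tabloid is determined by the function sending each entry to the index of its row.
This is the permutation representation of `S_n` with basis all functions `Fin n → ℕ`,
where `g` moves the entry `i` to `g i`; the tabloids of a fixed shape span a subrepresentation. -/
def tabloidRep (n : ℕ) : Representation ℂ (Equiv.Perm (Fin n)) ((Fin n → ℕ) →₀ ℂ) where
  toFun g := Finsupp.lmapDomain ℂ ℂ fun f i => f (g⁻¹ i)
  map_one' := by
    ext f : 2
    simp
  map_mul' g h := by
    ext f : 2
    simp [Finsupp.mapDomain_single, Equiv.Perm.mul_apply]

/-- The tabloid `{T}` of a tableau `T`. -/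
def rowTabloid {n : ℕ} {lam : n.Partition} (T : Tableau lam) : Fin n → ℕ :=
  fun i => (T i).1.1

/-- The column stabilizer of `T`. -/
def columnGroup {n : ℕ} {lam : n.Partition} (T : Tableau lam) :
    Finset (Equiv.Perm (Fin n)) :=
  Finset.univ.filter fun g => ∀ i, (T (g i)).1.2 = (T i).1.2

/-- The polytabloid `e_T = ∑ sgn(g) g{T}`, the sum over the column stabilizer of `T`. -/
def polytabloid {n : ℕ} {lam : n.Partition} (T : Tableau lam) : (Fin n → ℕ) →₀ ℂ :=
  ∑ g ∈ columnGroup T,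
    ((Equiv.Perm.sign g : ℤ) : ℂ) • tabloidRep n g (Finsupp.single (rowTabloid T) 1)

theorem tabloidRep_polytabloid {n : ℕ} {lam : n.Partition} (T : Tableau lam)
    (h : Equiv.Perm (Fin n)) :
    tabloidRep n h (polytabloid T) = polytabloid ((h⁻¹ : Equiv.Perm (Fin n)).trans T) := by
  unfold polytabloid
  rw [map_sum]
  refine Finset.sum_bij' (fun g _ => h * g * h⁻¹) (fun g _ => h⁻¹ * g * h) ?_ ?_ ?_ ?_ ?_
  · intro g hg
    simp only [columnGroup, Finset.mem_filter, Finset.mem_univ, true_and] at hg ⊢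
    intro i
    simpa using hg (h⁻¹ i)
  · intro g hg
    simp only [columnGroup, Finset.mem_filter, Finset.mem_univ, true_and] at hg ⊢
    intro i
    simpa using hg (h i)
  · intro g _
    group
  · intro g _
    group
  · intro g _
    have hT : rowTabloid ((h⁻¹ : Equiv.Perm (Fin n)).trans T)
        = fun i => rowTabloid T (h⁻¹ i) := rfl
    have hs : tabloidRep n h (Finsupp.single (rowTabloid T) 1)
        = Finsupp.single (rowTabloid ((h⁻¹ : Equiv.Perm (Fin n)).trans T)) 1 := by
      rw [hT]
      exact Finsupp.mapDomain_single
    have hsgn : Equiv.Perm.sign (h * g * h⁻¹) = Equiv.Perm.sign g := by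
      rw [Equiv.Perm.sign_mul, Equiv.Perm.sign_mul, Equiv.Perm.sign_inv, mul_right_comm,
        Int.units_mul_self, one_mul]
    rw [← hs, hsgn, map_smul, ← Module.End.mul_apply, ← map_mul, ← Module.End.mul_apply,
      ← map_mul, inv_mul_cancel_right]

/-- The Specht module `S^lam`: the span of all polytabloids of shape `lam`. -/
def specht {n : ℕ} (lam : n.Partition) : Subrepresentation (tabloidRep n) where
  toSubmodule := Submodule.span ℂ (Set.range (polytabloid (lam := lam)))
  apply_mem_toSubmodule h v hv := by
    induction hv using Submodule.span_induction with
    | mem x hx =>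
      obtain ⟨T, rfl⟩ := hx
      rw [tabloidRep_polytabloid]
      exact Submodule.subset_span ⟨_, rfl⟩
    | zero => simp
    | add x y _ _ hx hy => rw [map_add]; exact add_mem hx hy
    | smul a x _ hx => rw [map_smul]; exact Submodule.smul_mem _ a hx

/-- The Specht module as a representation of `S_n`. -/
def spechtRep {n : ℕ} (lam : n.Partition) :
    Representation ℂ (Equiv.Perm (Fin n)) (specht lam).toSubmodule :=
  (specht lam).toRepresentation

/-- `χ_lam`: the irreducible character of `S_n` indexed by the partition `lam`, i.e. the
character of the Specht module `S^lam` over `ℂ`. -/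
def spechtChar {n : ℕ} (lam : n.Partition) : Equiv.Perm (Fin n) → ℂ :=
  Representation.character (V := (specht lam).toSubmodule) (spechtRep lam)

end CharCovering

end

/-!
# Covering numbers of the two-row and two-column characters

Let `n = 2k - 1` and let `V` be the Specht module of shape `(k, k - 1)`. It is spanned by the tensors
of matchings of `{1, …, n}` with one unmatched point inside `(ℂ²)^{⊗ n}`, i.e. inside the permutation
module on binary words of length `n`; write `Y_c` for the permutation module on the words over `c`
letters. For `m ≥ 2`, the irreducible constituents of `V^{⊗ m}` are exactly those of `Y_{2^m}`.

*Lower bound.* `V^{⊗ j}` embeds in `Y_{2^j}`. A vector of `Y_c` on which the group acts by the sign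
involves only words without repeated letters (`exists_injective_word`), so the sign character can
be a constituent of `χ ^ j` only if `n ≤ 2 ^ j`.

*Upper bound.* For `m ≥ 2`, every irreducible `U ⊆ Y_{2^m}` occurs in `V^{⊗ m}`
(`exists_power_covering`), and for `n ≤ 2 ^ m` every irreducible representation is contained in
`Y_{2^m}`. The proof is by induction on `m`. Irreducible representations are recognized by Young
symmetrizers `e`, which satisfy `e A e ⊆ ℂ e` in the group algebra `A`: if `e` acts nontrivially on
an irreducible `U` and on some representation `X`, then `U` embeds in `X`
(`IsRankOne.exists_injective`), and every irreducible representation is met by some symmetrizer, for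
any choice of one diagram for each partition (`exists_acts_youngSym`). If `U ⊆ Y_c`, the diagram has
at most `c` rows. So for `m = 2` the symmetrizers of diagrams with at most four rows have to act
nontrivially on `V ⊗ V`; and in the step those of diagrams with at most `2h` rows, `h = 2 ^ m ≥ 2`,
have to act nontrivially on `V ⊗ Y_h`, since then they do so on `V ⊗ U'` for an irreducible
`U' ⊆ Y_h`, to which the induction hypothesis applies.

Whether `e` kills a tensor is tested by a polynomial: replace the letters of a word by indeterminates
depending on the row, and antisymmetrize along the columns; the result `minorSum` is a sum of products
of minors, one for each column. These polynomials multiply when diagrams are put next to each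
other, and a product of nonzero polynomials is nonzero (`HasConfig.add`), so it suffices to treat
blocks of one or two columns. In the step, the second factor is a single word chosen such that the
letters run through an initial segment down each column, and the minors are Vandermonde
determinants; two columns of odd height share a pair of the matching. In the base case, two columns
of equal or consecutive heights are paired horizontally in both factors, and the single columns of
heights `3` and `4` are evaluated directly (`hasConfig_isMatching`, `hasConfig_anyTensor`).

The shape `(2^{k-1}, 1)` is the transpose of `(k, k - 1)`. Its character is the product of `χ` with
the sign (`spechtChar_transpose`), and multiplication by the sign permutes the irreducible characters.
-/

set_option linter.unusedSectionVars false

noncomputable section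

namespace CharCovering

/-! ### Elements `e` of a ring with `e A e ⊆ k e` -/

section

section RankOne

variable {k A : Type*} [Field k] [Ring A] [Algebra k A]

/-- `e A e ⊆ k e`. In a semisimple algebra such an element acts nontrivially on at most one
simple module, and there with rank one. -/
def IsRankOne (k : Type*) {A : Type*} [Field k] [Ring A] [Algebra k A] (e : A) : Prop :=
  ∀ x : A, ∃ c : k, e * x * e = algebraMap k A c * e

theorem smul_algebraMap_ne_zero {X : Type*} [AddCommGroup X] [Module A X] {c : k} (hc : c ≠ 0)
    {v : X} (hv : v ≠ 0) : algebraMap k A c • v ≠ 0 := by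
  intro h
  apply hv
  have : (algebraMap k A c⁻¹ * algebraMap k A c) • v = 0 := by rw [mul_smul, h, smul_zero]
  rwa [← map_mul, inv_mul_cancel₀ hc, map_one, one_smul] at this

theorem exists_smul_eq_of_isSimpleModule {X : Type*} [AddCommGroup X] [Module A X]
    [IsSimpleModule A X] {v : X} (hv : v ≠ 0) (w : X) : ∃ a : A, a • v = w := by
  have : Submodule.span A {v} = ⊤ :=
    (eq_bot_or_eq_top _).resolve_left fun h => hv (Submodule.span_singleton_eq_bot.1 h)
  exact Submodule.mem_span_singleton.1 (this ▸ Submodule.mem_top)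

/-- The annihilator of `e • v ≠ 0` in a simple module depends only on `e`. -/
theorem IsRankOne.smul_smul_eq_zero_iff {e : A} (he : IsRankOne k e) {X : Type*} [AddCommGroup X]
    [Module A X] [IsSimpleModule A X] {v : X} (hv : e • v ≠ 0) (z : A) :
    z • e • v = 0 ↔ ∀ u : A, e * u * z * e = 0 := by
  constructor
  · intro h u
    obtain ⟨c, hc⟩ := he (u * z)
    rw [mul_assoc e u z, hc]
    by_cases h0 : c = 0
    · simp [h0]
    · have h1 : (e * (u * z) * e) • v = 0 := by
        simp only [mul_smul, h, smul_zero]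
      rw [hc, mul_smul] at h1
      exact absurd h1 (smul_algebraMap_ne_zero h0 hv)
  · intro h
    by_contra hne
    obtain ⟨u, hu⟩ := exists_smul_eq_of_isSimpleModule (A := A) hne v
    apply hv
    calc e • v = (e * u * z * e) • v := by simp only [mul_smul, hu]
      _ = 0 := by rw [h u, zero_smul]

/-- Two simple modules on which a rank one element acts nontrivially are isomorphic: the
annihilators of nonzero vectors `e • v` and `e • w` agree. -/
theorem IsRankOne.nonempty_equiv {e : A} (he : IsRankOne k e) {X Y : Type*} [AddCommGroup X]
    [Module A X] [IsSimpleModule A X] [AddCommGroup Y] [Module A Y] [IsSimpleModule A Y]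
    (hX : ∃ v : X, e • v ≠ 0) (hY : ∃ v : Y, e • v ≠ 0) : Nonempty (X ≃ₗ[A] Y) := by
  obtain ⟨v, hv⟩ := hX
  obtain ⟨w, hw⟩ := hY
  have hker : LinearMap.ker (LinearMap.toSpanSingleton A X (e • v))
      = LinearMap.ker (LinearMap.toSpanSingleton A Y (e • w)) := by
    ext z
    simp only [LinearMap.mem_ker, LinearMap.toSpanSingleton_apply]
    rw [he.smul_smul_eq_zero_iff hv, he.smul_smul_eq_zero_iff hw]
  exact ⟨((LinearMap.quotKerEquivOfSurjective _
      (fun x => exists_smul_eq_of_isSimpleModule hv x)).symm.trans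
    (Submodule.quotEquivOfEq _ _ hker)).trans (LinearMap.quotKerEquivOfSurjective _
      (fun x => exists_smul_eq_of_isSimpleModule hw x))⟩

/-- An element acting nontrivially on a semisimple module acts nontrivially on a simple
submodule. -/
theorem exists_simple_submodule {X : Type*} [AddCommGroup X] [Module A X] [IsSemisimpleModule A X]
    {e : A} (h : ∃ v : X, e • v ≠ 0) :
    ∃ N : Submodule A X, IsSimpleModule A N ∧ ∃ v : N, e • v ≠ 0 := by
  by_contra! hcon
  obtain ⟨v, hv⟩ := h
  refine hv ?_
  clear hv
  have hmem : v ∈ sSup {m : Submodule A X | IsSimpleModule A m} := by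
    rw [IsSemisimpleModule.sSup_simples_eq_top]; trivial
  rw [sSup_eq_iSup'] at hmem
  induction hmem using Submodule.iSup_induction' with
  | mem N x hx => exact congrArg Subtype.val (hcon N.1 N.2 ⟨x, hx⟩)
  | zero => exact smul_zero _
  | add x y _ _ hx hy => rw [smul_add, hx, hy, add_zero]

/-- If `e` has rank one and `e • τ ≠ 0`, the cyclic module generated by `e • τ` is simple (when it
sits in a semisimple module), and `e` acts nontrivially on it. -/
theorem IsRankOne.isSimpleModule_of_range_eq {e : A} (he : IsRankOne k e) {X N : Type*}
    [AddCommGroup X] [Module A X] [IsSemisimpleModule A X] [AddCommGroup N] [Module A N]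
    (i : N →ₗ[A] X) (hi : Function.Injective i) {τ : X} (hτ : e • τ ≠ 0)
    (hrange : LinearMap.range i = Submodule.span A {e • τ}) :
    IsSimpleModule A N ∧ ∃ u : N, e • u ≠ 0 := by
  have key : ∀ L : Submodule A X, L ≤ Submodule.span A {e • τ} → L ≠ ⊥ →
      e • τ ∈ L ∧ ∃ u ∈ L, e • u ≠ 0 := by
    intro L hL hL0
    -- The component of `τ` in a complement of `L` cannot carry all of `e • τ`.
    obtain ⟨L', hL'⟩ := exists_isCompl L
    obtain ⟨τ₁, h1, τ₂, h2, rfl⟩ := Submodule.mem_sup.1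
      (hL'.sup_eq_top ▸ (Submodule.mem_top : τ ∈ ⊤))
    have hne : e • τ₁ ≠ 0 := by
      intro h0
      rw [smul_add, h0, zero_add] at hL
      refine hL0 (eq_bot_iff.2 fun x hx => ?_)
      have hx2 : x ∈ L' :=
        (Submodule.span_singleton_le_iff_mem _ _).2 (L'.smul_mem e h2) (hL hx)
      exact hL'.disjoint.le_bot ⟨hx, hx2⟩
    obtain ⟨y, hy⟩ := Submodule.mem_span_singleton.1 (hL h1)
    obtain ⟨c, hc⟩ := he y
    have h3 : e • τ₁ = algebraMap k A c • e • (τ₁ + τ₂) := by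
      conv_lhs => rw [← hy]
      rw [← mul_smul, ← mul_smul, hc, mul_smul]
    have hc0 : c ≠ 0 := by
      rintro rfl
      apply hne
      rw [h3]; simp
    refine ⟨?_, τ₁, h1, hne⟩
    have h4 := L.smul_mem (algebraMap k A c⁻¹) (h3 ▸ L.smul_mem e h1)
    rwa [← mul_smul, ← map_mul, inv_mul_cancel₀ hc0, map_one, one_smul] at h4
  have hspan : Submodule.span A {e • τ} ≠ ⊥ := by
    rwa [Ne, Submodule.span_singleton_eq_bot]
  have hnt : Nontrivial N := by
    by_contra hN
    rw [not_nontrivial_iff_subsingleton] at hN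
    apply hspan
    rw [← hrange, LinearMap.range_eq_bot]
    ext x
    simp [Subsingleton.elim x 0]
  refine ⟨?_, ?_⟩
  · rw [isSimpleModule_iff]
    refine { eq_bot_or_eq_top := fun L => ?_ }
    by_cases hL : L.map i = ⊥
    · left
      rw [eq_bot_iff]
      intro x hx
      have h1 : i x ∈ L.map i := Submodule.mem_map_of_mem hx
      rw [hL, Submodule.mem_bot] at h1
      exact (map_eq_zero_iff i hi).1 h1
    · right
      have hle : L.map i ≤ Submodule.span A {e • τ} := hrange ▸ LinearMap.map_le_range
      have h1 := (key _ hle hL).1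
      rw [eq_top_iff]
      intro x _
      have h2 : i x ∈ L.map i := (Submodule.span_singleton_le_iff_mem _ _).2 h1
        (hrange ▸ LinearMap.mem_range_self i x)
      obtain ⟨y, hy, hxy⟩ := h2
      rwa [← hi hxy]
  · obtain ⟨u, hu, hne⟩ := (key _ le_rfl hspan).2
    rw [← hrange] at hu
    obtain ⟨u, rfl⟩ := hu
    refine ⟨u, fun h => hne ?_⟩
    rw [← map_smul, h, map_zero]

end RankOne

end

/-! ### Young diagrams on a finite set, and dominance -/

section

open Finset

/-- The numbers `0, …, #S - 1` are the unique `#S` natural numbers with the least sum. -/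
theorem sum_range_card_lt {S : Finset ℕ} (h : S ≠ range #S) : ∑ x ∈ range #S, x < ∑ x ∈ S, x := by
  have hcard : #(S \ range #S) = #(range #S \ S) := by
    apply Finset.card_sdiff_comm; simp
  have hne : (range #S \ S).Nonempty := by
    rw [Finset.sdiff_nonempty]
    exact fun hsub => h (Finset.eq_of_subset_of_card_le hsub (by simp)).symm
  have h1 : ∑ x ∈ range #S \ S, x < ∑ x ∈ range #S \ S, #S := by
    apply Finset.sum_lt_sum_of_nonempty hne
    intro x hx
    simpa using (Finset.mem_sdiff.1 hx).1
  have h2 : ∑ x ∈ S \ range #S, #S ≤ ∑ x ∈ S \ range #S, x := by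
    apply Finset.sum_le_sum
    intro x hx
    simpa using (Finset.mem_sdiff.1 hx).2
  rw [Finset.sum_const] at h1 h2
  rw [← Finset.sum_inter_add_sum_sdiff S (range #S), ← Finset.sum_inter_add_sum_sdiff (range #S) S,
    Finset.inter_comm]
  rw [hcard] at h2
  omega

theorem sum_range_card_le (S : Finset ℕ) : ∑ x ∈ range #S, x ≤ ∑ x ∈ S, x := by
  by_cases h : S = range #S
  · rw [← h]
  · exact (sum_range_card_lt h).le

variable {I κ : Type*} [Fintype I] [DecidableEq I] [DecidableEq κ]

/-- The functions `row` and `col` place the elements of `I` in the cells of a Young diagram: no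
two share a cell, and every column is justified to the top. The columns are labelled by an
arbitrary type and need not be sorted by height. -/
structure IsDiagram {I κ : Type*} (row : I → ℕ) (col : I → κ) : Prop where
  inj : Function.Injective fun i => (row i, col i)
  justified : ∀ i, ∀ r < row i, ∃ i', row i' = r ∧ col i' = col i

omit [DecidableEq I] in
theorem IsDiagram.image_fiber {row : I → ℕ} {col : I → κ} (h : IsDiagram row col) (j : κ) :
    (univ.filter fun i => col i = j).image row = range #(univ.filter fun i => col i = j) := by
  have hinj : Set.InjOn row (univ.filter fun i => col i = j : Finset I) := by
    intro a ha b hb hab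
    simp only [coe_filter, mem_univ, true_and, Set.mem_ofPred_eq] at ha hb
    exact h.inj (Prod.ext hab (ha.trans hb.symm))
  have hcard := Finset.card_image_of_injOn hinj
  rw [← hcard]
  apply Finset.eq_of_subset_of_card_le _ (by simp)
  intro x hx
  rw [mem_range, ← Nat.succ_le_iff, ← card_range x.succ]
  apply Finset.card_le_card
  intro r hr
  simp only [mem_range, mem_image, mem_filter, mem_univ, true_and] at hr hx ⊢
  obtain ⟨i, hi, rfl⟩ := hx
  rcases Nat.lt_succ_iff_lt_or_eq.1 hr with hlt | rfl
  · obtain ⟨i', h1, h2⟩ := h.justified i r hlt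
    exact ⟨i', h2.trans hi, h1⟩
  · exact ⟨i, hi, rfl⟩

omit [Fintype I] [DecidableEq I] [DecidableEq κ] in
theorem IsDiagram.comp_equiv {J : Type*} {row : I → ℕ} {col : I → κ} (h : IsDiagram row col)
    (e : J ≃ I) : IsDiagram (row ∘ e) (col ∘ e) where
  inj := h.inj.comp e.injective
  justified j r hr := by
    obtain ⟨i, h1, h2⟩ := h.justified (e j) r hr
    exact ⟨e.symm i, by simpa using h1, by simpa using h2⟩

omit [DecidableEq I] in
/-- If no two elements share both a row of `row₁` and a column of the diagram `(row₂, col₂)`, then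
`row₁` has at least the sum of `row₂`, already on each column; in case of equality each column meets the
same rows, so the two differ by a permutation within the columns. -/
theorem IsDiagram.exists_perm {row₁ row₂ : I → ℕ} {col₂ : I → κ} (h : IsDiagram row₂ col₂)
    (hinj : Function.Injective fun i => (row₁ i, col₂ i)) (hle : ∑ i, row₁ i ≤ ∑ i, row₂ i) :
    ∃ p : Equiv.Perm I, (∀ i, row₁ (p i) = row₂ i) ∧ ∀ i, col₂ (p i) = col₂ i := by
  classical
  have hinj1 : ∀ j, Set.InjOn row₁ (univ.filter fun i => col₂ i = j : Finset I) := by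
    intro j a ha b hb hab
    simp only [coe_filter, mem_univ, true_and, Set.mem_ofPred_eq] at ha hb
    exact hinj (Prod.ext hab (ha.trans hb.symm))
  have hinj2 : ∀ j, Set.InjOn row₂ (univ.filter fun i => col₂ i = j : Finset I) := by
    intro j a ha b hb hab
    simp only [coe_filter, mem_univ, true_and, Set.mem_ofPred_eq] at ha hb
    exact h.inj (Prod.ext hab (ha.trans hb.symm))
  have hs2 : ∀ j, ∑ i with col₂ i = j, row₂ i = ∑ x ∈ range #{i | col₂ i = j}, x := by
    intro j
    rw [← h.image_fiber j, Finset.sum_image (hinj2 j)]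
  have hs1 : ∀ j, ∑ i with col₂ i = j, row₁ i
      = ∑ x ∈ (univ.filter fun i => col₂ i = j).image row₁, x := by
    intro j
    rw [Finset.sum_image (hinj1 j)]
  have hc1 : ∀ j, #((univ.filter fun i => col₂ i = j).image row₁) = #{i | col₂ i = j} :=
    fun j => Finset.card_image_of_injOn (hinj1 j)
  have hle' : ∀ j ∈ univ.image col₂, ∑ i with col₂ i = j, row₂ i ≤ ∑ i with col₂ i = j, row₁ i := by
    intro j _
    rw [hs1, hs2, ← hc1 j]
    exact sum_range_card_le _
  have hmaps : ∀ i ∈ (univ : Finset I), col₂ i ∈ univ.image col₂ := fun i _ =>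
    mem_image_of_mem _ (mem_univ i)
  rw [← Finset.sum_fiberwise_of_maps_to hmaps row₁, ← Finset.sum_fiberwise_of_maps_to hmaps row₂]
    at hle
  have heq := (Finset.sum_eq_sum_iff_of_le hle').1 (le_antisymm (Finset.sum_le_sum hle') hle)
  have hex : ∀ i, ∃ i', row₁ i' = row₂ i ∧ col₂ i' = col₂ i := by
    intro i
    have h1 := heq (col₂ i) (mem_image_of_mem _ (mem_univ i))
    rw [hs1, hs2, ← hc1] at h1
    have h2 : (univ.filter fun i' => col₂ i' = col₂ i).image row₁
        = (univ.filter fun i' => col₂ i' = col₂ i).image row₂ := by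
      rw [h.image_fiber, ← hc1]
      by_contra hne
      exact (sum_range_card_lt hne).ne h1
    have h3 : row₂ i ∈ (univ.filter fun i' => col₂ i' = col₂ i).image row₁ := by
      rw [h2]; exact mem_image_of_mem _ (by simp)
    obtain ⟨i', hi', h4⟩ := mem_image.1 h3
    exact ⟨i', h4, by simpa using hi'⟩
  choose p hp1 hp2 using hex
  have hpinj : Function.Injective p := by
    intro a b hab
    apply h.inj
    simp only [Prod.mk.injEq]
    rw [← hp1 a, ← hp1 b, ← hp2 a, ← hp2 b, hab]
    exact ⟨rfl, rfl⟩
  exact ⟨Equiv.ofBijective p (Finite.injective_iff_bijective.1 hpinj), hp1, hp2⟩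

theorem perm_apply_inv_self {J : Type*} (g : Equiv.Perm J) (j : J) : g (g⁻¹ j) = j :=
  g.apply_symm_apply j

theorem perm_inv_apply_self {J : Type*} (g : Equiv.Perm J) (j : J) : g⁻¹ (g j) = j :=
  g.symm_apply_apply j

/-! ### Young symmetrizers -/

section Symmetrizers

variable {α : Type*} [DecidableEq α]

/-- The sum of the permutations preserving the rows. -/
def rowSym (row : I → α) : MonoidAlgebra ℂ (Equiv.Perm I) :=
  ∑ g : Equiv.Perm I with ∀ i, row (g i) = row i, MonoidAlgebra.single g 1

/-- The signed sum of the permutations preserving the columns. -/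
def colAnti (col : I → κ) : MonoidAlgebra ℂ (Equiv.Perm I) :=
  ∑ g : Equiv.Perm I with ∀ i, col (g i) = col i,
    MonoidAlgebra.single g ((Equiv.Perm.sign g : ℤ) : ℂ)

/-- The Young symmetrizer. The column antisymmetrizer acts first. -/
def youngSym (row : I → α) (col : I → κ) : MonoidAlgebra ℂ (Equiv.Perm I) :=
  rowSym row * colAnti col

theorem rowSym_mul_single {row : I → α} {p : Equiv.Perm I} (hp : ∀ i, row (p i) = row i) :
    rowSym row * MonoidAlgebra.single p 1 = rowSym row := by
  unfold rowSym
  rw [Finset.sum_mul]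
  refine Finset.sum_bij' (fun g _ => g * p) (fun g _ => g * p⁻¹) ?_ ?_ ?_ ?_ ?_
  · intro g hg
    simp only [mem_filter, mem_univ, true_and] at hg ⊢
    intro i
    rw [Equiv.Perm.mul_apply, hg, hp]
  · intro g hg
    simp only [mem_filter, mem_univ, true_and] at hg ⊢
    intro i
    rw [Equiv.Perm.mul_apply, hg, ← hp (p⁻¹ i), perm_apply_inv_self]
  · intro g _; group
  · intro g _; group
  · intro g _
    simp [MonoidAlgebra.single_mul_single]

theorem single_mul_rowSym {row : I → α} {p : Equiv.Perm I} (hp : ∀ i, row (p i) = row i) :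
    MonoidAlgebra.single p 1 * rowSym row = rowSym row := by
  unfold rowSym
  rw [Finset.mul_sum]
  refine Finset.sum_bij' (fun g _ => p * g) (fun g _ => p⁻¹ * g) ?_ ?_ ?_ ?_ ?_
  · intro g hg
    simp only [mem_filter, mem_univ, true_and] at hg ⊢
    intro i
    rw [Equiv.Perm.mul_apply, hp, hg]
  · intro g hg
    simp only [mem_filter, mem_univ, true_and] at hg ⊢
    intro i
    rw [Equiv.Perm.mul_apply, ← hg i, ← hp (p⁻¹ (g i)), perm_apply_inv_self]
  · intro g _; group
  · intro g _; group
  · intro g _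
    simp [MonoidAlgebra.single_mul_single]

theorem single_mul_colAnti {col : I → κ} {p : Equiv.Perm I} (hp : ∀ i, col (p i) = col i) :
    MonoidAlgebra.single p 1 * colAnti col
      = algebraMap ℂ _ ((Equiv.Perm.sign p : ℤ) : ℂ) * colAnti col := by
  unfold colAnti
  rw [Finset.mul_sum, Finset.mul_sum]
  refine Finset.sum_bij' (fun g _ => p * g) (fun g _ => p⁻¹ * g) ?_ ?_ ?_ ?_ ?_
  · intro g hg
    simp only [mem_filter, mem_univ, true_and] at hg ⊢
    intro i
    rw [Equiv.Perm.mul_apply, hp, hg]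
  · intro g hg
    simp only [mem_filter, mem_univ, true_and] at hg ⊢
    intro i
    rw [Equiv.Perm.mul_apply, ← hg i, ← hp (p⁻¹ (g i)), perm_apply_inv_self]
  · intro g _; group
  · intro g _; group
  · intro g _
    rw [← Algebra.smul_def, MonoidAlgebra.smul_single, MonoidAlgebra.single_mul_single, one_mul,
      Equiv.Perm.sign_mul]
    congr 1
    rcases Int.units_eq_one_or (Equiv.Perm.sign p) with h | h <;> simp [h]

theorem colAnti_mul_single {col : I → κ} {p : Equiv.Perm I} (hp : ∀ i, col (p i) = col i) :
    colAnti col * MonoidAlgebra.single p 1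
      = algebraMap ℂ _ ((Equiv.Perm.sign p : ℤ) : ℂ) * colAnti col := by
  unfold colAnti
  rw [Finset.sum_mul, Finset.mul_sum]
  refine Finset.sum_bij' (fun g _ => g * p) (fun g _ => g * p⁻¹) ?_ ?_ ?_ ?_ ?_
  · intro g hg
    simp only [mem_filter, mem_univ, true_and] at hg ⊢
    intro i
    rw [Equiv.Perm.mul_apply, hg, hp]
  · intro g hg
    simp only [mem_filter, mem_univ, true_and] at hg ⊢
    intro i
    rw [Equiv.Perm.mul_apply, hg, ← hp (p⁻¹ i), perm_apply_inv_self]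
  · intro g _; group
  · intro g _; group
  · intro g _
    rw [← Algebra.smul_def, MonoidAlgebra.smul_single, MonoidAlgebra.single_mul_single, mul_one,
      Equiv.Perm.sign_mul]
    congr 1
    rcases Int.units_eq_one_or (Equiv.Perm.sign p) with h | h <;> simp [h]

omit [Fintype I] [DecidableEq α] in
theorem swap_preserves {f : I → α} {i j : I} (h : f i = f j) (x : I) :
    f (Equiv.swap i j x) = f x := by
  rcases eq_or_ne x i with rfl | hi
  · rw [Equiv.swap_apply_left, h]
  rcases eq_or_ne x j with rfl | hj
  · rw [Equiv.swap_apply_right, h]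
  rw [Equiv.swap_apply_of_ne_of_ne hi hj]

theorem colAnti_mul_swap {col : I → κ} {i j : I} (hij : i ≠ j) (h : col i = col j) :
    colAnti col * MonoidAlgebra.single (Equiv.swap i j) 1 = - colAnti col := by
  rw [colAnti_mul_single (swap_preserves h), Equiv.Perm.sign_swap hij, Units.val_neg, Units.val_one,
    Int.cast_neg, Int.cast_one, map_neg, map_one, neg_one_mul]

theorem swap_mul_colAnti {col : I → κ} {i j : I} (hij : i ≠ j) (h : col i = col j) :
    MonoidAlgebra.single (Equiv.swap i j) 1 * colAnti col = - colAnti col := by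
  rw [single_mul_colAnti (swap_preserves h), Equiv.Perm.sign_swap hij, Units.val_neg, Units.val_one,
    Int.cast_neg, Int.cast_one, map_neg, map_one, neg_one_mul]

theorem swap_conj (g : Equiv.Perm I) (i j : I) :
    Equiv.swap (g i) (g j) * g = g * Equiv.swap i j := by
  rw [Equiv.swap_apply_apply]; group

theorem eq_zero_of_eq_neg_self {x : MonoidAlgebra ℂ (Equiv.Perm I)} (h : x = -x) : x = 0 := by
  have h1 : (2 : ℂ) • x = 0 := by
    rw [two_smul]; nth_rewrite 2 [h]; exact add_neg_cancel x
  exact (smul_eq_zero.1 h1).resolve_left two_ne_zero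

theorem rowSym_mul_single_mul_colAnti_eq_zero {row : I → α} {col : I → κ} {g : Equiv.Perm I}
    {i j : I} (hij : i ≠ j) (hr : row (g i) = row (g j)) (hc : col i = col j) :
    rowSym row * MonoidAlgebra.single g 1 * colAnti col = 0 := by
  apply eq_zero_of_eq_neg_self
  conv_lhs => rw [← rowSym_mul_single (swap_preserves hr)]
  rw [mul_assoc (rowSym row), MonoidAlgebra.single_mul_single, swap_conj, mul_assoc, one_mul,
    ← one_mul (1 : ℂ), ← MonoidAlgebra.single_mul_single, mul_assoc, swap_mul_colAnti hij hc,
    mul_neg, mul_neg, mul_assoc, one_mul]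

theorem colAnti_mul_single_mul_rowSym_eq_zero {row : I → α} {col : I → κ} {g : Equiv.Perm I}
    {i j : I} (hij : i ≠ j) (hr : row i = row j) (hc : col (g i) = col (g j)) :
    colAnti col * MonoidAlgebra.single g 1 * rowSym row = 0 := by
  apply eq_zero_of_eq_neg_self
  conv_lhs => rw [← single_mul_rowSym (swap_preserves hr)]
  rw [mul_assoc, ← mul_assoc (MonoidAlgebra.single g 1), MonoidAlgebra.single_mul_single,
    ← swap_conj, one_mul, ← one_mul (1 : ℂ), ← MonoidAlgebra.single_mul_single,
    mul_assoc (MonoidAlgebra.single _ _), ← mul_assoc (colAnti col),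
    colAnti_mul_swap (g.injective.ne hij) hc, neg_mul, one_mul, mul_assoc]

end Symmetrizers

section Diagram

variable {row : I → ℕ} {col : I → κ}

/-- Either `g` moves two elements of one column into one row, or it is a product of a row and a
column permutation. -/
theorem IsDiagram.exists_eq_mul (h : IsDiagram row col) (g : Equiv.Perm I)
    (hg : ∀ i j, row (g i) = row (g j) → col i = col j → i = j) :
    ∃ p q : Equiv.Perm I, (∀ i, row (p i) = row i) ∧ (∀ i, col (q i) = col i) ∧ g = p * q := by
  obtain ⟨q, h1, h2⟩ := h.exists_perm (row₁ := row ∘ g)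
    (fun i j hij => hg i j (congrArg Prod.fst hij) (congrArg Prod.snd hij))
    (Equiv.sum_comp g row).le
  refine ⟨g * q, q⁻¹, h1, fun i => ?_, by group⟩
  rw [← h2 (q⁻¹ i), perm_apply_inv_self]

theorem exists_algebraMap_mul_of_single {a b c : MonoidAlgebra ℂ (Equiv.Perm I)}
    (H : ∀ g : Equiv.Perm I, ∃ t : ℂ, a * MonoidAlgebra.single g 1 * b = algebraMap ℂ _ t * c)
    (x : MonoidAlgebra ℂ (Equiv.Perm I)) : ∃ t : ℂ, a * x * b = algebraMap ℂ _ t * c := by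
  induction x using MonoidAlgebra.induction_linear with
  | zero => exact ⟨0, by simp⟩
  | add x y hx hy =>
    obtain ⟨s, hs⟩ := hx
    obtain ⟨t, ht⟩ := hy
    exact ⟨s + t, by rw [mul_add, add_mul, hs, ht, map_add, add_mul]⟩
  | single g r =>
    obtain ⟨t, ht⟩ := H g
    refine ⟨r * t, ?_⟩
    have : MonoidAlgebra.single g r = algebraMap ℂ (MonoidAlgebra ℂ (Equiv.Perm I)) r
        * MonoidAlgebra.single g 1 := by
      rw [← Algebra.smul_def, MonoidAlgebra.smul_single, smul_eq_mul, mul_one]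
    rw [this, ← mul_assoc, ← Algebra.commutes, mul_assoc, mul_assoc, ← mul_assoc a, ht, map_mul,
      mul_assoc]

/-- Von Neumann's lemma: `a x b` is a multiple of the Young symmetrizer `a b` for all `x`. -/
theorem IsDiagram.rowSym_mul_mul_colAnti (h : IsDiagram row col)
    (x : MonoidAlgebra ℂ (Equiv.Perm I)) :
    ∃ c : ℂ, rowSym row * x * colAnti col = algebraMap ℂ _ c * youngSym row col := by
  refine exists_algebraMap_mul_of_single (fun g => ?_) x
  by_cases hg : ∀ i j, row (g i) = row (g j) → col i = col j → i = j
  · obtain ⟨p, q, hp, hq, rfl⟩ := h.exists_eq_mul g hg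
    refine ⟨((Equiv.Perm.sign q : ℤ) : ℂ), ?_⟩
    rw [← one_mul (1 : ℂ), ← MonoidAlgebra.single_mul_single, ← mul_assoc, rowSym_mul_single hp,
      mul_assoc, single_mul_colAnti hq, ← mul_assoc, ← Algebra.commutes, mul_assoc, youngSym]
  · push Not at hg
    obtain ⟨i, j, hr, hc, hij⟩ := hg
    exact ⟨0, by rw [rowSym_mul_single_mul_colAnti_eq_zero hij hr hc]; simp⟩

theorem IsDiagram.colAnti_mul_mul_rowSym (h : IsDiagram row col)
    (x : MonoidAlgebra ℂ (Equiv.Perm I)) :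
    ∃ c : ℂ, colAnti col * x * rowSym row = algebraMap ℂ _ c * (colAnti col * rowSym row) := by
  refine exists_algebraMap_mul_of_single (fun g => ?_) x
  by_cases hg : ∀ i j, row (g⁻¹ i) = row (g⁻¹ j) → col i = col j → i = j
  · obtain ⟨p, q, hp, hq, hpq⟩ := h.exists_eq_mul g⁻¹ hg
    have hg' : g = q⁻¹ * p⁻¹ := by rw [← mul_inv_rev, ← hpq, inv_inv]
    have hp' : ∀ i, row (p⁻¹ i) = row i := fun i => by
      rw [← hp (p⁻¹ i), perm_apply_inv_self]
    have hq' : ∀ i, col (q⁻¹ i) = col i := fun i => by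
      rw [← hq (q⁻¹ i), perm_apply_inv_self]
    refine ⟨((Equiv.Perm.sign q⁻¹ : ℤ) : ℂ), ?_⟩
    rw [hg', ← one_mul (1 : ℂ), ← MonoidAlgebra.single_mul_single, ← mul_assoc,
      colAnti_mul_single hq', mul_assoc, single_mul_rowSym hp', mul_assoc]
  · push Not at hg
    obtain ⟨i, j, hr, hc, hij⟩ := hg
    refine ⟨0, ?_⟩
    rw [colAnti_mul_single_mul_rowSym_eq_zero (g⁻¹.injective.ne hij) hr (by simpa using hc)]
    simp

theorem IsDiagram.isRankOne_youngSym (h : IsDiagram row col) : IsRankOne ℂ (youngSym row col) := by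
  intro x
  obtain ⟨c, hc⟩ := h.rowSym_mul_mul_colAnti (colAnti col * x * rowSym row)
  refine ⟨c, ?_⟩
  rw [← hc, youngSym]
  simp only [mul_assoc]

theorem IsDiagram.isRankOne_colAnti_mul_rowSym (h : IsDiagram row col) :
    IsRankOne ℂ (colAnti col * rowSym row) := by
  intro x
  obtain ⟨c, hc⟩ := h.colAnti_mul_mul_rowSym (rowSym row * x * colAnti col)
  refine ⟨c, ?_⟩
  rw [← hc]
  simp only [mul_assoc]

/-- On a simple module, the two orders of multiplication in the Young symmetrizer vanish
simultaneously. -/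
theorem IsDiagram.exists_youngSym_smul_ne_zero (h : IsDiagram row col) {X : Type*}
    [AddCommGroup X] [Module (MonoidAlgebra ℂ (Equiv.Perm I)) X]
    [IsSimpleModule (MonoidAlgebra ℂ (Equiv.Perm I)) X]
    (hX : ∃ v : X, (colAnti col * rowSym row) • v ≠ 0) : ∃ v : X, youngSym row col • v ≠ 0 := by
  obtain ⟨v, hv⟩ := hX
  obtain ⟨z, hz⟩ := exists_smul_eq_of_isSimpleModule (A := MonoidAlgebra ℂ (Equiv.Perm I)) hv v
  obtain ⟨c, hc⟩ := h.rowSym_mul_mul_colAnti z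
  refine ⟨rowSym row • v, fun h0 => hv ?_⟩
  have h1 : (rowSym row * z * colAnti col) • rowSym row • v = rowSym row • v := by
    conv_rhs => rw [← hz]
    simp only [mul_smul]
  rw [hc, mul_smul, h0, smul_zero] at h1
  rw [mul_smul, ← h1, smul_zero]

theorem IsDiagram.youngSym_ne_zero (h : IsDiagram row col) : youngSym row col ≠ 0 := by
  intro h0
  have h1 : (youngSym row col).coeff 1 = 1 := by
    unfold youngSym rowSym colAnti
    rw [Finset.sum_mul_sum, ← Finset.sum_product']
    simp only [MonoidAlgebra.single_mul_single, one_mul]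
    rw [MonoidAlgebra.coeff_sum, Finsupp.finsetSum_apply, Finset.sum_eq_single (1, 1)]
    · simp
    · rintro ⟨p, q⟩ hpq hne
      simp only [mem_product, mem_filter, mem_univ, true_and] at hpq
      rw [MonoidAlgebra.coeff_single, Finsupp.single_apply, if_neg]
      intro hpq1
      have hp : p = q⁻¹ := eq_inv_of_mul_eq_one_left hpq1
      have hq : q = 1 := by
        ext i
        apply h.inj
        simp only [Equiv.Perm.one_apply, hpq.2, Prod.mk.injEq, and_true]
        rw [← hpq.1 (q i), hp, perm_inv_apply_self]
      exact hne (by simp [hp, hq])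
    · simp
  rw [h0] at h1
  simp at h1

/-- Symmetrizing by one diagram and antisymmetrizing by a lower one gives zero, unless the row
lengths agree. -/
theorem IsDiagram.rowSym_mul_mul_colAnti_eq_zero {κ' : Type*} [DecidableEq κ'] {row₂ : I → ℕ}
    {col₂ : I → κ'} (h₂ : IsDiagram row₂ col₂) (hle : ∑ i, row i ≤ ∑ i, row₂ i)
    (hne : ∃ s, #{i | row i = s} ≠ #{i | row₂ i = s}) (x : MonoidAlgebra ℂ (Equiv.Perm I)) :
    rowSym row * x * colAnti col₂ = 0 := by
  obtain ⟨c, hc⟩ : ∃ c : ℂ, rowSym row * x * colAnti col₂ = algebraMap ℂ _ c * 0 := by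
    refine exists_algebraMap_mul_of_single (fun g => ⟨0, ?_⟩) x
    by_cases hg : ∀ i j, row (g i) = row (g j) → col₂ i = col₂ j → i = j
    · exfalso
      obtain ⟨q, h1, h2⟩ := h₂.exists_perm (row₁ := row ∘ g)
        (fun i j hij => hg i j (congrArg Prod.fst hij) (congrArg Prod.snd hij))
        ((Equiv.sum_comp g row).trans_le hle)
      obtain ⟨s, hs⟩ := hne
      apply hs
      symm
      refine Finset.card_equiv (q.trans g) fun i => ?_
      simp [← h1]
    · push Not at hg
      obtain ⟨i, j, hr, hc, hij⟩ := hg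
      rw [rowSym_mul_single_mul_colAnti_eq_zero hij hr hc]; simp
  rw [hc, mul_zero]

theorem IsDiagram.card_row_eq_of_le {κ' : Type*} [DecidableEq κ'] {row₂ : I → ℕ} {col₂ : I → κ'}
    (h₂ : IsDiagram row₂ col₂) {X : Type*}
    [AddCommGroup X] [Module (MonoidAlgebra ℂ (Equiv.Perm I)) X]
    [IsSimpleModule (MonoidAlgebra ℂ (Equiv.Perm I)) X]
    (hX₁ : ∃ v : X, youngSym row col • v ≠ 0) (hX₂ : ∃ v : X, youngSym row₂ col₂ • v ≠ 0)
    (hle : ∑ i, row i ≤ ∑ i, row₂ i) (s : ℕ) : #{i | row i = s} = #{i | row₂ i = s} := by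
  by_contra hne
  obtain ⟨v, hv⟩ := hX₁
  obtain ⟨w, hw⟩ := hX₂
  have hw' : colAnti col₂ • w ≠ 0 := fun h0 => hw (by rw [youngSym, mul_smul, h0, smul_zero])
  obtain ⟨x, hx⟩ := exists_smul_eq_of_isSimpleModule (A := MonoidAlgebra ℂ (Equiv.Perm I)) hw'
    (colAnti col • v)
  apply hv
  rw [youngSym, mul_smul, ← hx, ← mul_smul, ← mul_smul,
    h₂.rowSym_mul_mul_colAnti_eq_zero hle ⟨s, hne⟩, zero_smul]

/-- Young symmetrizers of diagrams with different row lengths do not both act nontrivially on a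
simple module. -/
theorem IsDiagram.card_row_eq {κ' : Type*} [DecidableEq κ'] {row₂ : I → ℕ} {col₂ : I → κ'}
    (h₁ : IsDiagram row col) (h₂ : IsDiagram row₂ col₂) {X : Type*}
    [AddCommGroup X] [Module (MonoidAlgebra ℂ (Equiv.Perm I)) X]
    [IsSimpleModule (MonoidAlgebra ℂ (Equiv.Perm I)) X]
    (hX₁ : ∃ v : X, youngSym row col • v ≠ 0) (hX₂ : ∃ v : X, youngSym row₂ col₂ • v ≠ 0) (s : ℕ) :
    #{i | row i = s} = #{i | row₂ i = s} := by
  rcases le_total (∑ i, row i) (∑ i, row₂ i) with hle | hle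
  · exact h₂.card_row_eq_of_le hX₁ hX₂ hle s
  · exact (h₁.card_row_eq_of_le hX₂ hX₁ hle s).symm

end Diagram

end

/-! ### Characters of finite groups -/

section

open Finset Representation

section Group

variable {G : Type} [Group G] [Fintype G]
variable {V W : Type} [AddCommGroup V] [Module ℂ V] [AddCommGroup W] [Module ℂ W]

/-- The element `e` of the group algebra acts on the representation by a nonzero operator. -/
def Acts (ρ : Representation ℂ G V) (e : MonoidAlgebra ℂ G) : Prop :=
  ∃ v, ρ.asAlgebraHom e v ≠ 0

theorem acts_iff {ρ : Representation ℂ G V} {e : MonoidAlgebra ℂ G} :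
    Acts ρ e ↔ ∃ v : ρ.asModule, e • v ≠ 0 := Iff.rfl

theorem intertwining_asAlgebraHom {ρ : Representation ℂ G V} {σ : Representation ℂ G W}
    (f : IntertwiningMap ρ σ) (e : MonoidAlgebra ℂ G) (v : V) :
    f (ρ.asAlgebraHom e v) = σ.asAlgebraHom e (f v) :=
  (IntertwiningMap.equivLinearMapAsModule ρ σ f).map_smul e v

theorem Acts.of_injective {ρ : Representation ℂ G V} {σ : Representation ℂ G W}
    {e : MonoidAlgebra ℂ G} (h : Acts ρ e) (f : IntertwiningMap ρ σ)
    (hf : Function.Injective f) : Acts σ e := by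
  obtain ⟨v, hv⟩ := h
  refine ⟨f v, fun h0 => hv (hf ?_)⟩
  rw [intertwining_asAlgebraHom, h0, map_zero]

/-- The inclusion of a subrepresentation. -/
def subtypeMap {ρ : Representation ℂ G V} (σ : Subrepresentation ρ) :
    IntertwiningMap σ.toRepresentation ρ where
  toLinearMap := σ.toSubmodule.subtype
  isIntertwining' _ := rfl

theorem subtypeMap_injective {ρ : Representation ℂ G V} (σ : Subrepresentation ρ) :
    Function.Injective (subtypeMap σ) := Subtype.val_injective

/-- A submodule, as a module, is the module of the corresponding subrepresentation. -/
def ofSubmoduleEquiv {ρ : Representation ℂ G V} (N : Submodule (MonoidAlgebra ℂ G) ρ.asModule) :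
    (Subrepresentation.ofSubmodule' N).toRepresentation.asModule ≃ₗ[MonoidAlgebra ℂ G] N :=
  (LinearEquiv.ofInjective (IntertwiningMap.equivLinearMapAsModule _ _
    (subtypeMap (Subrepresentation.ofSubmodule' N))) (subtypeMap_injective _)).trans
    (LinearEquiv.ofEq _ _ <| by
      ext x
      constructor
      · rintro ⟨y, rfl⟩
        exact y.2
      · intro hx
        exact ⟨⟨x, hx⟩, rfl⟩)

theorem isIrreducible_ofSubmodule {ρ : Representation ℂ G V}
    {N : Submodule (MonoidAlgebra ℂ G) ρ.asModule} (hN : IsSimpleModule (MonoidAlgebra ℂ G) N) :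
    (Subrepresentation.ofSubmodule' N).toRepresentation.IsIrreducible := by
  rw [irreducible_iff_isSimpleModule_asModule]
  exact IsSimpleModule.congr (ofSubmoduleEquiv N)

theorem exists_irreducible_sub {ρ : Representation ℂ G V} {e : MonoidAlgebra ℂ G}
    (h : Acts ρ e) : ∃ σ : Subrepresentation ρ,
      σ.toRepresentation.IsIrreducible ∧ Acts σ.toRepresentation e := by
  obtain ⟨N, hN, v, hv⟩ := exists_simple_submodule (acts_iff.1 h)
  refine ⟨Subrepresentation.ofSubmodule' N, isIrreducible_ofSubmodule hN, ?_⟩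
  rw [acts_iff]
  refine ⟨(ofSubmoduleEquiv N).symm v, fun h0 => hv ?_⟩
  rw [← map_smul, (ofSubmoduleEquiv N).symm.map_eq_zero_iff] at h0
  exact h0

/-- An isomorphism of modules over the group algebra is an isomorphism of representations. -/
def equivOfLinearEquiv {ρ : Representation ℂ G V} {σ : Representation ℂ G W}
    (f : ρ.asModule ≃ₗ[MonoidAlgebra ℂ G] σ.asModule) : Representation.Equiv ρ σ :=
  ((IntertwiningMap.equivLinearMapAsModule ρ σ).symm f.toLinearMap).ofBijective f.bijective

theorem IsRankOne.nonempty_repEquiv {e : MonoidAlgebra ℂ G} (he : IsRankOne ℂ e)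
    {ρ : Representation ℂ G V} {σ : Representation ℂ G W} [ρ.IsIrreducible] [σ.IsIrreducible]
    (hρ : Acts ρ e) (hσ : Acts σ e) : Nonempty (Representation.Equiv ρ σ) := by
  obtain ⟨f⟩ := he.nonempty_equiv (acts_iff.1 hρ) (acts_iff.1 hσ)
  exact ⟨equivOfLinearEquiv f⟩

/-- An irreducible representation embeds in every representation on which a common rank one element
acts nontrivially. -/
theorem IsRankOne.exists_injective {e : MonoidAlgebra ℂ G} (he : IsRankOne ℂ e)
    {ρ : Representation ℂ G V} {σ : Representation ℂ G W} [ρ.IsIrreducible]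
    (hρ : Acts ρ e) (hσ : Acts σ e) : ∃ f : IntertwiningMap ρ σ, Function.Injective f := by
  obtain ⟨τ, hτ, hτe⟩ := exists_irreducible_sub hσ
  obtain ⟨f⟩ := he.nonempty_repEquiv hρ hτe
  exact ⟨(subtypeMap τ).comp f.toIntertwiningMap,
    (subtypeMap_injective τ).comp f.toLinearEquiv.injective⟩

variable [FiniteDimensional ℂ V] [FiniteDimensional ℂ W]

instance invertibleNatCard : Invertible (Nat.card G : ℂ) :=
  invertibleOfNonzero (by simp)

theorem charInner_character (ρ : Representation ℂ G V) (σ : Representation ℂ G W) :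
    charInner ρ.character σ.character = Module.finrank ℂ (IntertwiningMap σ ρ) := by
  rw [← card_inv_mul_sum_char_mul_char_eq_finrank, charInner, Nat.card_eq_fintype_card]

theorem charInner_ne_zero_of_injective {ρ : Representation ℂ G V} {σ : Representation ℂ G W}
    [σ.IsIrreducible] (f : IntertwiningMap σ ρ) (hf : Function.Injective f) :
    charInner ρ.character σ.character ≠ 0 := by
  rw [charInner_character]
  have hne : f ≠ 0 := by
    rintro rfl
    have := IsSimpleModule.nontrivial (MonoidAlgebra ℂ G) σ.asModule
    obtain ⟨x, hx⟩ := exists_ne (0 : σ.asModule)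
    exact hx (hf rfl)
  have : Nontrivial (IntertwiningMap σ ρ) := ⟨f, 0, hne⟩
  exact_mod_cast Module.finrank_pos.ne'

theorem exists_injective_of_charInner_ne_zero {ρ : Representation ℂ G V}
    {σ : Representation ℂ G W} [σ.IsIrreducible]
    (h : charInner ρ.character σ.character ≠ 0) :
    ∃ f : IntertwiningMap σ ρ, Function.Injective f := by
  rw [charInner_character] at h
  have hpos : 0 < Module.finrank ℂ (IntertwiningMap σ ρ) :=
    Nat.pos_of_ne_zero (by exact_mod_cast h)
  have := Module.finrank_pos_iff.1 hpos
  obtain ⟨f, hf⟩ := exists_ne (0 : IntertwiningMap σ ρ)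
  exact ⟨f, (IsIrreducible.injective_or_eq_zero f).resolve_right hf⟩

theorem nonempty_equiv_of_character_eq {ρ : Representation ℂ G V} {σ : Representation ℂ G W}
    [ρ.IsIrreducible] [σ.IsIrreducible] (h : ρ.character = σ.character) :
    Nonempty (Representation.Equiv σ ρ) := by
  by_contra hne
  have h1 := char_orthonormal ρ σ
  have h2 := char_orthonormal ρ ρ
  rw [if_neg hne, ← h] at h1
  rw [h1, if_pos ⟨Representation.Equiv.refl ρ⟩] at h2
  exact zero_ne_one h2

open scoped Classical in
theorem charInner_irr {φ ψ : G → ℂ} (hφ : φ ∈ Irr G) (hψ : ψ ∈ Irr G) :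
    charInner φ ψ = if φ = ψ then 1 else 0 := by
  obtain ⟨V, _, _, _, ρ, hρ, rfl⟩ := hφ
  obtain ⟨W, _, _, _, σ, hσ, rfl⟩ := hψ
  have h1 := char_orthonormal ρ σ
  rw [Nat.card_eq_fintype_card] at h1
  rw [charInner, h1]
  by_cases h : Nonempty (Representation.Equiv σ ρ)
  · rw [if_pos h, if_pos]
    exact (char_iso h.some).symm
  · rw [if_neg h, if_neg]
    exact fun heq => h (nonempty_equiv_of_character_eq heq)

theorem charInner_sum_left {ι : Type*} (s : Finset ι) (c : ι → ℂ) (f : ι → G → ℂ) (ψ : G → ℂ) :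
    charInner (∑ i ∈ s, c i • f i) ψ = ∑ i ∈ s, c i * charInner (f i) ψ := by
  simp only [charInner, Finset.sum_apply, Pi.smul_apply, smul_eq_mul, Finset.sum_mul,
    Finset.mul_sum]
  rw [Finset.sum_comm]
  refine Finset.sum_congr rfl fun i _ => Finset.sum_congr rfl fun g _ => by ring

variable (G) in
theorem linearIndependent_irr : LinearIndependent ℂ (Subtype.val : Irr G → G → ℂ) := by
  classical
  rw [linearIndependent_iff']
  intro s c hc i hi
  have h := charInner_sum_left s c (fun φ => (φ : G → ℂ)) i
  rw [hc] at h
  simp only [charInner_irr (Subtype.prop _) i.2, Subtype.val_inj] at h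
  rw [Finset.sum_eq_single i (by intro b _ hb; simp [hb]) (fun h => absurd hi h)] at h
  simpa [charInner] using h.symm

end Group

/-! ### Every irreducible representation of a symmetric group is met by a Young symmetrizer -/

section Symmetric

/-- The number of cells in row `s` of the diagram with column heights `m`. -/
def rowLength (m : Multiset ℕ) (s : ℕ) : ℕ := (m.filter fun p => s < p).card

theorem rowLength_add (m m' : Multiset ℕ) (s : ℕ) :
    rowLength (m + m') s = rowLength m s + rowLength m' s := by
  simp [rowLength]

theorem rowLength_eq (m : Multiset ℕ) (s : ℕ) :
    rowLength m s = m.count (s + 1) + rowLength m (s + 1) := by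
  induction m using Multiset.induction_on with
  | empty => rfl
  | cons a m ih =>
    simp only [rowLength, Multiset.filter_cons, Multiset.count_cons, Multiset.card_add] at ih ⊢
    rw [ih]
    rcases lt_trichotomy a (s + 1) with h | h | h
    · rw [if_neg (by omega), if_neg (by omega), if_neg (by omega)]; simp
    · subst h; simp; omega
    · rw [if_pos (by omega), if_neg (by omega), if_pos h]; simp; omega

theorem eq_of_rowLength_eq {n : ℕ} {lam mu : n.Partition}
    (h : ∀ s, rowLength lam.parts s = rowLength mu.parts s) : lam = mu := by
  rw [Nat.Partition.ext_iff]
  ext p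
  rcases p with _ | p
  · rw [Multiset.count_eq_zero_of_notMem, Multiset.count_eq_zero_of_notMem]
    · exact fun h0 => (mu.parts_pos h0).ne rfl
    · exact fun h0 => (lam.parts_pos h0).ne rfl
  · have h1 := rowLength_eq lam.parts p
    have h2 := rowLength_eq mu.parts p
    have h3 := h p
    have h4 := h (p + 1)
    omega

/-- The functions on `S_n` depending only on the cycle type. -/
def cycleTypeFunctions (n : ℕ) : Submodule ℂ (Equiv.Perm (Fin n) → ℂ) :=
  LinearMap.range (LinearMap.funLeft ℂ ℂ
    (fun g : Equiv.Perm (Fin n) => Equiv.Perm.partition g))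

theorem finrank_cycleTypeFunctions_le (n : ℕ) :
    Module.finrank ℂ (cycleTypeFunctions n) ≤ Fintype.card n.Partition := by
  have h := LinearMap.finrank_range_le (LinearMap.funLeft ℂ ℂ
    (fun g : Equiv.Perm (Fin n) => Equiv.Perm.partition g))
  rw [Module.finrank_fintype_fun_eq_card] at h
  exact h.trans_eq (Fintype.card_congr (Equiv.cast (by rw [Fintype.card_fin])))

theorem irr_subset_cycleTypeFunctions {n : ℕ} {φ : Equiv.Perm (Fin n) → ℂ}
    (hφ : φ ∈ Irr (Equiv.Perm (Fin n))) : φ ∈ cycleTypeFunctions n := by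
  classical
  obtain ⟨V, _, _, _, ρ, hρ, rfl⟩ := hφ
  refine ⟨fun p => if h : ∃ g : Equiv.Perm (Fin n), Equiv.Perm.partition g = p
    then ρ.character h.choose else 0, ?_⟩
  ext g
  have hex : ∃ g' : Equiv.Perm (Fin n), Equiv.Perm.partition g' = Equiv.Perm.partition g := ⟨g, rfl⟩
  rw [LinearMap.funLeft_apply, dif_pos hex]
  obtain ⟨c, hc⟩ := isConj_iff.1 (Equiv.Perm.partition_eq_of_isConj.2 hex.choose_spec)
  exact (char_conj ρ _ c).symm.trans (congrArg ρ.character hc)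

/-- There are at most as many irreducible characters as cycle types. -/
theorem finite_and_card_irr_le (n : ℕ) : Finite (Irr (Equiv.Perm (Fin n))) ∧
    Nat.card (Irr (Equiv.Perm (Fin n))) ≤ Fintype.card n.Partition := by
  have hli : LinearIndependent ℂ (fun φ : Irr (Equiv.Perm (Fin n)) =>
      (⟨φ.1, irr_subset_cycleTypeFunctions φ.2⟩ : cycleTypeFunctions n)) :=
    LinearIndependent.of_comp (cycleTypeFunctions n).subtype
      (linearIndependent_irr (Equiv.Perm (Fin n)))
  have hfin : Finite (Irr (Equiv.Perm (Fin n))) := hli.finite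
  refine ⟨hfin, ?_⟩
  have := Fintype.ofFinite (Irr (Equiv.Perm (Fin n)))
  rw [Nat.card_eq_fintype_card]
  exact hli.fintype_card_le_finrank.trans (finrank_cycleTypeFunctions_le n)

/-- Choose for each partition `lam` of `n` a diagram with column heights `lam`. The Young
symmetrizers of these diagrams detect all irreducible representations: they pick out pairwise
different ones, and there are no more irreducible characters than conjugacy classes. -/
theorem exists_acts_youngSym {n : ℕ} {κ : n.Partition → Type} [∀ lam, DecidableEq (κ lam)]
    (row : n.Partition → Fin n → ℕ) (col : ∀ lam, Fin n → κ lam)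
    (hD : ∀ lam, IsDiagram (row lam) (col lam))
    (hrow : ∀ (lam : n.Partition) s, #{i | row lam i = s} = rowLength lam.parts s)
    {V : Type} [AddCommGroup V] [Module ℂ V] [FiniteDimensional ℂ V]
    (ρ : Representation ℂ (Equiv.Perm (Fin n)) V) [hρ : ρ.IsIrreducible] :
    ∃ lam, Acts ρ (youngSym (row lam) (col lam)) := by
  have hreg : ∀ lam, Acts (leftRegular ℂ (Equiv.Perm (Fin n))) (youngSym (row lam) (col lam)) := by
    intro lam
    refine ⟨MonoidAlgebra.single 1 1, fun h0 => (hD lam).youngSym_ne_zero ?_⟩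
    have h1 := asAlgebraHom_ofMulAction_smul_eq_mul (k := ℂ) (youngSym (row lam) (col lam))
      (MonoidAlgebra.single (1 : Equiv.Perm (Fin n)) 1)
    rw [← MonoidAlgebra.one_def, mul_one] at h1
    rw [← h1]
    exact h0
  choose σ hσ hact using fun lam => exists_irreducible_sub (hreg lam)
  let F : n.Partition → Irr (Equiv.Perm (Fin n)) := fun lam =>
    ⟨(σ lam).toRepresentation.character, (σ lam).toSubmodule, inferInstance, inferInstance,
      inferInstance, (σ lam).toRepresentation, hσ lam, rfl⟩
  -- A simple module determines the row lengths of the symmetrizers meeting it.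
  have hF : Function.Injective F := by
    intro lam mu h
    have := hσ lam
    have := hσ mu
    obtain ⟨f⟩ := nonempty_equiv_of_character_eq (congrArg Subtype.val h)
    have hact' : Acts (σ lam).toRepresentation (youngSym (row mu) (col mu)) :=
      (hact mu).of_injective f.toIntertwiningMap f.toLinearEquiv.injective
    apply eq_of_rowLength_eq
    intro s
    rw [← hrow, ← hrow]
    exact (hD lam).card_row_eq (hD mu) (acts_iff.1 (hact lam)) (acts_iff.1 hact') s
  obtain ⟨hfin, hcard⟩ := finite_and_card_irr_le n
  have hbij : Function.Bijective F := by
    apply hF.bijective_of_nat_card_le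
    rwa [Nat.card_eq_fintype_card (α := n.Partition)]
  obtain ⟨lam, hlam⟩ := hbij.2 ⟨ρ.character, V, inferInstance, inferInstance, inferInstance, ρ, hρ, rfl⟩
  have := hσ lam
  obtain ⟨f⟩ := nonempty_equiv_of_character_eq (congrArg Subtype.val hlam).symm
  exact ⟨lam, (hact lam).of_injective f.toIntertwiningMap f.toLinearEquiv.injective⟩

end Symmetric

end

/-! ### Word modules -/

section

open Finset Representation
open scoped TensorProduct

section Words

variable {I : Type} [Fintype I] [DecidableEq I]

/-- The permutation representation of `Perm I` on the words `I → C`. -/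
def wordRep (I C : Type) : Representation ℂ (Equiv.Perm I) ((I → C) →₀ ℂ) where
  toFun g := Finsupp.lmapDomain ℂ ℂ fun f i => f (g⁻¹ i)
  map_one' := by
    ext f : 2
    simp
  map_mul' g h := by
    ext f : 2
    simp [Finsupp.mapDomain_single, Equiv.Perm.mul_apply]

theorem wordRep_single {C : Type} (g : Equiv.Perm I) (f : I → C) (r : ℂ) :
    wordRep I C g (Finsupp.single f r) = Finsupp.single (fun i => f (g⁻¹ i)) r :=
  Finsupp.mapDomain_single

theorem tabloidRep_eq_wordRep (n : ℕ) : tabloidRep n = wordRep (Fin n) ℕ := rfl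

theorem asAlgebraHom_rowSym {V : Type} [AddCommGroup V] [Module ℂ V] {α : Type*} [DecidableEq α]
    (ρ : Representation ℂ (Equiv.Perm I) V) (row : I → α) (v : V) :
    ρ.asAlgebraHom (rowSym row) v = ∑ g : Equiv.Perm I with ∀ i, row (g i) = row i, ρ g v := by
  simp [rowSym, map_sum]

theorem asAlgebraHom_colAnti {V : Type} [AddCommGroup V] [Module ℂ V] {κ : Type*} [DecidableEq κ]
    (ρ : Representation ℂ (Equiv.Perm I) V) (col : I → κ) (v : V) :
    ρ.asAlgebraHom (colAnti col) v = ∑ g : Equiv.Perm I with ∀ i, col (g i) = col i,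
      ((Equiv.Perm.sign g : ℤ) : ℂ) • ρ g v := by
  simp [colAnti, map_sum]

variable {κ : Type} [DecidableEq κ] {row : I → ℕ} {col : I → κ}

theorem acts_wordRep_of_injective {C : Type} (h : IsDiagram row col) {f : I → C}
    (hf : Function.Injective f) : Acts (wordRep I C) (youngSym row col) := by
  classical
  refine ⟨Finsupp.single f 1, fun h0 => h.youngSym_ne_zero ?_⟩
  have hexp : ∀ e : MonoidAlgebra ℂ (Equiv.Perm I), ∀ g : Equiv.Perm I,
      (wordRep I C).asAlgebraHom e (Finsupp.single f 1) (fun i => f (g⁻¹ i)) = e.coeff g := by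
    intro e g
    induction e using MonoidAlgebra.induction_linear with
    | zero => simp
    | add x y hx hy =>
      rw [map_add, LinearMap.add_apply, Finsupp.add_apply, hx, hy, MonoidAlgebra.coeff_add,
        Finsupp.add_apply]
    | single g' r =>
      rw [asAlgebraHom_single, LinearMap.smul_apply, wordRep_single, Finsupp.smul_single,
        MonoidAlgebra.coeff_single, Finsupp.single_apply, Finsupp.single_apply]
      have : (fun i => f (g'⁻¹ i)) = (fun i => f (g⁻¹ i)) ↔ g' = g := by
        constructor
        · intro hh
          rw [← inv_inj]
          ext i
          exact hf (congrFun hh i)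
        · rintro rfl; rfl
      simp only [this, smul_eq_mul, mul_one]
  ext g
  rw [← hexp, h0]
  simp

/-- Words in an alphabet `C` only see diagrams with at most `|C|` rows: antisymmetrizing a word
with a repeated letter in a column gives zero. -/
theorem row_lt_card_of_acts_wordRep {C : Type} [Fintype C] (h : IsDiagram row col)
    (hact : Acts (wordRep I C) (youngSym row col)) (i : I) : row i < Fintype.card C := by
  by_contra hi
  push Not at hi
  obtain ⟨v, hv⟩ := hact
  apply hv
  have hkill : (wordRep I C).asAlgebraHom (colAnti col) = 0 := by
    ext f : 2
    simp only [LinearMap.comp_apply, Finsupp.lsingle_apply, LinearMap.zero_apply]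
    -- The column of `i` has more cells than there are letters.
    have hch : ∀ r : Fin (Fintype.card C + 1), ∃ i', row i' = r ∧ col i' = col i := by
      intro r
      rcases (show (r : ℕ) ≤ row i by omega).lt_or_eq with hlt | heq
      · exact h.justified i r hlt
      · exact ⟨i, heq.symm, rfl⟩
    choose c hc1 hc2 using hch
    obtain ⟨r, r', hrr, heq⟩ := Fintype.exists_ne_map_eq_of_card_lt (fun r => f (c r)) (by simp)
    have hne : c r ≠ c r' := by
      intro hcc
      apply hrr
      apply Fin.ext
      rw [← hc1 r, ← hc1 r', hcc]
    have h1 : (wordRep I C).asAlgebraHom (MonoidAlgebra.single (Equiv.swap (c r) (c r')) 1)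
        (Finsupp.single f 1) = Finsupp.single f 1 := by
      rw [asAlgebraHom_single_one, wordRep_single, Equiv.swap_inv]
      congr 1
      funext x
      exact swap_preserves heq x
    have h2 := congrArg (fun e => (wordRep I C).asAlgebraHom e (Finsupp.single f 1))
      (colAnti_mul_swap hne ((hc2 r).trans (hc2 r').symm))
    simp only [map_mul, Module.End.mul_apply, map_neg, LinearMap.neg_apply, h1] at h2
    exact self_eq_neg.1 h2
  rw [youngSym, map_mul, Module.End.mul_apply, hkill, LinearMap.zero_apply, map_zero]

end Words

/-! ### Detecting Young symmetrizers on tensor products of word modules -/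

section Detection

variable {I : Type} [Fintype I] [DecidableEq I] {κ : Type} [DecidableEq κ]

/-- The value of the column-antisymmetrized tensor `t` under the substitution `z`: a word
`f : I → L` contributes the product over the columns of the minors of `z` with letters given
by `f`. For generic `z` this is the row-symmetrization of the antisymmetrized tensor, written as a
polynomial. -/
def minorSum {L R : Type*} [Fintype L] [DecidableEq L] [CommRing R] (row : I → ℕ) (col : I → κ)
    (z : ℕ → L → R) (t : (I → L) → ℤ) : R :=
  ∑ f : I → L, (t f : R) *
    (Matrix.of fun i j => if col i = col j then z (row i) (f j) else 0).det

theorem det_ite_eq_sum {R : Type*} [CommRing R] (col : I → κ) (m : I → I → R) :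
    (Matrix.of fun i j => if col i = col j then m i j else 0).det
      = ∑ q : Equiv.Perm I with ∀ i, col (q i) = col i,
        ((Equiv.Perm.sign q : ℤ) : R) * ∏ i, m (q i) i := by
  rw [Matrix.det_apply']
  rw [← Finset.sum_filter_add_sum_filter_not univ (fun q : Equiv.Perm I => ∀ i, col (q i) = col i)]
  rw [add_eq_left.2]
  · refine Finset.sum_congr rfl fun q hq => ?_
    congr 1
    refine Finset.prod_congr rfl fun i _ => ?_
    simp [(mem_filter.1 hq).2 i]
  · refine Finset.sum_eq_zero fun q hq => ?_
    have hq' := (mem_filter.1 hq).2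
    push Not at hq'
    obtain ⟨i, hi⟩ := hq'
    rw [Finset.prod_eq_zero (mem_univ i) (by simp [hi]), mul_zero]

/-- A linear functional that is invariant under row permutations detects the Young symmetrizer. -/
theorem acts_youngSym_of_functional {V : Type} [AddCommGroup V] [Module ℂ V]
    {ρ : Representation ℂ (Equiv.Perm I) V} {row : I → ℕ} {col : I → κ} (Φ : V →ₗ[ℂ] ℂ)
    (hΦ : ∀ p : Equiv.Perm I, (∀ i, row (p i) = row i) → ∀ v, Φ (ρ p v) = Φ v) (v : V)
    (hv : ∑ q : Equiv.Perm I with ∀ i, col (q i) = col i,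
      ((Equiv.Perm.sign q : ℤ) : ℂ) * Φ (ρ q v) ≠ 0) : Acts ρ (youngSym row col) := by
  refine ⟨v, fun h0 => hv ?_⟩
  have h1 := congrArg Φ h0
  rw [youngSym, map_mul, Module.End.mul_apply, asAlgebraHom_rowSym, map_sum, map_zero] at h1
  rw [Finset.sum_congr rfl (fun p hp => hΦ p (mem_filter.1 hp).2 _), Finset.sum_const,
    nsmul_eq_mul, mul_eq_zero] at h1
  have h2 := h1.resolve_left (Nat.cast_ne_zero.2 (Finset.card_ne_zero.2 ⟨1, by simp⟩))
  rw [asAlgebraHom_colAnti, map_sum] at h2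
  simpa only [map_smul, smul_eq_mul] using h2

/-- The functional on pairs of words sending `(f, c)` to the monomial `∏ i, z (row i) (f i) (c i)`. -/
def monomialFunctional {C₁ C₂ : Type} (row : I → ℕ) (z : ℕ → C₁ → C₂ → ℂ) :
    ((I → C₁) →₀ ℂ) ⊗[ℂ] ((I → C₂) →₀ ℂ) →ₗ[ℂ] ℂ :=
  TensorProduct.lift (Finsupp.linearCombination ℂ fun f : I → C₁ =>
    Finsupp.linearCombination ℂ fun c : I → C₂ => ∏ i, z (row i) (f i) (c i))

theorem monomialFunctional_single {C₁ C₂ : Type} (row : I → ℕ) (z : ℕ → C₁ → C₂ → ℂ)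
    (f : I → C₁) (c : I → C₂) (a b : ℂ) :
    monomialFunctional row z (Finsupp.single f a ⊗ₜ Finsupp.single c b)
      = a * b * ∏ i, z (row i) (f i) (c i) := by
  simp [monomialFunctional, mul_assoc]

theorem monomialFunctional_perm {C₁ C₂ : Type} (row : I → ℕ) (z : ℕ → C₁ → C₂ → ℂ)
    {p : Equiv.Perm I} (hp : ∀ i, row (p i) = row i)
    (x : ((I → C₁) →₀ ℂ) ⊗[ℂ] ((I → C₂) →₀ ℂ)) :
    monomialFunctional row z (TensorProduct.map (wordRep I C₁ p) (wordRep I C₂ p) x)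
      = monomialFunctional row z x := by
  rw [← LinearMap.comp_apply]
  congr 1
  ext f c
  simp only [TensorProduct.AlgebraTensorModule.curry_apply, LinearMap.coe_comp,
    Function.comp_apply, Finsupp.lsingle_apply, TensorProduct.curry_apply,
    LinearMap.coe_restrictScalars, TensorProduct.map_tmul, wordRep_single,
    monomialFunctional_single, one_mul]
  rw [← Equiv.prod_comp p]
  simp [hp]

/-- If two representations map to word modules, hitting the tensors `v` and `y`, and the
antisymmetrization of `v ⊗ y` does not vanish under some substitution `z`, then the Young symmetrizer
acts nontrivially on the tensor product of the representations. -/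
theorem acts_tprod_of_minorSum_ne_zero {U₁ U₂ : Type} [AddCommGroup U₁] [Module ℂ U₁]
    [AddCommGroup U₂] [Module ℂ U₂] {σ₁ : Representation ℂ (Equiv.Perm I) U₁}
    {σ₂ : Representation ℂ (Equiv.Perm I) U₂} {C₁ C₂ D₁ D₂ : Type} [Fintype C₁] [Fintype C₂]
    [DecidableEq C₁] [DecidableEq C₂]
    (j₁ : IntertwiningMap σ₁ (wordRep I D₁)) (j₂ : IntertwiningMap σ₂ (wordRep I D₂))
    {ι₁ : C₁ → D₁} {ι₂ : C₂ → D₂} {π₁ : D₁ → C₁} {π₂ : D₂ → C₂}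
    (h₁ : Function.LeftInverse π₁ ι₁) (h₂ : Function.LeftInverse π₂ ι₂)
    {v : (I → C₁) → ℤ} {y : (I → C₂) → ℤ}
    (hv : ∃ u, j₁ u = ∑ f, Finsupp.single (fun i => ι₁ (f i)) (v f : ℂ))
    (hy : ∃ u, j₂ u = ∑ c, Finsupp.single (fun i => ι₂ (c i)) (y c : ℂ))
    {row : I → ℕ} {col : I → κ} {z : ℕ → C₁ × C₂ → ℂ}
    (hz : minorSum row col z (fun f => v (fun i => (f i).1) * y (fun i => (f i).2)) ≠ 0) :
    Acts (tprod σ₁ σ₂) (youngSym row col) := by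
  obtain ⟨u₁, hu₁⟩ := hv
  obtain ⟨u₂, hu₂⟩ := hy
  let z' : ℕ → D₁ → D₂ → ℂ := fun r a b => z r (π₁ a, π₂ b)
  let Φ : U₁ ⊗[ℂ] U₂ →ₗ[ℂ] ℂ :=
    monomialFunctional row z' ∘ₗ TensorProduct.map j₁.toLinearMap j₂.toLinearMap
  have hΦ : ∀ (q : Equiv.Perm I) (x : U₁ ⊗[ℂ] U₂), Φ (tprod σ₁ σ₂ q x) = monomialFunctional row z'
      (TensorProduct.map (wordRep I D₁ q) (wordRep I D₂ q)
        (TensorProduct.map j₁.toLinearMap j₂.toLinearMap x)) := by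
    intro q x
    simp only [Φ, LinearMap.comp_apply, Representation.tprod_apply]
    congr 1
    rw [← LinearMap.comp_apply, ← LinearMap.comp_apply, ← TensorProduct.map_comp,
      ← TensorProduct.map_comp, j₁.isIntertwining', j₂.isIntertwining']
  refine acts_youngSym_of_functional Φ (fun p hp x => ?_) (u₁ ⊗ₜ u₂) ?_
  · rw [hΦ, monomialFunctional_perm row z' hp]
    rfl
  · convert hz using 1
    unfold minorSum
    simp only [det_ite_eq_sum, Finset.mul_sum]
    rw [Finset.sum_comm]
    refine Finset.sum_congr rfl fun q _ => ?_
    rw [hΦ, TensorProduct.map_tmul]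
    have e1 : j₁.toLinearMap u₁ = _ := hu₁
    have e2 : j₂.toLinearMap u₂ = _ := hu₂
    rw [e1, e2, TensorProduct.map_tmul, map_sum, map_sum, TensorProduct.sum_tmul, map_sum]
    simp only [TensorProduct.tmul_sum, map_sum, wordRep_single, monomialFunctional_single]
    rw [← (Equiv.arrowProdEquivProdArrow I (fun _ => C₁) (fun _ => C₂)).symm.sum_comp,
      Fintype.sum_prod_type, Finset.mul_sum]
    refine Finset.sum_congr rfl fun f _ => ?_
    rw [Finset.mul_sum]
    refine Finset.sum_congr rfl fun c _ => ?_
    have hprod : ∏ i, z' (row i) (ι₁ (f (q⁻¹ i))) (ι₂ (c (q⁻¹ i)))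
        = ∏ i, z (row (q i)) (f i, c i) := by
      rw [← Equiv.prod_comp q]
      simp [z', h₁ _, h₂ _]
    rw [hprod]
    simp only [Equiv.arrowProdEquivProdArrow, Equiv.coe_fn_symm_mk]
    push_cast
    ring

/-- If an element acts nontrivially on `ρ ⊗ τ`, it already does on `ρ ⊗ σ` for an irreducible
subrepresentation `σ` of `τ`. -/
theorem exists_irreducible_sub_tprod {G : Type} [Group G] [Fintype G] {V W : Type}
    [AddCommGroup V] [Module ℂ V] [AddCommGroup W] [Module ℂ W]
    {ρ : Representation ℂ G V} {τ : Representation ℂ G W} {e : MonoidAlgebra ℂ G}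
    (h : Acts (tprod ρ τ) e) : ∃ σ : Subrepresentation τ,
      σ.toRepresentation.IsIrreducible ∧ Acts (tprod ρ σ.toRepresentation) e := by
  by_contra! hcon
  let L : V → W →ₗ[ℂ] V ⊗[ℂ] W := fun v =>
    (tprod ρ τ).asAlgebraHom e ∘ₗ TensorProduct.mk ℂ V W v
  have key : ∀ (w : τ.asModule) (v : V), L v w = 0 := by
    intro w v
    have hmem : w ∈ sSup {m : Submodule (MonoidAlgebra ℂ G) τ.asModule |
        IsSimpleModule (MonoidAlgebra ℂ G) m} := by
      rw [IsSemisimpleModule.sSup_simples_eq_top]; trivial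
    rw [sSup_eq_iSup'] at hmem
    induction hmem using Submodule.iSup_induction' with
    | mem N x hx =>
      have hN := hcon _ (isIrreducible_ofSubmodule N.2)
      simp only [Acts, not_exists, not_not] at hN
      have h1 := intertwining_asAlgebraHom
        (IntertwiningMap.lTensor ρ (subtypeMap (Subrepresentation.ofSubmodule' N.1))) e
        (v ⊗ₜ ⟨x, hx⟩)
      rw [hN, map_zero, IntertwiningMap.lTensor_apply] at h1
      exact h1.symm
    | zero => exact (L v).map_zero
    | add x y _ _ hx hy =>
      exact ((L v).map_add x y).trans ((congrArg₂ (· + ·) hx hy).trans (add_zero 0))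
  obtain ⟨x, hx⟩ := h
  refine hx ?_
  clear hx
  induction x using TensorProduct.induction_on with
  | zero => rw [map_zero]
  | tmul v w => exact key w v
  | add x y hx hy => rw [map_add, hx, hy, add_zero]

end Detection

end

/-! ### Matchings and configurations of columns -/

section

open Finset

/-- The tensor in `(ℂ²)^{⊗ I}` attached to a partial matching of `I` with pairs indexed by `P` and
unmatched points indexed by `S`: the product of the alternating form over the pairs and of the
first basis vector over the unmatched points. -/
def matchVec {I P S : Type} [Fintype P] [Fintype S] (E : (P × Fin 2) ⊕ S ≃ I) (f : I → Fin 2) : ℤ :=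
  (∏ p, (((f (E (.inl (p, 1)))).val : ℤ) - ((f (E (.inl (p, 0)))).val : ℤ))) *
    ∏ j, if f (E (.inr j)) = 0 then 1 else 0

/-- `v` is the tensor of a matching with `s` unmatched points. -/
def IsMatching (s : ℕ) (I : Type) (v : (I → Fin 2) → ℤ) : Prop :=
  ∃ (P S : Type) (_ : Fintype P) (_ : Fintype S) (E : (P × Fin 2) ⊕ S ≃ I),
    Fintype.card S = s ∧ v = matchVec E

theorem IsMatching.sum {s s' : ℕ} {I J : Type} {v : (I → Fin 2) → ℤ} {w : (J → Fin 2) → ℤ}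
    (hv : IsMatching s I v) (hw : IsMatching s' J w) :
    IsMatching (s + s') (I ⊕ J) (fun f => v (f ∘ Sum.inl) * w (f ∘ Sum.inr)) := by
  obtain ⟨P, S, _, _, E, hS, rfl⟩ := hv
  obtain ⟨P', S', _, _, E', hS', rfl⟩ := hw
  refine ⟨P ⊕ P', S ⊕ S', inferInstance, inferInstance,
    ((Equiv.sumCongr (Equiv.sumProdDistrib P P' (Fin 2)) (Equiv.refl _)).trans
      (Equiv.sumSumSumComm _ _ _ _)).trans (Equiv.sumCongr E E'), by simp [hS, hS'], ?_⟩
  funext f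
  simp only [matchVec, Fintype.prod_sum_type]
  simp
  ring

theorem IsMatching.equiv {s : ℕ} {I J : Type} {v : (I → Fin 2) → ℤ}
    (hv : IsMatching s I v) (e : I ≃ J) : IsMatching s J (fun f => v (f ∘ e)) := by
  obtain ⟨P, S, _, _, E, hS, rfl⟩ := hv
  exact ⟨P, S, inferInstance, inferInstance, E.trans e, hS, rfl⟩

section MinorSum

variable {I J : Type} [Fintype I] [DecidableEq I] [Fintype J] [DecidableEq J]
  {κ κ' : Type} [DecidableEq κ] [DecidableEq κ'] {L : Type} [Fintype L] [DecidableEq L]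

theorem map_minorSum {R S : Type*} [CommRing R] [CommRing S] (φ : R →+* S) (row : I → ℕ)
    (col : I → κ) (z : ℕ → L → R) (t : (I → L) → ℤ) :
    φ (minorSum row col z t) = minorSum row col (fun r l => φ (z r l)) t := by
  unfold minorSum
  rw [map_sum]
  refine Finset.sum_congr rfl fun f _ => ?_
  rw [map_mul, map_intCast, RingHom.map_det]
  congr 2
  ext i j
  simp only [RingHom.mapMatrix_apply, Matrix.map_apply, Matrix.of_apply]
  split_ifs <;> simp

theorem det_sum_blocks {R : Type*} [CommRing R] (col : I → κ) (col' : J → κ')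
    (m : I ⊕ J → I ⊕ J → R) :
    (Matrix.of fun i j => if Sum.map col col' i = Sum.map col col' j then m i j else 0).det
      = (Matrix.of fun i j => if col i = col j then m (.inl i) (.inl j) else 0).det
        * (Matrix.of fun i j => if col' i = col' j then m (.inr i) (.inr j) else 0).det := by
  rw [← Matrix.det_fromBlocks_zero₂₁ _ 0]
  congr 1
  ext i j
  rcases i with i | i <;> rcases j with j | j <;> simp

theorem minorSum_sum {R : Type*} [CommRing R] (row : I → ℕ) (row' : J → ℕ) (col : I → κ)
    (col' : J → κ') (z : ℕ → L → R) (t : (I → L) → ℤ) (t' : (J → L) → ℤ) :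
    minorSum (Sum.elim row row') (Sum.map col col') z (fun f => t (f ∘ Sum.inl) * t' (f ∘ Sum.inr))
      = minorSum row col z t * minorSum row' col' z t' := by
  unfold minorSum
  rw [Finset.sum_mul_sum, ← Finset.sum_product', Finset.univ_product_univ,
    ← (Equiv.sumArrowEquivProdArrow I J L).symm.sum_comp]
  refine Finset.sum_congr rfl fun f _ => ?_
  rw [det_sum_blocks col col' (fun i j => z (Sum.elim row row' i)
    ((Equiv.sumArrowEquivProdArrow I J L).symm f j))]
  simp only [Sum.elim_inl, Sum.elim_inr]
  have h3 : ∀ j, (Equiv.sumArrowEquivProdArrow I J L).symm f (Sum.inl j) = f.1 j := fun _ => rfl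
  have h4 : ∀ j, (Equiv.sumArrowEquivProdArrow I J L).symm f (Sum.inr j) = f.2 j := fun _ => rfl
  have h1 : (Equiv.sumArrowEquivProdArrow I J L).symm f ∘ Sum.inl = f.1 := rfl
  have h2 : (Equiv.sumArrowEquivProdArrow I J L).symm f ∘ Sum.inr = f.2 := rfl
  rw [h1, h2]
  simp only [h3, h4]
  push_cast
  ring

theorem minorSum_equiv {R : Type*} [CommRing R] (row : I → ℕ) (col : I → κ) (z : ℕ → L → R)
    (t : (I → L) → ℤ) (e : I ≃ J) :
    minorSum (row ∘ e.symm) (col ∘ e.symm) z (fun f => t (f ∘ e)) = minorSum row col z t := by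
  unfold minorSum
  rw [← (e.arrowCongr (Equiv.refl L)).sum_comp]
  refine Finset.sum_congr rfl fun f _ => ?_
  congr 1
  · have : (e.arrowCongr (Equiv.refl L)) f ∘ e = f := by
      funext i
      simp
    simp only [this]
  · rw [← Matrix.det_submatrix_equiv_self e]
    congr 1
    ext i j
    simp

/-- Nonvanishing antisymmetrizations can be specialized simultaneously, polynomial rings being
domains. -/
theorem exists_specialization {row : I → ℕ} {col : I → κ} {row' : J → ℕ} {col' : J → κ'}
    {t : (I → L) → ℤ} {t' : (J → L) → ℤ} {z z' : ℕ → L → ℂ}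
    (h : minorSum row col z t ≠ 0) (h' : minorSum row' col' z' t' ≠ 0) :
    ∃ w : ℕ → L → ℂ, minorSum row col w t * minorSum row' col' w t' ≠ 0 := by
  let X : ℕ → L → MvPolynomial (ℕ × L) ℂ := fun r l => MvPolynomial.X (r, l)
  have hev : ∀ (w : ℕ → L → ℂ) (r : ℕ) (l : L),
      MvPolynomial.eval (fun x : ℕ × L => w x.1 x.2) (X r l) = w r l := fun w r l => by simp [X]
  have h1 : minorSum row col X t ≠ 0 := by
    intro h0
    apply h
    have := map_minorSum (MvPolynomial.eval (fun x : ℕ × L => z x.1 x.2)) row col X t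
    simp only [hev, h0, map_zero] at this
    exact this.symm
  have h2 : minorSum row' col' X t' ≠ 0 := by
    intro h0
    apply h'
    have := map_minorSum (MvPolynomial.eval (fun x : ℕ × L => z' x.1 x.2)) row' col' X t'
    simp only [hev, h0, map_zero] at this
    exact this.symm
  by_contra! hcon
  apply mul_ne_zero h1 h2
  refine MvPolynomial.funext fun x => ?_
  have := hcon fun r l => x (r, l)
  rw [map_mul, map_minorSum, map_minorSum, map_zero]
  simpa [X] using this

end MinorSum

theorem IsDiagram.sum {I J κ κ' : Type*} {row : I → ℕ} {col : I → κ} {row' : J → ℕ} {col' : J → κ'}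
    (h : IsDiagram row col) (h' : IsDiagram row' col') :
    IsDiagram (Sum.elim row row') (Sum.map col col') where
  inj := by
    rintro (i | i) (j | j) hij
    · simp only [Sum.elim_inl, Sum.map_inl, Prod.mk.injEq, Sum.inl.injEq] at hij
      exact congrArg _ (h.inj (Prod.ext hij.1 hij.2))
    · simp at hij
    · simp at hij
    · simp only [Sum.elim_inr, Sum.map_inr, Prod.mk.injEq, Sum.inr.injEq] at hij
      exact congrArg _ (h'.inj (Prod.ext hij.1 hij.2))
  justified := by
    rintro (i | i) r hr
    · obtain ⟨i', h1, h2⟩ := h.justified i r hr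
      exact ⟨.inl i', h1, congrArg Sum.inl h2⟩
    · obtain ⟨i', h1, h2⟩ := h'.justified i r hr
      exact ⟨.inr i', h1, congrArg Sum.inr h2⟩

theorem sum_range_rowLength (m : Multiset ℕ) {N : ℕ} (hN : ∀ p ∈ m, p ≤ N) :
    ∑ r ∈ range N, rowLength m r = m.sum := by
  induction m using Multiset.induction_on with
  | empty => simp [rowLength]
  | cons a m ih =>
    have ha : a ≤ N := hN a (by simp)
    rw [← Multiset.singleton_add, Multiset.sum_add, Multiset.sum_singleton,
      ← ih fun p hp => hN p (by simp [hp])]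
    simp only [rowLength_add, Finset.sum_add_distrib]
    congr 1
    have h1 : ∀ r, rowLength {a} r = if r < a then 1 else 0 := by
      intro r
      unfold rowLength
      split_ifs with h <;> simp [Multiset.filter_singleton, h]
    simp only [h1]
    rw [← Finset.sum_filter, Finset.sum_const, smul_eq_mul, mul_one]
    rw [show (range N).filter (fun r => r < a) = range a by ext r; simp; omega, card_range]

/-- The column heights `m` carry a configuration: a diagram with columns of these heights, a
matching `v` of its cells with `s` unmatched points and a tensor `y` from the class `Y` such that the
tensor `v ⊗ y` has a nonvanishing antisymmetrization along the columns. -/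
def HasConfig {C : Type} [Fintype C] [DecidableEq C] (Y : ℕ → ∀ I : Type, ((I → C) → ℤ) → Prop)
    (s : ℕ) (m : Multiset ℕ) : Prop :=
  ∃ (I κ : Type) (_ : Fintype I) (_ : DecidableEq I) (_ : DecidableEq κ) (row : I → ℕ) (col : I → κ),
    IsDiagram row col ∧ (∀ r, #{i | row i = r} = rowLength m r) ∧
    ∃ v y, IsMatching s I v ∧ Y s I y ∧ ∃ z : ℕ → Fin 2 × C → ℂ,
      minorSum row col z (fun f => v (fun i => (f i).1) * y (fun i => (f i).2)) ≠ 0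

section HasConfig

variable {C : Type} [Fintype C] [DecidableEq C] {Y : ℕ → ∀ I : Type, ((I → C) → ℤ) → Prop}

theorem HasConfig.add (hY : ∀ {s s' : ℕ} {I J : Type} {y : (I → C) → ℤ} {y' : (J → C) → ℤ},
      Y s I y → Y s' J y' → Y (s + s') (I ⊕ J) (fun f => y (f ∘ Sum.inl) * y' (f ∘ Sum.inr)))
    {s s' : ℕ} {m m' : Multiset ℕ} (h : HasConfig Y s m) (h' : HasConfig Y s' m') :
    HasConfig Y (s + s') (m + m') := by
  obtain ⟨I, κ, _, _, _, row, col, hD, hrow, v, y, hv, hy, z, hz⟩ := h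
  obtain ⟨J, κ', _, _, _, row', col', hD', hrow', v', y', hv', hy', z', hz'⟩ := h'
  obtain ⟨w, hw⟩ := exists_specialization hz hz'
  refine ⟨I ⊕ J, κ ⊕ κ', inferInstance, inferInstance, inferInstance, _, _, hD.sum hD', ?_,
    _, _, hv.sum hv', hY hy hy', w, ?_⟩
  · intro r
    rw [rowLength_add, ← hrow, ← hrow', Finset.card_filter, Finset.card_filter, Finset.card_filter,
      Fintype.sum_sum_type]
    rfl
  · rw [← minorSum_sum] at hw
    convert hw using 2
    funext f
    simp only [Function.comp_def]
    ring

/-- Configurations can be transported to `Fin n`. -/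
theorem HasConfig.exists_fin {n : ℕ}
    (hY : ∀ {s : ℕ} {I J : Type} {y : (I → C) → ℤ}, Y s I y → ∀ e : I ≃ J,
      Y s J (fun f => y (f ∘ e)))
    {s : ℕ} {m : Multiset ℕ} (h : HasConfig Y s m) (hm : m.sum = n) :
    ∃ (κ : Type) (_ : DecidableEq κ) (row : Fin n → ℕ) (col : Fin n → κ),
      IsDiagram row col ∧ (∀ r, #{i | row i = r} = rowLength m r) ∧
      ∃ v y, IsMatching s (Fin n) v ∧ Y s (Fin n) y ∧ ∃ z : ℕ → Fin 2 × C → ℂ,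
        minorSum row col z (fun f => v (fun i => (f i).1) * y (fun i => (f i).2)) ≠ 0 := by
  obtain ⟨I, κ, _, _, _, row, col, hD, hrow, v, y, hv, hy, z, hz⟩ := h
  have hcard : Fintype.card I = n := by
    obtain ⟨N, hN⟩ : ∃ N, ∀ i, row i < N :=
      ⟨univ.sup row + 1, fun i => Nat.lt_succ_of_le (Finset.le_sup (mem_univ i))⟩
    obtain ⟨M, hM1, hM2⟩ : ∃ M, N ≤ M ∧ ∀ p ∈ m, p ≤ M :=
      ⟨N + m.sum, by omega, fun p hp => (Multiset.le_sum_of_mem hp).trans (by omega)⟩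
    rw [← hm, ← sum_range_rowLength m hM2]
    simp only [← hrow]
    rw [← Finset.card_univ, Finset.card_eq_sum_card_fiberwise (f := row) (t := range M)]
    intro i _
    simpa using (hN i).trans_le hM1
  let e : I ≃ Fin n := Fintype.equivFinOfCardEq hcard
  refine ⟨κ, inferInstance, row ∘ e.symm, col ∘ e.symm, hD.comp_equiv e.symm, ?_, _, _, hv.equiv e,
    hY hy e, z, ?_⟩
  · intro r
    rw [← hrow]
    refine Finset.card_equiv e.symm fun i => ?_
    simp
  · rw [← minorSum_equiv row col z _ e] at hz
    exact hz

end HasConfig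

end

/-! ### Configurations with one free tensor factor -/

section

open Finset

section Expansion

variable {I P S : Type} [Fintype I] [DecidableEq I] [Fintype P] [DecidableEq P] [Fintype S]
  [DecidableEq S]

/-- The word of a matching in which the pair `p` reads `o p 0, o p 1` and unmatched points read
`0`. -/
def matchWord (E : (P × Fin 2) ⊕ S ≃ I) (o : P → Equiv.Perm (Fin 2)) (i : I) : Fin 2 :=
  Sum.elim (fun x => o x.1 x.2) (fun _ => 0) (E.symm i)

/-- Expansion of a matching vector: each pair reads `0, 1` or, with a sign, `1, 0`. -/
theorem sum_matchVec_mul {R : Type*} [CommRing R] (E : (P × Fin 2) ⊕ S ≃ I)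
    (D : (I → Fin 2) → R) :
    ∑ f, (matchVec E f : R) * D f = ∑ o : P → Equiv.Perm (Fin 2),
      ((∏ p, (Equiv.Perm.sign (o p) : ℤ) : ℤ) : R) * D (matchWord E o) := by
  symm
  refine Fintype.sum_of_injective (matchWord E) ?_ _ _ ?_ ?_
  · intro o o' h
    funext p
    ext e : 1
    have := congrFun h (E (.inl (p, e)))
    simpa [matchWord] using this
  · intro f hf
    have : matchVec E f = 0 := by
      by_contra hne
      apply hf
      unfold matchVec at hne
      obtain ⟨h1, h2⟩ := mul_ne_zero_iff.1 hne
      rw [Finset.prod_ne_zero_iff] at h1 h2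
      refine ⟨fun p => if f (E (.inl (p, 0))) = 0 then 1 else Equiv.swap 0 1, ?_⟩
      funext i
      obtain ⟨x, rfl⟩ := E.surjective i
      rcases x with ⟨p, e⟩ | j
      · have h3 := h1 p (mem_univ p)
        simp only [matchWord, Equiv.symm_apply_apply, Sum.elim_inl]
        generalize h0 : f (E (Sum.inl (p, 0))) = a at *
        generalize h0' : f (E (Sum.inl (p, 1))) = b at *
        fin_cases e <;> simp only [Fin.zero_eta, Fin.mk_one, h0, h0'] <;> clear h0 h0' <;>
          revert h3 <;> revert a b <;> decide
      · have h3 := h2 j (mem_univ j)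
        simp only [matchWord, Equiv.symm_apply_apply, Sum.elim_inr]
        by_contra h4
        exact h3 (if_neg (Ne.symm h4))
    rw [this, Int.cast_zero, zero_mul]
  · intro o
    congr 2
    unfold matchVec
    simp only [matchWord, Equiv.symm_apply_apply, Sum.elim_inl, Sum.elim_inr, if_true,
      Finset.prod_const_one, mul_one]
    refine Finset.prod_congr rfl fun p _ => ?_
    generalize o p = g
    revert g
    decide

theorem det_comp_perm {R : Type*} [CommRing R] {κ L : Type} [DecidableEq κ] (col : I → κ)
    (z : I → L → R) (f : I → L) (π : Equiv.Perm I) (hπ : ∀ i, col (π i) = col i) :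
    (Matrix.of fun i j => if col i = col j then z i (f (π j)) else 0).det
      = ((Equiv.Perm.sign π : ℤ) : R)
        * (Matrix.of fun i j => if col i = col j then z i (f j) else 0).det := by
  rw [← Matrix.det_permute']
  congr 1
  ext i j
  simp [hπ]

/-- If the pairs in `P₁` each lie in a column and do not change the coloring `c`, they contribute equal
terms to the antisymmetrization. -/
theorem sum_matchVec_mul_det {R : Type*} [CommRing R] {κ C P₁ P₂ : Type} [DecidableEq κ] [Fintype P₁]
    [DecidableEq P₁] [Fintype P₂] [DecidableEq P₂] (E : ((P₁ ⊕ P₂) × Fin 2) ⊕ S ≃ I) (col : I → κ)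
    (c : I → C) (z : I → Fin 2 × C → R)
    (hcol : ∀ p e, col (E (.inl (.inl p, e))) = col (E (.inl (.inl p, 0))))
    (hc : ∀ p e, c (E (.inl (.inl p, e))) = c (E (.inl (.inl p, 0)))) :
    ∑ f, (matchVec E f : R) *
        (Matrix.of fun i j => if col i = col j then z i (f j, c j) else 0).det
      = Fintype.card (P₁ → Equiv.Perm (Fin 2)) * ∑ o : P₂ → Equiv.Perm (Fin 2),
        ((∏ p, (Equiv.Perm.sign (o p) : ℤ) : ℤ) : R) *
          (Matrix.of fun i j => if col i = col j then
            z i (matchWord E (Sum.elim (fun _ => 1) o) j, c j) else 0).det := by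
  rw [sum_matchVec_mul, ← (Equiv.sumArrowEquivProdArrow P₁ P₂ _).symm.sum_comp,
    Fintype.sum_prod_type]
  have hterm : ∀ (o₁ : P₁ → Equiv.Perm (Fin 2)) (o₂ : P₂ → Equiv.Perm (Fin 2)),
      ((∏ p, (Equiv.Perm.sign ((Equiv.sumArrowEquivProdArrow P₁ P₂ _).symm (o₁, o₂) p) : ℤ) : ℤ) : R)
        * (Matrix.of fun i j => if col i = col j then z i (matchWord E
            ((Equiv.sumArrowEquivProdArrow P₁ P₂ _).symm (o₁, o₂)) j, c j) else 0).det
      = ((∏ p, (Equiv.Perm.sign (o₂ p) : ℤ) : ℤ) : R) *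
          (Matrix.of fun i j => if col i = col j then
            z i (matchWord E (Sum.elim (fun _ => 1) o₂) j, c j) else 0).det := by
    intro o₁ o₂
    -- `π` swaps the pairs in `P₁` according to `o₁`: it changes the word, but neither the columns nor
    -- the colors, and its sign cancels the one from the matching vector.
    let π : Equiv.Perm I := E.permCongr (Equiv.sumCongr
      (Equiv.prodCongrRight (Sum.elim o₁ (fun _ => 1))) (Equiv.refl S))
    have hπ1 : ∀ p e, π (E (.inl (.inl p, e))) = E (.inl (.inl p, o₁ p e)) := by
      intro p e; simp [π, Equiv.permCongr_apply]
    have hπ2 : ∀ p e, π (E (.inl (.inr p, e))) = E (.inl (.inr p, e)) := by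
      intro p e; simp [π, Equiv.permCongr_apply]
    have hπ3 : ∀ j, π (E (.inr j)) = E (.inr j) := by
      intro j; simp [π, Equiv.permCongr_apply]
    have hsign : Equiv.Perm.sign π = ∏ p, Equiv.Perm.sign (o₁ p) := by
      simp only [π, Equiv.Perm.sign_permCongr]
      change Equiv.Perm.sign (Equiv.Perm.sumCongr _ (1 : Equiv.Perm S)) = _
      rw [Equiv.Perm.sign_sumCongr, Equiv.Perm.sign_prodCongrRight]
      simp
    have hcolπ : ∀ i, col (π i) = col i := by
      intro i
      obtain ⟨x, rfl⟩ := E.surjective i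
      rcases x with ⟨p | p, e⟩ | j
      · rw [hπ1, hcol, hcol p e]
      · rw [hπ2]
      · rw [hπ3]
    have hcπ : ∀ i, c (π i) = c i := by
      intro i
      obtain ⟨x, rfl⟩ := E.surjective i
      rcases x with ⟨p | p, e⟩ | j
      · rw [hπ1, hc, hc p e]
      · rw [hπ2]
      · rw [hπ3]
    have hword : ∀ i, matchWord E ((Equiv.sumArrowEquivProdArrow P₁ P₂ _).symm (o₁, o₂)) i
        = matchWord E (Sum.elim (fun _ => 1) o₂) (π i) := by
      intro i
      obtain ⟨x, rfl⟩ := E.surjective i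
      rcases x with ⟨p | p, e⟩ | j
      · rw [hπ1]; simp [matchWord, Equiv.sumArrowEquivProdArrow]
      · rw [hπ2]; simp [matchWord, Equiv.sumArrowEquivProdArrow]
      · rw [hπ3]; simp [matchWord]
    have h1 := det_comp_perm col z (fun i => (matchWord E (Sum.elim (fun _ => 1) o₂) i, c i)) π hcolπ
    simp only [hcπ, ← hword] at h1
    rw [h1, hsign, Fintype.prod_sum_type]
    have h2 : ((∏ p, (Equiv.Perm.sign (o₁ p) : ℤ) : ℤ) : R)
        * (((∏ p, Equiv.Perm.sign (o₁ p) : ℤˣ) : ℤ) : R) = 1 := by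
      rw [← Int.cast_mul, Units.coe_prod, ← Units.coe_prod, ← Units.val_mul, Int.units_mul_self]
      simp
    simp only [Equiv.sumArrowEquivProdArrow, Equiv.coe_fn_symm_mk, Sum.elim_inl, Sum.elim_inr]
    rw [Int.cast_mul]
    linear_combination (((∏ p, (Equiv.Perm.sign (o₂ p) : ℤ) : ℤ) : R) *
          (Matrix.of fun i j => if col i = col j then
            z i (matchWord E (Sum.elim (fun _ => 1) o₂) j, c j) else 0).det) * h2
  simp only [hterm]
  rw [Finset.sum_const, nsmul_eq_mul, Finset.card_univ]

end Expansion

/-- A tensor with a free second factor concentrated in the coloring `c`. -/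
theorem minorSum_coloring {R : Type*} [CommRing R] {I κ C : Type} [Fintype I] [DecidableEq I]
    [DecidableEq κ] [Fintype C] [DecidableEq C] (row : I → ℕ) (col : I → κ) (z : ℕ → Fin 2 × C → R)
    (v : (I → Fin 2) → ℤ) (c : I → C) :
    minorSum row col z (fun f => v (fun i => (f i).1) * if (fun i => (f i).2) = c then 1 else 0)
      = ∑ f, (v f : R) *
        (Matrix.of fun i j => if col i = col j then z (row i) (f j, c j) else 0).det := by
  unfold minorSum
  rw [← (Equiv.arrowProdEquivProdArrow I (fun _ => Fin 2) (fun _ => C)).symm.sum_comp,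
    Fintype.sum_prod_type]
  refine Finset.sum_congr rfl fun f _ => ?_
  rw [Finset.sum_eq_single c]
  · simp [Equiv.arrowProdEquivProdArrow]
  · intro b _ hb
    have : (fun i => ((Equiv.arrowProdEquivProdArrow I (fun _ => Fin 2) (fun _ => C)).symm
      (f, b) i).2) ≠ c := hb
    simp only [this, if_false, mul_zero, Int.cast_zero, zero_mul]
  · simp

/-- A Vandermonde determinant with rows indexed by exponents. -/
theorem det_pow_ne_zero {K : Type} [Fintype K] [DecidableEq K] {row : K → ℕ}
    (hinj : Function.Injective row) (hlt : ∀ i, row i < Fintype.card K) {x : K → ℂ}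
    (hx : Function.Injective x) : (Matrix.of fun i j => x j ^ row i).det ≠ 0 := by
  let ρ : K ≃ Fin (Fintype.card K) := Equiv.ofBijective (fun i => ⟨row i, hlt i⟩)
    ((Fintype.bijective_iff_injective_and_card _).2
      ⟨fun i j hij => hinj (congrArg Fin.val hij), by simp⟩)
  have h : (Matrix.of fun i j => x j ^ row i)
      = ((Matrix.vandermonde (x ∘ ρ.symm)).transpose).submatrix ρ ρ := by
    ext i j
    simp [Matrix.vandermonde_apply, ρ]
  rw [h, Matrix.det_submatrix_equiv_self, Matrix.det_transpose, Matrix.det_vandermonde_ne_zero_iff]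
  exact hx.comp ρ.symm.injective

theorem exists_row_eq {K : Type} [Fintype K] {row : K → ℕ} (hinj : Function.Injective row)
    (hlt : ∀ i, row i < Fintype.card K) {r : ℕ} (hr : r < Fintype.card K) : ∃ i, row i = r := by
  have hsurj : Function.Surjective (fun i => (⟨row i, hlt i⟩ : Fin (Fintype.card K))) :=
    ((Fintype.bijective_iff_injective_and_card _).2
      ⟨fun i j hij => hinj (congrArg Fin.val hij), by simp⟩).2
  obtain ⟨i, hi⟩ := hsurj ⟨r, hr⟩
  exact ⟨i, congrArg Fin.val hi⟩

theorem isDiagram_column {K : Type} [Fintype K] {row : K → ℕ}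
    (hinj : Function.Injective row) (hlt : ∀ i, row i < Fintype.card K) :
    IsDiagram row (fun _ : K => ()) where
  inj _ _ hij := hinj (congrArg Prod.fst hij)
  justified i r hr := by
    obtain ⟨i', hi'⟩ := exists_row_eq hinj hlt (hr.trans (hlt i))
    exact ⟨i', hi', rfl⟩

theorem card_column {K : Type} [Fintype K] [DecidableEq K] {row : K → ℕ}
    (hinj : Function.Injective row) (hlt : ∀ i, row i < Fintype.card K) (r : ℕ) :
    #{i | row i = r} = rowLength {Fintype.card K} r := by
  have h1 : rowLength {Fintype.card K} r = if r < Fintype.card K then 1 else 0 := by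
    unfold rowLength
    split_ifs with h <;> simp [Multiset.filter_singleton, h]
  rw [h1]
  split_ifs with h
  · obtain ⟨i, hi⟩ := exists_row_eq hinj hlt h
    rw [Finset.card_eq_one]
    refine ⟨i, ?_⟩
    ext j
    simp only [mem_filter, mem_univ, true_and, mem_singleton]
    exact ⟨fun hj => hinj (hj.trans hi.symm), fun hj => hj ▸ hi⟩
  · rw [Finset.card_eq_zero, Finset.filter_eq_empty_iff]
    intro i _ hi
    exact h (hi ▸ hlt i)

/-- The rows of a column consisting of `q` vertical pairs, with the elements of `S` below them. -/
def pairRow (q : ℕ) (S : Type) : (Fin q × Fin 2) ⊕ S → ℕ :=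
  Sum.elim (fun x => 2 * x.1 + x.2) (fun _ => 2 * q)

theorem pairRow_injective (q : ℕ) (S : Type) [Subsingleton S] :
    Function.Injective (pairRow q S) := by
  rintro (⟨p, e⟩ | i) (⟨p', e'⟩ | i') h
  · simp only [pairRow, Sum.elim_inl] at h
    have h1 : p = p' := by ext; omega
    have h2 : e = e' := by ext; omega
    rw [h1, h2]
  · simp only [pairRow, Sum.elim_inl, Sum.elim_inr] at h
    omega
  · simp only [pairRow, Sum.elim_inl, Sum.elim_inr] at h
    omega
  · rw [Subsingleton.elim i i']

theorem card_pairRow (q : ℕ) (S : Type) [Fintype S] :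
    Fintype.card ((Fin q × Fin 2) ⊕ S) = 2 * q + Fintype.card S := by
  simp [mul_comm]

theorem pairRow_lt (q : ℕ) (S : Type) [Fintype S] (i) :
    pairRow q S i < Fintype.card ((Fin q × Fin 2) ⊕ S) := by
  rw [card_pairRow]
  rcases i with ⟨p, e⟩ | i
  · simp only [pairRow, Sum.elim_inl]
    omega
  · simp only [pairRow, Sum.elim_inr]
    have := Fintype.card_pos_iff.2 ⟨i⟩
    omega

section Free

variable {h : ℕ}

/-- The class of all tensors. -/
def anyTensor (C : Type) : ℕ → ∀ I : Type, ((I → C) → ℤ) → Prop := fun _ _ _ => True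

/-- A single column, tiled by vertical pairs with at most one point left over. The pair in rows
`2i, 2i+1` gets the color `i`, so that the letters read `0, 1, 2, …` down the column and the
antisymmetrization is a multiple of an initial minor. -/
theorem hasConfig_singleton (S : Type) [Fintype S] [DecidableEq S] [Subsingleton S] (q : ℕ)
    (hq : 2 * q + Fintype.card S ≤ 2 * h) :
    HasConfig (anyTensor (Fin h)) (Fintype.card S) {2 * q + Fintype.card S} := by
  have hc : ∀ i, pairRow q S i / 2 < h := fun i => by
    have := pairRow_lt q S i
    rw [card_pairRow] at this
    omega
  let c : (Fin q × Fin 2) ⊕ S → Fin h := fun i => ⟨pairRow q S i / 2, hc i⟩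
  let E : ((Fin q ⊕ Empty) × Fin 2) ⊕ S ≃ (Fin q × Fin 2) ⊕ S :=
    Equiv.sumCongr (Equiv.prodCongr (Equiv.sumEmpty _ _) (Equiv.refl _)) (Equiv.refl _)
  refine ⟨(Fin q × Fin 2) ⊕ S, Unit, inferInstance, inferInstance, inferInstance, pairRow q S,
    fun _ => (), isDiagram_column (pairRow_injective q S) (pairRow_lt q S), ?_,
    matchVec E, fun f => if f = c then 1 else 0, ⟨_, S, inferInstance, inferInstance, E, rfl, rfl⟩,
    trivial, fun r l => ((2 * (l.2 : ℕ) + (l.1 : ℕ) : ℕ) : ℂ) ^ r, ?_⟩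
  · intro r
    rw [← card_pairRow]
    exact card_column (pairRow_injective q S) (pairRow_lt q S) r
  · rw [minorSum_coloring, sum_matchVec_mul_det E (fun _ => ()) c
      (fun i l => ((2 * (l.2 : ℕ) + (l.1 : ℕ) : ℕ) : ℂ) ^ pairRow q S i) (fun _ _ => rfl)]
    · refine mul_ne_zero (by simp) ?_
      rw [Fintype.sum_unique]
      simp only [univ_eq_empty, prod_empty, Int.cast_one, one_mul, if_true]
      have hword : ∀ o j, 2 * (c j : ℕ) + (matchWord E (Sum.elim (fun _ => 1) o) j : ℕ)
          = pairRow q S j := by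
        rintro o (⟨p, e⟩ | j)
        · simp [matchWord, E, c, pairRow]; omega
        · simp [matchWord, E, c, pairRow]
      simp only [hword]
      refine det_pow_ne_zero (pairRow_injective q S) (pairRow_lt q S) ?_
      exact Nat.cast_injective.comp (pairRow_injective q S)
    · intro p e
      refine Fin.ext ?_
      change (2 * (p : ℕ) + e) / 2 = (2 * (p : ℕ) + (0 : Fin 2)) / 2
      simp only [Fin.val_zero]
      omega

/-- The empty diagram. -/
theorem hasConfig_zero : HasConfig (anyTensor (Fin h)) 0 0 := by
  refine ⟨Empty, Empty, inferInstance, inferInstance, inferInstance, fun _ => 0, id,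
    ⟨fun i => i.elim, fun i => i.elim⟩, fun r => by simp [rowLength], matchVec (P := Empty) (S := Empty)
      ⟨fun x => by rcases x with x | x; exacts [x.1, x], fun x => x.elim, fun x => by
        rcases x with x | x; exacts [x.1.elim, x.elim], fun x => x.elim⟩, fun _ => 1,
    ⟨_, _, _, _, _, rfl, rfl⟩, trivial, fun _ _ => 0, ?_⟩
  simp [minorSum, matchVec]

/-- The matching of two columns of odd heights `2q+1`, `2q'+1` by vertical pairs, with the two
lowest cells matched to each other. -/
def twoColumnMatching (q q' : ℕ) : (((Fin q ⊕ Fin q') ⊕ Unit) × Fin 2) ⊕ Empty ≃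
    ((Fin q × Fin 2) ⊕ Unit) ⊕ ((Fin q' × Fin 2) ⊕ Unit) where
  toFun
    | .inl (.inl (.inl p), e) => .inl (.inl (p, e))
    | .inl (.inl (.inr p), e) => .inr (.inl (p, e))
    | .inl (.inr _, e) => if e = 0 then .inl (.inr ()) else .inr (.inr ())
  invFun
    | .inl (.inl (p, e)) => .inl (.inl (.inl p), e)
    | .inr (.inl (p, e)) => .inl (.inl (.inr p), e)
    | .inl (.inr _) => .inl (.inr (), 0)
    | .inr (.inr _) => .inl (.inr (), 1)
  left_inv := by
    rintro (⟨(p | p) | _, e⟩ | x)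
    · rfl
    · rfl
    · fin_cases e <;> rfl
    · exact x.elim
  right_inv := by
    rintro ((⟨p, e⟩ | _) | (⟨p, e⟩ | _)) <;> rfl

/-- Two columns of odd heights. The letters read `0, …, 2q-1` in the first column and
`2, …, 2q'+1` in the second; the two lowest cells share their pair and read `2q, 1` or `2q+1, 0`.
Identifying the letters `2q+1` and `0` kills the second term only. (For `q = 0` the last cell of the
second column has color `1`, and `2q+1` is sent to zero instead.) -/
theorem hasConfig_pair {q q' : ℕ} (hh : 2 ≤ h) (hq : 2 * q + 1 ≤ 2 * h) (hq' : q' ≤ q) :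
    HasConfig (anyTensor (Fin h)) 0 ({2 * q + 1} + {2 * q' + 1}) := by
  let c : ((Fin q × Fin 2) ⊕ Unit) ⊕ ((Fin q' × Fin 2) ⊕ Unit) → Fin h :=
    Sum.elim (Sum.elim (fun x => ⟨x.1, by omega⟩) (fun _ => ⟨q, by omega⟩))
      (Sum.elim (fun x => ⟨x.1 + 1, by omega⟩) (fun _ => ⟨if q = 0 then 1 else 0, by split_ifs <;> omega⟩))
  let E := twoColumnMatching q q'
  -- The node of a letter: its number `2 * color + bit`, except for `2q+1`, which is identified with `0`.
  let x : Fin 2 × Fin h → ℕ := fun l => if l.1 = 1 ∧ (l.2 : ℕ) = q then 0 else 2 * (l.2 : ℕ) + l.1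
  let z : ℕ → Fin 2 × Fin h → ℂ := fun r l =>
    if q = 0 ∧ l.1 = 1 ∧ (l.2 : ℕ) = q then 0 else (x l : ℂ) ^ r
  have hd1 := isDiagram_column (pairRow_injective q Unit) (pairRow_lt q Unit)
  have hd2 := isDiagram_column (pairRow_injective q' Unit) (pairRow_lt q' Unit)
  refine ⟨_, _, inferInstance, inferInstance, inferInstance, _, _, hd1.sum hd2, ?_,
    matchVec E, fun f => if f = c then 1 else 0, ⟨_, Empty, inferInstance, inferInstance, E, rfl, rfl⟩,
    trivial, z, ?_⟩
  · intro r
    have h1 := card_column (pairRow_injective q Unit) (pairRow_lt q Unit) r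
    have h2 := card_column (pairRow_injective q' Unit) (pairRow_lt q' Unit) r
    rw [card_pairRow, Fintype.card_unit] at h1 h2
    rw [rowLength_add, ← h1, ← h2, Finset.card_filter, Finset.card_filter, Finset.card_filter,
      Fintype.sum_sum_type]
    rfl
  · rw [minorSum_coloring, sum_matchVec_mul_det E _ c
      (fun i l => z (Sum.elim (pairRow q Unit) (pairRow q' Unit) i) l)]
    · refine mul_ne_zero (by simp) ?_
      rw [← (Equiv.funUnique Unit (Equiv.Perm (Fin 2))).symm.sum_comp,
        show (univ : Finset (Equiv.Perm (Fin 2))) = {1, Equiv.swap 0 1} by decide,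
        Finset.sum_pair (by decide), det_sum_blocks, det_sum_blocks]
      have hzero : ∀ o : Unit → Equiv.Perm (Fin 2), o () = Equiv.swap 0 1 →
          (Matrix.of fun i j : (Fin q × Fin 2) ⊕ Unit => if (fun _ => ()) i = (fun _ => ()) j then
            z (Sum.elim (pairRow q Unit) (pairRow q' Unit) (.inl i))
              (matchWord E (Sum.elim (fun _ => 1) o) (.inl j), c (.inl j)) else 0).det = 0 := by
        intro o ho
        have hu : matchWord E (Sum.elim (fun _ => 1) o) (.inl (.inr ())) = 1 := by
          change o () 0 = 1
          rw [ho]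
          rfl
        rcases Nat.eq_zero_or_pos q with hq0 | hq0
        -- For `q = 0` the column is a single cell, evaluated at zero.
        · refine Matrix.det_eq_zero_of_column_eq_zero (.inr ()) fun i => ?_
          simp [hu, z, c, hq0]
        · have hl : matchWord E (Sum.elim (fun _ => 1) o) (.inl (.inl (⟨0, hq0⟩, 0))) = 0 := rfl
          refine Matrix.det_zero_of_column_eq (i := .inl (⟨0, hq0⟩, 0)) (j := .inr ()) (by simp)
            fun i => ?_
          simp [hu, hl, z, c, x, hq0.ne']
      have hone : ∀ o : Unit → Equiv.Perm (Fin 2), o () = 1 →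
          (Matrix.of fun i j : (Fin q × Fin 2) ⊕ Unit => if (fun _ => ()) i = (fun _ => ()) j then
            z (Sum.elim (pairRow q Unit) (pairRow q' Unit) (.inl i))
              (matchWord E (Sum.elim (fun _ => 1) o) (.inl j), c (.inl j)) else 0).det ≠ 0 ∧
          (Matrix.of fun i j : (Fin q' × Fin 2) ⊕ Unit => if (fun _ => ()) i = (fun _ => ()) j then
            z (Sum.elim (pairRow q Unit) (pairRow q' Unit) (.inr i))
              (matchWord E (Sum.elim (fun _ => 1) o) (.inr j), c (.inr j)) else 0).det ≠ 0 := by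
        intro o ho
        have hu : matchWord E (Sum.elim (fun _ => 1) o) (.inl (.inr ())) = 0 := by
          change o () 0 = 0
          rw [ho]
          rfl
        have hu' : matchWord E (Sum.elim (fun _ => 1) o) (.inr (.inr ())) = 1 := by
          change o () 1 = 1
          rw [ho]
          rfl
        have hl : ∀ p e, matchWord E (Sum.elim (fun _ => 1) o) (.inl (.inl (p, e))) = e :=
          fun _ _ => rfl
        have hl' : ∀ p e, matchWord E (Sum.elim (fun _ => 1) o) (.inr (.inl (p, e))) = e :=
          fun _ _ => rfl
        simp only [if_true, Sum.elim_inl, Sum.elim_inr]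
        constructor
        · have hz : ∀ r j, z r (matchWord E (Sum.elim (fun _ => 1) o) (.inl j), c (.inl j))
              = ((pairRow q Unit j : ℕ) : ℂ) ^ r := by
            rintro r (⟨p, e⟩ | j)
            · have := p.2.ne
              have := p.2
              simp only [hl, z, c, x, Sum.elim_inl, pairRow]
              rw [if_neg (by omega), if_neg (by omega)]
            · simp [hu, z, c, x, pairRow]
          simp only [hz]
          exact det_pow_ne_zero (pairRow_injective q Unit) (pairRow_lt q Unit)
            (Nat.cast_injective.comp (pairRow_injective q Unit))
        · have hz : ∀ r j, z r (matchWord E (Sum.elim (fun _ => 1) o) (.inr j), c (.inr j))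
              = ((x (matchWord E (Sum.elim (fun _ => 1) o) (.inr j), c (.inr j)) : ℕ) : ℂ) ^ r := by
            rintro r (⟨p, e⟩ | j)
            · have := p.2
              simp only [z]
              rw [if_neg (by omega)]
            · simp only [hu', z, c, Sum.elim_inr]
              rw [if_neg]
              split_ifs <;> omega
          simp only [hz]
          refine det_pow_ne_zero (pairRow_injective q' Unit) (pairRow_lt q' Unit)
            (Nat.cast_injective.comp ?_)
          rintro (⟨p, e⟩ | i) (⟨p', e'⟩ | i') hij
          · simp only [hl', x, c, Sum.elim_inl, Sum.elim_inr] at hij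
            have h1 : p = p' := by
              ext
              split_ifs at hij <;> omega
            have h2 : e = e' := by
              ext
              split_ifs at hij <;> omega
            rw [h1, h2]
          · simp only [hl', hu', x, c, Sum.elim_inl, Sum.elim_inr] at hij
            split_ifs at hij <;> simp at * <;> omega
          · simp only [hl', hu', x, c, Sum.elim_inl, Sum.elim_inr] at hij
            split_ifs at hij <;> simp at * <;> omega
          · rfl
      rw [hzero ((Equiv.funUnique Unit (Equiv.Perm (Fin 2))).symm (Equiv.swap 0 1)) rfl]
      obtain ⟨h1, h2⟩ := hone ((Equiv.funUnique Unit (Equiv.Perm (Fin 2))).symm 1) rfl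
      rw [zero_mul, mul_zero, add_zero]
      exact mul_ne_zero (by simp) (mul_ne_zero h1 h2)
    · rintro (p | p) e <;> rfl
    · rintro (p | p) e <;> rfl

/-- With a free tensor factor in at least two colors, every multiset of column heights that is not
excluded by the size of the alphabet carries a configuration. -/
theorem hasConfig_anyTensor (hh : 2 ≤ h) (m : Multiset ℕ) (hm : ∀ a ∈ m, a ≤ 2 * h) :
    HasConfig (anyTensor (Fin h)) (m.sum % 2) m := by
  induction hc : Multiset.card m using Nat.strong_induction_on generalizing m with
  | _ N ih =>
    subst hc
    by_cases hev : ∃ a ∈ m, Even a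
    · obtain ⟨a, ha, q, hq⟩ := hev
      obtain ⟨t, rfl⟩ := Multiset.exists_cons_of_mem ha
      have h1 := hasConfig_singleton (h := h) Empty q (by have := hm a ha; simp; omega)
      have h2 := ih _ (by simp) t (fun b hb => hm b (Multiset.mem_cons_of_mem hb)) rfl
      have h3 := h1.add (fun _ _ => trivial) h2
      rw [← Multiset.singleton_add]
      convert h3 using 1
      · simp; omega
      · simp; omega
    · push Not at hev
      have hodd : ∀ a ∈ m, ∃ q, a = 2 * q + 1 := fun a ha => Nat.not_even_iff_odd.1 (hev a ha)
      rcases m.empty_or_exists_mem with rfl | ⟨a, ha⟩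
      · exact hasConfig_zero
      obtain ⟨t, rfl⟩ := Multiset.exists_cons_of_mem ha
      obtain ⟨q, rfl⟩ := hodd a ha
      have haq := hm _ ha
      rcases t.empty_or_exists_mem with rfl | ⟨b, hb⟩
      · have h1 := hasConfig_singleton (h := h) Unit q (by simpa using haq)
        convert h1 using 1
        · simp only [Multiset.cons_zero, Multiset.sum_singleton, Fintype.card_unit]
          omega
        · rfl
      · obtain ⟨u, rfl⟩ := Multiset.exists_cons_of_mem hb
        obtain ⟨q', rfl⟩ := hodd b (Multiset.mem_cons_of_mem hb)
        have hbq := hm _ (Multiset.mem_cons_of_mem hb)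
        have h2 := ih _ (by simp) u
          (fun b hb => hm b (Multiset.mem_cons_of_mem (Multiset.mem_cons_of_mem hb))) rfl
        have h1 : HasConfig (anyTensor (Fin h)) 0 ({2 * q + 1} + {2 * q' + 1}) := by
          rcases le_total q' q with hle | hle
          · exact hasConfig_pair hh haq hle
          · rw [add_comm]
            exact hasConfig_pair hh hbq hle
        have h3 := h1.add (fun _ _ => trivial) h2
        rw [← Multiset.singleton_add, ← Multiset.singleton_add, ← add_assoc]
        convert h3 using 1
        simp; omega

end Free

end

/-! ### Configurations with two matchings -/

section

open Finset

/-- The bilinear form on `ℂ² ⊗ ℂ²` that is the tensor square of the alternating form. -/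
def pairForm {R : Type*} [CommRing R] (x y : Fin 2 × Fin 2 → R) : R :=
  x (0, 0) * y (1, 1) - x (0, 1) * y (1, 0) - x (1, 0) * y (0, 1) + x (1, 1) * y (0, 0)

/-- Contracting the square of a matching vector against a product of vectors gives a product over
the pairs and the unmatched points. -/
theorem sum_matchVec_sq {R : Type*} [CommRing R] {I P S : Type} [Fintype I] [DecidableEq I]
    [Fintype P] [DecidableEq P] [Fintype S] [DecidableEq S] (E : (P × Fin 2) ⊕ S ≃ I)
    (w : I → Fin 2 × Fin 2 → R) :
    ∑ f : I → Fin 2 × Fin 2,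
        ((matchVec E (fun i => (f i).1) * matchVec E (fun i => (f i).2) : ℤ) : R) * ∏ i, w i (f i)
      = (∏ p, pairForm (w (E (.inl (p, 0)))) (w (E (.inl (p, 1))))) * ∏ j, w (E (.inr j)) (0, 0) := by
  have h1 : ∀ p, pairForm (w (E (.inl (p, 0)))) (w (E (.inl (p, 1)))) = ∑ a : Fin 2 → Fin 2 × Fin 2,
      (((((a 1).1.val : ℤ) - ((a 0).1.val : ℤ)) * (((a 1).2.val : ℤ) - ((a 0).2.val : ℤ)) : ℤ) : R)
        * ∏ e, w (E (.inl (p, e))) (a e) := by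
    intro p
    rw [← (finTwoArrowEquiv (Fin 2 × Fin 2)).symm.sum_comp, Fintype.sum_prod_type]
    simp only [Fintype.sum_prod_type, Fin.sum_univ_two, Fin.prod_univ_two, finTwoArrowEquiv_symm_apply,
      Matrix.cons_val_zero, Matrix.cons_val_one, pairForm]
    simp
    ring
  have h2 : ∀ j, w (E (.inr j)) (0, 0) = ∑ l : Fin 2 × Fin 2,
      (((if l.1 = 0 then 1 else 0) * (if l.2 = 0 then 1 else 0) : ℤ) : R) * w (E (.inr j)) l := by
    intro j
    simp [Fintype.sum_prod_type]
  simp only [h1]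
  rw [Finset.prod_congr rfl fun j _ => h2 j, Finset.prod_univ_sum, Finset.prod_univ_sum,
    Finset.sum_mul_sum, ← Finset.sum_product', Fintype.piFinset_univ, Fintype.piFinset_univ,
    Finset.univ_product_univ,
    ← ((Equiv.curry P (Fin 2) (Fin 2 × Fin 2)).prodCongr (Equiv.refl (S → Fin 2 × Fin 2))).sum_comp,
    ← (Equiv.sumArrowEquivProdArrow _ _ _).sum_comp,
    ← (E.arrowCongr (Equiv.refl (Fin 2 × Fin 2))).sum_comp]
  refine Finset.sum_congr rfl fun f _ => ?_
  rw [← E.prod_comp, Fintype.prod_sum_type, Fintype.prod_prod_type]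
  simp only [matchVec, Equiv.arrowCongr_apply, Equiv.coe_refl, Function.comp_apply, id,
    Equiv.symm_apply_apply, Finset.prod_mul_distrib, Int.cast_mul, Int.cast_prod, Equiv.prodCongr_apply,
    Prod.map, Equiv.sumArrowEquivProdArrow, Equiv.coe_fn_mk, Equiv.curry_apply, Function.curry]
  ring

/-- The matching that pairs the cells `K` of one column with the cells `K` of another and leaves
the cells `S` unmatched. -/
def horizontalMatching (K S : Type) : (K × Fin 2) ⊕ S ≃ (K ⊕ S) ⊕ K where
  toFun
    | .inl (p, e) => if e = 0 then .inl (.inl p) else .inr p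
    | .inr j => .inl (.inr j)
  invFun
    | .inl (.inl p) => .inl (p, 0)
    | .inr p => .inl (p, 1)
    | .inl (.inr j) => .inr j
  left_inv := by
    rintro (⟨p, e⟩ | j)
    · fin_cases e <;> rfl
    · rfl
  right_inv := by
    rintro ((p | j) | p) <;> rfl

/-- If the vectors `z` of the paired rows are orthogonal for `pairForm` and those of the paired rows
have no coefficient `(0, 0)`, the antisymmetrization is a positive multiple of the product of the
values `ε p` of the form: for each permutation of the second column, the sum over the first column is a
block triangular determinant, and the signs cancel. -/
theorem minorSum_horizontalMatching {R : Type*} [CommRing R] {K S : Type} [Fintype K] [DecidableEq K]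
    [Fintype S] [DecidableEq S] [Subsingleton S] (rowK : K → ℕ) (rowS : S → ℕ)
    (z : ℕ → Fin 2 × Fin 2 → R) (ε : K → R)
    (hK : ∀ p p', pairForm (z (rowK p)) (z (rowK p')) = if p = p' then ε p else 0)
    (hz : ∀ (p : K) (_ : S), z (rowK p) (0, 0) = 0) (hS : ∀ j, z (rowS j) (0, 0) = 1) :
    minorSum (Sum.elim (Sum.elim rowK rowS) rowK)
        (Sum.map (fun _ => ()) (fun _ => ())) z
        (fun f => matchVec (horizontalMatching K S) (fun i => (f i).1) *
          matchVec (horizontalMatching K S) (fun i => (f i).2))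
      = Fintype.card (Equiv.Perm K) * ∏ p, ε p := by
  set E := horizontalMatching K S
  have h0 : ∀ f : (K ⊕ S) ⊕ K → Fin 2 × Fin 2,
      (Matrix.of fun i j : (K ⊕ S) ⊕ K => if Sum.map (fun _ => ()) (fun _ => ()) i =
          (Sum.map (fun _ => ()) (fun _ => ()) j : Unit ⊕ Unit)
        then z (Sum.elim (Sum.elim rowK rowS) rowK i) (f j) else 0).det
      = ∑ q₂ : Equiv.Perm K, ∑ q₁ : Equiv.Perm (K ⊕ S),
          ((Equiv.Perm.sign q₂ : ℤ) : R) * ((Equiv.Perm.sign q₁ : ℤ) : R) *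
            ∏ i, z (Sum.elim (Sum.elim rowK rowS) rowK (Equiv.sumCongr q₁ q₂ i)) (f i) := by
    intro f
    rw [det_sum_blocks (fun _ => ()) (fun _ => ())
      (fun i j => z (Sum.elim (Sum.elim rowK rowS) rowK i) (f j)), Matrix.det_apply', Matrix.det_apply',
      Finset.sum_mul_sum, Finset.sum_comm]
    refine Finset.sum_congr rfl fun q₂ _ => Finset.sum_congr rfl fun q₁ _ => ?_
    rw [Fintype.prod_sum_type]
    simp
    ring
  unfold minorSum
  simp only [h0, Finset.mul_sum]
  rw [Finset.sum_comm]
  have h1 : ∀ q₂ : Equiv.Perm K, (∑ f : (K ⊕ S) ⊕ K → Fin 2 × Fin 2, ∑ q₁ : Equiv.Perm (K ⊕ S),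
      ((matchVec E (fun i => (f i).1) * matchVec E (fun i => (f i).2) : ℤ) : R) *
      (((Equiv.Perm.sign q₂ : ℤ) : R) * ((Equiv.Perm.sign q₁ : ℤ) : R) *
            ∏ i, z (Sum.elim (Sum.elim rowK rowS) rowK (Equiv.sumCongr q₁ q₂ i)) (f i)))
      = ∏ p, ε p := by
    intro q₂
    rw [Finset.sum_comm]
    have h2 : ∀ q₁ : Equiv.Perm (K ⊕ S), (∑ f : (K ⊕ S) ⊕ K → Fin 2 × Fin 2,
        ((matchVec E (fun i => (f i).1) * matchVec E (fun i => (f i).2) : ℤ) : R) *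
        (((Equiv.Perm.sign q₂ : ℤ) : R) * ((Equiv.Perm.sign q₁ : ℤ) : R) *
            ∏ i, z (Sum.elim (Sum.elim rowK rowS) rowK (Equiv.sumCongr q₁ q₂ i)) (f i)))
        = ((Equiv.Perm.sign q₂ : ℤ) : R) * (((Equiv.Perm.sign q₁ : ℤ) : R) * ∏ x : K ⊕ S,
          (Matrix.of fun (a b : K ⊕ S) => Sum.elim
            (fun p => pairForm (z (Sum.elim rowK rowS a)) (z (rowK (q₂ p))))
            (fun _ => z (Sum.elim rowK rowS a) (0, 0)) b) (q₁ x) x) := by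
      intro q₁
      rw [Fintype.prod_sum_type]
      have := sum_matchVec_sq E
        (fun i => z (Sum.elim (Sum.elim rowK rowS) rowK (Equiv.sumCongr q₁ q₂ i)))
      have hE0 : ∀ p, E (.inl (p, 0)) = .inl (.inl p) := fun _ => rfl
      have hE1 : ∀ p, E (.inl (p, 1)) = .inr p := fun _ => rfl
      have hE2 : ∀ j, E (.inr j) = .inl (.inr j) := fun _ => rfl
      simp only [hE0, hE1, hE2] at this
      simp only [Matrix.of_apply, Sum.elim_inl, Sum.elim_inr]
      simp only [Equiv.sumCongr_apply, Sum.map_inl, Sum.map_inr, Sum.elim_inl, Sum.elim_inr] at this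
      rw [← this, ← mul_assoc, Finset.mul_sum]
      refine Finset.sum_congr rfl fun f _ => ?_
      simp only [Equiv.sumCongr_apply]
      ring
    simp only [h2]
    rw [← Finset.mul_sum, ← Matrix.det_apply']
    have h3 : (Matrix.of fun (a b : K ⊕ S) => Sum.elim
            (fun p => pairForm (z (Sum.elim rowK rowS a)) (z (rowK (q₂ p))))
            (fun _ => z (Sum.elim rowK rowS a) (0, 0)) b)
        = Matrix.fromBlocks ((Matrix.diagonal ε).submatrix id q₂) 0
          (Matrix.of fun (j : S) p => pairForm (z (rowS j)) (z (rowK (q₂ p)))) 1 := by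
      ext (a | a) (b | b)
      · simp [hK, Matrix.diagonal_apply]
      · simp [hz a b]
      · simp
      · simp [hS, Subsingleton.elim a b]
    rw [h3, Matrix.det_fromBlocks_zero₁₂, Matrix.det_one, mul_one, Matrix.det_permute',
      Matrix.det_diagonal, ← mul_assoc, ← Int.cast_mul, ← Units.val_mul, Int.units_mul_self]
    simp
  rw [Finset.sum_congr rfl fun q₂ _ => h1 q₂]
  simp

/-- Substitution for a pair of columns of heights `d + s` and `d`, with `d + s ≤ 3` and `s ≤ 1`. The
rows `r < d` receive vectors from the list `e₀₁ + e₁₀`, `e₀₁ - e₁₀`, `e₀₀ + e₁₁`, which are orthogonal for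
`pairForm`; row `d`, that of the unmatched cell, receives `e₀₀`. The third vector, which has a
coefficient at `e₀₀`, is needed only if there is no unmatched cell. -/
def blockRows (d r : ℕ) (l : Fin 2 × Fin 2) : ℂ :=
  if r = d then if l = (0, 0) then 1 else 0
  else if r = 0 then if l.1 = l.2 then 0 else 1
  else if r = 1 then if l.1 = l.2 then 0 else if l.1 = 0 then 1 else -1
  else if l.1 = l.2 then 1 else 0

/-- Only the row lengths matter; in particular columns of height zero may be dropped. -/
theorem HasConfig.of_rowLength_eq {C : Type} [Fintype C] [DecidableEq C]
    {Y : ℕ → ∀ I : Type, ((I → C) → ℤ) → Prop} {s : ℕ} {m m' : Multiset ℕ} (h : HasConfig Y s m)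
    (hm : ∀ r, rowLength m r = rowLength m' r) : HasConfig Y s m' := by
  obtain ⟨I, κ, i1, i2, i3, row, col, hD, hrow, rest⟩ := h
  exact ⟨I, κ, i1, i2, i3, row, col, hD, fun r => (hrow r).trans (hm r), rest⟩

/-- Two columns of heights `d + |S|` and `d`, the same horizontal matching in both factors. -/
theorem hasConfig_horizontal (d : ℕ) (S : Type) [Fintype S] [DecidableEq S] [Subsingleton S]
    (hd : d + Fintype.card S ≤ 3) :
    HasConfig IsMatching (Fintype.card S) ({d + Fintype.card S} + {d}) := by
  have hinj : Function.Injective (Sum.elim (fun p : Fin d => (p : ℕ)) (fun _ : S => d)) := by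
    rintro (p | p) (p' | p') h
    · exact congrArg _ (Fin.ext h)
    · exact absurd h p.2.ne
    · exact absurd h p'.2.ne'
    · rw [Subsingleton.elim p p']
  have hlt : ∀ i, Sum.elim (fun p : Fin d => (p : ℕ)) (fun _ : S => d) i
      < Fintype.card (Fin d ⊕ S) := by
    have hc : Fintype.card (Fin d ⊕ S) = d + Fintype.card S := by simp
    rw [hc]
    rintro (p | p)
    · exact p.2.trans_le (Nat.le_add_right _ _)
    · have := Fintype.card_pos_iff.2 ⟨p⟩
      simp only [Sum.elim_inr]
      omega
  have hinj' : Function.Injective (fun p : Fin d => (p : ℕ)) := Fin.val_injective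
  have hlt' : ∀ p : Fin d, (p : ℕ) < Fintype.card (Fin d) := fun p => by simp
  refine ⟨_, _, inferInstance, inferInstance, inferInstance, _, _,
    (isDiagram_column hinj hlt).sum (isDiagram_column hinj' hlt'), ?_,
    matchVec (horizontalMatching (Fin d) S), matchVec (horizontalMatching (Fin d) S),
    ⟨_, S, inferInstance, inferInstance, _, rfl, rfl⟩, ⟨_, S, inferInstance, inferInstance, _, rfl, rfl⟩,
    blockRows d, ?_⟩
  · intro r
    have h1 := card_column hinj hlt r
    have h2 := card_column hinj' hlt' r
    have hc : Fintype.card (Fin d ⊕ S) = d + Fintype.card S := by simp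
    rw [hc] at h1
    rw [Fintype.card_fin] at h2
    rw [rowLength_add, ← h1, ← h2, Finset.card_filter, Finset.card_filter, Finset.card_filter,
      Fintype.sum_sum_type]
    rfl
  · rw [minorSum_horizontalMatching (fun p : Fin d => (p : ℕ)) (fun _ : S => d) (blockRows d)
      (fun p => if (p : ℕ) = 0 then -2 else 2)]
    · refine mul_ne_zero (by simp [Fintype.card_ne_zero]) (Finset.prod_ne_zero_iff.2 fun p _ => ?_)
      split_ifs <;> norm_num
    · intro p p'
      have h1 := p.2
      have h2 := p'.2
      have h3 : (p : ℕ) = 0 ∨ (p : ℕ) = 1 ∨ (p : ℕ) = 2 := by omega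
      have h4 : (p' : ℕ) = 0 ∨ (p' : ℕ) = 1 ∨ (p' : ℕ) = 2 := by omega
      have h5 : (p = p') ↔ (p : ℕ) = p' := Fin.ext_iff
      simp only [pairForm, blockRows, if_neg h1.ne, if_neg h2.ne, h5]
      rcases h3 with h3 | h3 | h3 <;> rcases h4 with h4 | h4 | h4 <;> simp [h3, h4] <;> norm_num
    · intro p j
      have h1 := p.2
      have h2 := Fintype.card_pos_iff.2 ⟨j⟩
      have h3 : (p : ℕ) = 0 ∨ (p : ℕ) = 1 := by omega
      rcases h3 with h3 | h3 <;> simp [blockRows, h3]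
      all_goals omega
    · intro j
      simp [blockRows]

/-- Evaluating at the coefficients of a word `ℓ` extracts the antisymmetrized coefficient of `ℓ`. -/
theorem minorSum_indicator {L : Type} [Fintype L] [DecidableEq L] {N : ℕ} (ℓ : ℕ → L)
    (t : (Fin N → L) → ℤ) :
    minorSum (fun i : Fin N => (i : ℕ)) (fun _ => ()) (fun r l => if l = ℓ r then (1 : ℤ) else 0) t
      = ∑ q : Equiv.Perm (Fin N), (Equiv.Perm.sign q : ℤ) * t (fun i => ℓ (q i)) := by
  unfold minorSum
  simp only [if_true, Matrix.det_apply', Matrix.of_apply, Finset.mul_sum]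
  rw [Finset.sum_comm]
  refine Finset.sum_congr rfl fun q _ => ?_
  rw [Finset.sum_eq_single (fun i => ℓ (q i))]
  · simp [mul_comm]
  · intro f _ hf
    obtain ⟨i, hi⟩ := Function.ne_iff.1 hf
    rw [Finset.prod_eq_zero (mem_univ i) (if_neg hi), mul_zero, mul_zero]
  · simp

/-- A single column: it suffices that the antisymmetrization over all permutations has a nonzero
coefficient at some word `ℓ`. -/
theorem hasConfig_of_sum_ne_zero {N s : ℕ} (ℓ : ℕ → Fin 2 × Fin 2) {v y : (Fin N → Fin 2) → ℤ}
    (hv : IsMatching s (Fin N) v) (hy : IsMatching s (Fin N) y)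
    (hne : ∑ q : Equiv.Perm (Fin N), (Equiv.Perm.sign q : ℤ) *
      (v (fun i => (ℓ (q i)).1) * y (fun i => (ℓ (q i)).2)) ≠ 0) :
    HasConfig IsMatching s {N} := by
  have hinj : Function.Injective (fun p : Fin N => (p : ℕ)) := Fin.val_injective
  have hlt : ∀ p : Fin N, (p : ℕ) < Fintype.card (Fin N) := fun p => by simp
  refine ⟨Fin N, Unit, inferInstance, inferInstance, inferInstance, _, _, isDiagram_column hinj hlt, ?_,
    v, y, hv, hy, fun r l => Int.castRingHom ℂ (if l = ℓ r then 1 else 0), ?_⟩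
  · intro r
    rw [card_column hinj hlt r, Fintype.card_fin]
  · rw [← map_minorSum, minorSum_indicator]
    exact (map_ne_zero_iff (Int.castRingHom ℂ) Int.cast_injective).2 hne

/-- The matching of `{0, 1, 2, 3}` with pairs `{0, 1}`, `{2, 3}`. -/
def fourMatching : (Fin 2 × Fin 2) ⊕ Fin 0 ≃ Fin 4 :=
  (Equiv.sumEmpty _ _).trans finProdFinEquiv

/-- The matching of `{0, 1, 2}` with the pair `{0, 1}`. -/
def threeMatching : (Fin 1 × Fin 2) ⊕ Fin 1 ≃ Fin 3 :=
  (Equiv.sumCongr finProdFinEquiv (Equiv.refl _)).trans finSumFinEquiv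

theorem hasConfig_four : HasConfig IsMatching 0 {4} := by
  refine hasConfig_of_sum_ne_zero (fun r => ![(0, 0), (0, 1), (1, 0), (1, 1)] (Fin.ofNat 4 r))
    ⟨_, _, inferInstance, inferInstance, fourMatching, rfl, rfl⟩
    ⟨_, _, inferInstance, inferInstance, fourMatching.trans (Equiv.swap 1 2), rfl, rfl⟩ ?_
  decide +kernel

theorem hasConfig_three : HasConfig IsMatching 1 {3} := by
  refine hasConfig_of_sum_ne_zero (fun r => ![(0, 0), (0, 1), (1, 0)] (Fin.ofNat 3 r))
    ⟨_, _, inferInstance, inferInstance, threeMatching, rfl, rfl⟩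
    ⟨_, _, inferInstance, inferInstance, threeMatching.trans (Equiv.swap 1 2), rfl, rfl⟩ ?_
  decide +kernel

theorem hasConfig_one : HasConfig IsMatching 1 {1} :=
  (hasConfig_horizontal 0 (Fin 1) (by simp)).of_rowLength_eq fun r => by
    rw [rowLength_add]
    simp [rowLength, Multiset.filter_singleton]

/-- Every multiset of column heights at most `4` with odd sum carries a configuration of two
matchings. -/
theorem hasConfig_isMatching (m : Multiset ℕ) (hm : ∀ a ∈ m, 0 < a ∧ a ≤ 4) (hodd : Odd m.sum) :
    HasConfig IsMatching 1 m := by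
  induction hc : Multiset.card m using Nat.strong_induction_on generalizing m with
  | _ N ih =>
    subst hc
    have hadd : ∀ {s s' : ℕ} {m m' : Multiset ℕ}, HasConfig IsMatching s m →
        HasConfig IsMatching s' m' → HasConfig IsMatching (s + s') (m + m') :=
      HasConfig.add IsMatching.sum
    by_cases h4 : 4 ∈ m
    · obtain ⟨t, rfl⟩ := Multiset.exists_cons_of_mem h4
      have h1 := ih _ (by simp) t (fun b hb => hm b (Multiset.mem_cons_of_mem hb))
        (by rw [Multiset.sum_cons] at hodd; exact (Nat.odd_add.1 (add_comm 4 _ ▸ hodd)).2 (by decide)) rfl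
      rw [← Multiset.singleton_add]
      exact hadd hasConfig_four h1
    have hm3 : ∀ a ∈ m, a = 1 ∨ a = 2 ∨ a = 3 := by
      intro a ha
      have h1 := hm a ha
      have h2 : a ≠ 4 := fun h => h4 (h ▸ ha)
      omega
    by_cases hdup : ∃ a, ∃ t, m = a ::ₘ a ::ₘ t
    · obtain ⟨a, t, rfl⟩ := hdup
      have ha := hm3 a (by simp)
      have h1 := ih _ (by simp) t
        (fun b hb => hm b (Multiset.mem_cons_of_mem (Multiset.mem_cons_of_mem hb)))
        (by
          rw [Multiset.sum_cons, Multiset.sum_cons, ← add_assoc, Nat.odd_iff] at hodd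
          rw [Nat.odd_iff]; omega) rfl
      rw [← Multiset.singleton_add, ← Multiset.singleton_add, ← add_assoc]
      exact hadd (s := 0) (hasConfig_horizontal a (Fin 0) (by simp; omega)) h1
    · have hnodup : m.Nodup := Multiset.nodup_iff_ne_cons_cons.2 fun a t h => hdup ⟨a, t, h⟩
      have hle : m ≤ {1, 2, 3} := (Multiset.le_iff_subset hnodup).2 fun a ha => by
        simpa using hm3 a ha
      -- What remains is a set of heights from `{1, 2, 3}` with odd sum.
      have hmem : m ∈ Multiset.powerset {1, 2, 3} := Multiset.mem_powerset.2 hle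
      have hcases : ∀ m ∈ Multiset.powerset ({1, 2, 3} : Multiset ℕ), Odd m.sum →
          m = {1} ∨ m = {3} ∨ m = {1 + 1} + {1} ∨ m = {2 + 1} + {2} := by decide
      rcases hcases m hmem hodd with rfl | rfl | rfl | rfl
      · exact hasConfig_one
      · exact hasConfig_three
      · exact hasConfig_horizontal 1 (Fin 1) (by simp)
      · exact hasConfig_horizontal 2 (Fin 1) (by simp)

end

/-! ### Twisting by the sign character -/

section

open Finset Representation

section Twist

variable {I : Type} [Fintype I] [DecidableEq I] {V W : Type} [AddCommGroup V] [Module ℂ V]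
  [AddCommGroup W] [Module ℂ W]

theorem sign_mul_sign (g : Equiv.Perm I) :
    ((Equiv.Perm.sign g : ℤ) : ℂ) * ((Equiv.Perm.sign g : ℤ) : ℂ) = 1 := by
  rw [← Int.cast_mul, ← Units.val_mul, Int.units_mul_self]
  simp

/-- The tensor product of a representation with the sign character. -/
def signTwist (ρ : Representation ℂ (Equiv.Perm I) V) : Representation ℂ (Equiv.Perm I) V where
  toFun g := ((Equiv.Perm.sign g : ℤ) : ℂ) • ρ g
  map_one' := by simp
  map_mul' g h := by
    rw [map_mul, map_mul, smul_mul_smul_comm]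
    simp

theorem signTwist_apply (ρ : Representation ℂ (Equiv.Perm I) V) (g : Equiv.Perm I) (v : V) :
    signTwist ρ g v = ((Equiv.Perm.sign g : ℤ) : ℂ) • ρ g v := rfl

theorem character_signTwist (ρ : Representation ℂ (Equiv.Perm I) V) (g : Equiv.Perm I) :
    (signTwist ρ).character g = ((Equiv.Perm.sign g : ℤ) : ℂ) * ρ.character g := by
  change LinearMap.trace ℂ V (((Equiv.Perm.sign g : ℤ) : ℂ) • ρ g) = _
  rw [map_smul]
  rfl

theorem asAlgebraHom_signTwist_rowSym (ρ : Representation ℂ (Equiv.Perm I) V) {α : Type*}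
    [DecidableEq α] (row : I → α) (v : V) :
    (signTwist ρ).asAlgebraHom (rowSym row) v = ρ.asAlgebraHom (colAnti row) v := by
  rw [asAlgebraHom_rowSym, asAlgebraHom_colAnti]
  rfl

theorem asAlgebraHom_signTwist_colAnti (ρ : Representation ℂ (Equiv.Perm I) V) {α : Type*}
    [DecidableEq α] (col : I → α) (v : V) :
    (signTwist ρ).asAlgebraHom (colAnti col) v = ρ.asAlgebraHom (rowSym col) v := by
  rw [asAlgebraHom_rowSym, asAlgebraHom_colAnti]
  refine Finset.sum_congr rfl fun g _ => ?_
  rw [signTwist_apply, smul_smul, sign_mul_sign, one_smul]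

theorem isIrreducible_signTwist {ρ : Representation ℂ (Equiv.Perm I) V} (h : ρ.IsIrreducible) :
    (signTwist ρ).IsIrreducible := by
  have hsmul : ∀ (g : Equiv.Perm I) (v : V) (N : Submodule ℂ V),
      ((Equiv.Perm.sign g : ℤ) : ℂ) • v ∈ N ↔ v ∈ N := by
    intro g v N
    refine ⟨fun hv => ?_, fun hv => N.smul_mem _ hv⟩
    have := N.smul_mem ((Equiv.Perm.sign g : ℤ) : ℂ) hv
    rwa [smul_smul, sign_mul_sign, one_smul] at this
  let F : Subrepresentation (signTwist ρ) ≃o Subrepresentation ρ :=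
    { toFun := fun S => ⟨S.toSubmodule, fun g v hv => (hsmul g _ _).1 (S.apply_mem_toSubmodule g hv)⟩
      invFun := fun S => ⟨S.toSubmodule, fun g v hv => (hsmul g _ _).2 (S.apply_mem_toSubmodule g hv)⟩
      left_inv := fun _ => rfl
      right_inv := fun _ => rfl
      map_rel_iff' := Iff.rfl }
  exact F.isSimpleOrder_iff.2 h

/-- The twist of an intertwining map. -/
def signTwistMap {ρ : Representation ℂ (Equiv.Perm I) V} {σ : Representation ℂ (Equiv.Perm I) W}
    (f : IntertwiningMap ρ σ) : IntertwiningMap (signTwist ρ) (signTwist σ) where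
  toLinearMap := f.toLinearMap
  isIntertwining' g := by
    ext v
    have := LinearMap.congr_fun (f.isIntertwining' g) v
    simp only [LinearMap.comp_apply] at this ⊢
    rw [signTwist_apply, signTwist_apply, map_smul, this]

/-- Multiplication by the sign permutes the irreducible characters. -/
theorem sign_mul_mem_irr {φ : Equiv.Perm I → ℂ} (h : φ ∈ Irr (Equiv.Perm I)) :
    (fun g => ((Equiv.Perm.sign g : ℤ) : ℂ) * φ g) ∈ Irr (Equiv.Perm I) := by
  obtain ⟨V, i1, i2, i3, ρ, hρ, rfl⟩ := h
  exact ⟨V, i1, i2, i3, signTwist ρ, isIrreducible_signTwist hρ,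
    funext fun g => (character_signTwist ρ g).symm⟩

/-- Row symmetrization multiplies a word that is constant along rows by a scalar. -/
theorem asAlgebraHom_rowSym_single {C : Type} {α : Type*} [DecidableEq α] (row : I → α)
    (f : I → C) (hf : ∀ i j, row i = row j → f i = f j) : ∃ c : ℂ, c ≠ 0 ∧
    (wordRep I C).asAlgebraHom (rowSym row) (Finsupp.single f 1) = c • Finsupp.single f 1 := by
  refine ⟨#{g : Equiv.Perm I | ∀ i, row (g i) = row i},
    Nat.cast_ne_zero.2 (Finset.card_ne_zero.2 ⟨1, by simp⟩), ?_⟩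
  rw [asAlgebraHom_rowSym, Nat.cast_smul_eq_nsmul, ← Finset.sum_const]
  refine Finset.sum_congr rfl fun g hg => ?_
  rw [wordRep_single]
  congr 1
  funext i
  refine hf _ _ ?_
  have := (mem_filter.1 hg).2 (g⁻¹ i)
  rw [perm_apply_inv_self] at this
  exact this.symm

end Twist

/-! ### Specht modules -/

section Specht

/-- A subrepresentation generated by a multiple of `e • τ`, with `e` of rank one, is irreducible, and
`e` acts on it nontrivially. -/
theorem IsRankOne.isIrreducible_of_generated {G : Type} [Group G] [Fintype G] {U X : Type}
    [AddCommGroup U] [Module ℂ U] [AddCommGroup X] [Module ℂ X] {σ : Representation ℂ G U}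
    {ω : Representation ℂ G X} {e : MonoidAlgebra ℂ G} (he : IsRankOne ℂ e)
    (j : IntertwiningMap σ ω) (hj : Function.Injective j) {τ x : X} {c : ℂ} (hc : c ≠ 0)
    (hx : x ≠ 0) (hτ : ω.asAlgebraHom e τ = c • x) (h1 : ∃ u, j u = x)
    (h2 : ∀ u, j u ∈ Submodule.span ℂ (Set.range fun g => ω g x)) :
    σ.IsIrreducible ∧ Acts σ e := by
  let i : σ.asModule →ₗ[MonoidAlgebra ℂ G] ω.asModule := IntertwiningMap.equivLinearMapAsModule σ ω j
  let τ' : ω.asModule := τ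
  let x' : ω.asModule := (c • x : X)
  have hτ' : e • τ' = x' := hτ
  have hgen : ∀ y : X, y ∈ Submodule.span ℂ (Set.range fun g => ω g x) →
      ∀ y' : ω.asModule, y' = y → y' ∈ Submodule.span (MonoidAlgebra ℂ G) {x'} := by
    intro y hy
    induction hy using Submodule.span_induction with
    | mem y hy =>
      rintro y' rfl
      obtain ⟨g, hg⟩ := hy
      refine Submodule.mem_span_singleton.2 ⟨MonoidAlgebra.single g c⁻¹, ?_⟩
      rw [← hg]
      change ω.asAlgebraHom (MonoidAlgebra.single g c⁻¹) (c • x) = ω g x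
      rw [asAlgebraHom_single, LinearMap.smul_apply, map_smul, smul_smul, inv_mul_cancel₀ hc,
        one_smul]
    | zero =>
      rintro y' rfl
      exact Submodule.zero_mem _
    | add y z _ _ hy hz =>
      rintro y' rfl
      exact Submodule.add_mem _ (hy _ rfl) (hz _ rfl)
    | smul a y _ hy =>
      rintro y' rfl
      have h := Submodule.smul_mem _ (MonoidAlgebra.single (1 : G) a) (hy _ rfl)
      have h3 : (ω.asAlgebraHom (MonoidAlgebra.single (1 : G) a)) y = a • y := by
        rw [asAlgebraHom_single, map_one, LinearMap.smul_apply, Module.End.one_apply]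
      exact h3 ▸ h
  have key := he.isSimpleModule_of_range_eq i hj (τ := τ')
    (by rw [hτ']; exact smul_ne_zero hc hx) ?_
  · rw [irreducible_iff_isSimpleModule_asModule]
    exact ⟨key.1, acts_iff.2 key.2⟩
  · rw [hτ']
    apply le_antisymm
    · rintro _ ⟨u, rfl⟩
      exact hgen _ (h2 u) _ rfl
    · rw [Submodule.span_singleton_le_iff_mem]
      obtain ⟨u, hu⟩ := h1
      refine ⟨(c • u : U), ?_⟩
      change j (c • u) = c • x
      rw [map_smul, hu]

variable {n : ℕ} {lam : n.Partition}

/-- The underlying vector space of the Specht module. -/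
def SpechtModule (lam : n.Partition) : Type := (specht lam).toSubmodule

instance (lam : n.Partition) : AddCommGroup (SpechtModule lam) :=
  inferInstanceAs (AddCommGroup (specht lam).toSubmodule)

instance (lam : n.Partition) : Module ℂ (SpechtModule lam) :=
  inferInstanceAs (Module ℂ (specht lam).toSubmodule)

instance (lam : n.Partition) : FiniteDimensional ℂ (SpechtModule lam) :=
  FiniteDimensional.span_of_finite ℂ (Set.finite_range _)

/-- The action on the Specht module. -/
def spechtAction (lam : n.Partition) : Representation ℂ (Equiv.Perm (Fin n)) (SpechtModule lam) :=
  spechtRep lam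

theorem character_spechtAction (lam : n.Partition) :
    (spechtAction lam).character = spechtChar lam := rfl

/-- The inclusion of the Specht module in the module of all row assignments. -/
def spechtInclusion (lam : n.Partition) : IntertwiningMap (spechtAction lam) (tabloidRep n) where
  toLinearMap := (specht lam).toSubmodule.subtype
  isIntertwining' _ := rfl

theorem spechtInclusion_injective (lam : n.Partition) : Function.Injective (spechtInclusion lam) :=
  Subtype.val_injective

/-- The column of each entry of a tableau. -/
def columnOf (T : Tableau lam) : Fin n → ℕ := fun i => (T i).1.2

theorem isDiagram_tableau (T : Tableau lam) : IsDiagram (rowTabloid T) (columnOf T) where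
  inj i j h := by
    simp only [rowTabloid, columnOf, Prod.mk.injEq] at h
    exact T.injective (Subtype.ext (Prod.ext h.1 h.2))
  justified i r hr := by
    have hmem : (r, (T i).1.2) ∈ diagram lam :=
      (diagram lam).up_left_mem hr.le le_rfl ((YoungDiagram.mem_cells _).1 (T i).2)
    refine ⟨T.symm ⟨_, (YoungDiagram.mem_cells _).2 hmem⟩, ?_, ?_⟩ <;> simp [rowTabloid, columnOf]

theorem polytabloid_eq (T : Tableau lam) : polytabloid T
    = (tabloidRep n).asAlgebraHom (colAnti (columnOf T)) (Finsupp.single (rowTabloid T) 1) := by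
  rw [asAlgebraHom_colAnti]
  exact Finset.sum_congr (by unfold columnGroup columnOf; congr!) fun _ _ => rfl

/-- The coefficients of a polytabloid are products of minors of permutation matrices, one for each
column. -/
theorem polytabloid_apply (T : Tableau lam) (w : Fin n → ℕ) : polytabloid T w
    = (Matrix.of fun i j => if columnOf T i = columnOf T j then
        if rowTabloid T j = w i then (1 : ℂ) else 0 else 0).det := by
  rw [polytabloid, Finsupp.finsetSum_apply, det_ite_eq_sum]
  refine Finset.sum_congr (by unfold columnGroup columnOf; congr!) fun g _ => ?_
  rw [tabloidRep_eq_wordRep, wordRep_single, Finsupp.smul_apply, smul_eq_mul, Finsupp.single_apply]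
  simp only [Finset.prod_ite_zero, Finset.prod_const_one]
  congr 1
  refine if_congr ⟨?_, fun h => funext fun i => ?_⟩ rfl rfl
  · rintro rfl i _
    exact congrArg _ (perm_inv_apply_self g i).symm
  · rw [h _ (mem_univ _), perm_apply_inv_self]

theorem polytabloid_ne_zero (T : Tableau lam) : polytabloid T ≠ 0 := by
  intro h0
  have h1 := polytabloid_apply T (rowTabloid T)
  have h2 : (Matrix.of fun i j => if columnOf T i = columnOf T j then
        if rowTabloid T j = rowTabloid T i then (1 : ℂ) else 0 else 0) = 1 := by
    ext i j
    rw [Matrix.one_apply, Matrix.of_apply, ← ite_and]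
    refine if_congr ⟨fun h => (isDiagram_tableau T).inj (Prod.ext h.2.symm h.1), ?_⟩ rfl rfl
    rintro rfl
    exact ⟨rfl, rfl⟩
  rw [h0, h2, Matrix.det_one] at h1
  exact zero_ne_one h1

theorem exists_tabloidRep_polytabloid_eq (T T' : Tableau lam) :
    ∃ g, polytabloid T' = tabloidRep n g (polytabloid T) := by
  refine ⟨(T'.trans T.symm : Equiv.Perm (Fin n))⁻¹, ?_⟩
  rw [tabloidRep_polytabloid, inv_inv]
  congr 1
  ext i : 1
  simp

/-- Specht modules are irreducible, being generated by `b • {T}`, a multiple of `b a • {T}`, where `a` and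
`b` are the row symmetrizer and the column antisymmetrizer of `T`. -/
theorem isIrreducible_spechtAction (T : Tableau lam) : (spechtAction lam).IsIrreducible ∧
    Acts (spechtAction lam) (youngSym (rowTabloid T) (columnOf T)) := by
  have hD := isDiagram_tableau T
  obtain ⟨c, hc, hrow⟩ := asAlgebraHom_rowSym_single (rowTabloid T) (rowTabloid T) fun _ _ h => h
  obtain ⟨h1, h2⟩ := hD.isRankOne_colAnti_mul_rowSym.isIrreducible_of_generated
    (spechtInclusion lam) (spechtInclusion_injective lam) hc (polytabloid_ne_zero T)
    (τ := Finsupp.single (rowTabloid T) 1)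
    (by rw [map_mul, Module.End.mul_apply, tabloidRep_eq_wordRep, hrow, map_smul, polytabloid_eq]; rfl)
    ⟨⟨polytabloid T, Submodule.subset_span ⟨T, rfl⟩⟩, rfl⟩ (fun u => by
      refine Submodule.span_mono ?_ u.2
      rintro _ ⟨T', rfl⟩
      obtain ⟨g, hg⟩ := exists_tabloidRep_polytabloid_eq T T'
      exact ⟨g, hg.symm⟩)
  refine ⟨h1, ?_⟩
  have := (irreducible_iff_isSimpleModule_asModule (spechtAction lam)).1 h1
  exact acts_iff.2 (hD.exists_youngSym_smul_ne_zero (acts_iff.1 h2))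

/-- The twist of the Specht module of the transposed shape: its Young symmetrizer for the original
tableau acts nontrivially, rows and columns being exchanged. -/
theorem isIrreducible_signTwist_spechtAction {lam' : n.Partition} (T : Tableau lam) (T' : Tableau lam')
    (hrow : rowTabloid T' = columnOf T) (hcol : columnOf T' = rowTabloid T) :
    (signTwist (spechtAction lam')).IsIrreducible ∧
      Acts (signTwist (spechtAction lam')) (youngSym (rowTabloid T) (columnOf T)) := by
  obtain ⟨c, hc, hc'⟩ := asAlgebraHom_rowSym_single (columnOf T) (columnOf T) fun _ _ h => h
  refine (isDiagram_tableau T).isRankOne_youngSym.isIrreducible_of_generated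
    (signTwistMap (spechtInclusion lam')) (spechtInclusion_injective lam') hc
    (polytabloid_ne_zero T') (τ := Finsupp.single (columnOf T) 1)
    ?_ ⟨⟨polytabloid T', Submodule.subset_span ⟨T', rfl⟩⟩, rfl⟩ (fun u => ?_)
  · rw [youngSym, map_mul, Module.End.mul_apply, asAlgebraHom_signTwist_colAnti, tabloidRep_eq_wordRep, hc', map_smul,
      asAlgebraHom_signTwist_rowSym, polytabloid_eq, hrow, hcol]
    rfl
  · refine (Submodule.span_le.2 ?_ : _ ≤ _) u.2
    rintro _ ⟨T'', rfl⟩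
    obtain ⟨g, hg⟩ := exists_tabloidRep_polytabloid_eq T' T''
    have h1 : polytabloid T'' = ((Equiv.Perm.sign g : ℤ) : ℂ) •
        signTwist (tabloidRep n) g (polytabloid T') := by
      rw [signTwist_apply, smul_smul, sign_mul_sign, one_smul, hg]
    rw [SetLike.mem_coe, h1]
    exact Submodule.smul_mem _ _ (Submodule.subset_span ⟨g, rfl⟩)

/-- Transposing the diagram multiplies the character by the sign. -/
theorem spechtChar_transpose {lam' : n.Partition}
    (h : ∀ a b, (a, b) ∈ diagram lam' ↔ (b, a) ∈ diagram lam) (T : Tableau lam) (g) :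
    spechtChar lam' g = ((Equiv.Perm.sign g : ℤ) : ℂ) * spechtChar lam g := by
  let e : (diagram lam).cells ≃ (diagram lam').cells :=
    (Equiv.prodComm ℕ ℕ).subtypeEquiv fun ⟨a, b⟩ => by
      rw [YoungDiagram.mem_cells, YoungDiagram.mem_cells]
      exact (h b a).symm
  obtain ⟨h1, h2⟩ := isIrreducible_spechtAction T
  obtain ⟨h3, h4⟩ := isIrreducible_signTwist_spechtAction T (T.trans e) rfl rfl
  obtain ⟨f⟩ := (isDiagram_tableau T).isRankOne_youngSym.nonempty_repEquiv h2 h4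
  have h5 := congrFun (char_iso f) g
  rw [character_signTwist] at h5
  change spechtChar lam g = _ * spechtChar lam' g at h5
  rw [h5, ← mul_assoc, sign_mul_sign, one_mul]

theorem mem_diagram_iff {w : List ℕ} (hw : w.Pairwise (· ≥ ·)) (h : lam.parts = (w : Multiset ℕ))
    (c : ℕ × ℕ) : c ∈ diagram lam ↔ ∃ hc : c.1 < w.length, c.2 < w[c.1] := by
  have hs : lam.parts.sort (· ≥ ·) = w := by
    rw [h]
    exact List.Perm.eq_of_pairwise' (Multiset.pairwise_sort _ _) hw
      (Multiset.coe_eq_coe.1 (Multiset.sort_eq _ _))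
  unfold diagram
  rw [YoungDiagram.mem_ofRowLens]
  simp only [hs]

/-- A diagram whose cells are those of `lam` is a tableau. -/
theorem exists_tableau {row col : Fin n → ℕ} (hD : IsDiagram row col)
    (hmem : ∀ i, (row i, col i) ∈ diagram lam)
    (hsurj : ∀ a b, (a, b) ∈ diagram lam → ∃ i, row i = a ∧ col i = b) :
    ∃ T : Tableau lam, rowTabloid T = row ∧ columnOf T = col := by
  refine ⟨Equiv.ofBijective (fun i => ⟨(row i, col i), (YoungDiagram.mem_cells _).2 (hmem i)⟩) ⟨?_, ?_⟩,
    rfl, rfl⟩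
  · intro i j h
    exact hD.inj (congrArg Subtype.val h)
  · rintro ⟨⟨a, b⟩, hab⟩
    obtain ⟨i, rfl, rfl⟩ := hsurj a b ((YoungDiagram.mem_cells _).1 hab)
    exact ⟨i, rfl⟩

/-- The coefficients of the tensor of a matching with at most one unmatched point, as determinants: the
pairs are the columns of height two. -/
theorem det_matching {P S : Type} [Fintype P] [DecidableEq P] [Fintype S] [DecidableEq S]
    [Subsingleton S] (E : (P × Fin 2) ⊕ S ≃ Fin n) {row col : Fin n → ℕ} {cp : P → ℕ} {cs : ℕ}
    (hr : ∀ p e, row (E (.inl (p, e))) = (e : ℕ)) (hr' : ∀ j, row (E (.inr j)) = 0)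
    (hc : ∀ p e, col (E (.inl (p, e))) = cp p) (hc' : ∀ j, col (E (.inr j)) = cs)
    (hcp : Function.Injective cp) (hcs : ∀ p, cp p ≠ cs) (f : Fin n → Fin 2) :
    (Matrix.of fun i j => if col i = col j then
        if row j = (f i : ℕ) then (1 : ℂ) else 0 else 0).det = matchVec E f := by
  rw [← Matrix.det_submatrix_equiv_self E]
  have h1 : ((Matrix.of fun i j => if col i = col j then
        if row j = (f i : ℕ) then (1 : ℂ) else 0 else 0).submatrix E E)
      = Matrix.fromBlocks ((Matrix.blockDiagonal fun p : P => Matrix.of fun e e' : Fin 2 =>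
            if (e' : ℕ) = (f (E (.inl (p, e))) : ℕ) then (1 : ℂ) else 0).submatrix
              (Equiv.prodComm _ _) (Equiv.prodComm _ _)) 0 0
          (Matrix.diagonal fun j : S => if f (E (.inr j)) = 0 then (1 : ℂ) else 0) := by
    ext (⟨p, e⟩ | j) (⟨p', e'⟩ | j')
    · simp [hr, hc, hcp.eq_iff, Matrix.blockDiagonal_apply]
    · simp [hc, hc', hcs]
    · simp [hc, hc', (hcs _).symm]
    · rw [Subsingleton.elim j' j]
      simp only [Matrix.submatrix_apply, Matrix.of_apply, if_true, hr', Matrix.fromBlocks_apply₂₂,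
        Matrix.diagonal_apply_eq, Fin.ext_iff, Fin.val_zero, eq_comm]
  rw [h1, Matrix.det_fromBlocks_zero₁₂, Matrix.det_submatrix_equiv_self, Matrix.det_blockDiagonal,
    Matrix.det_diagonal, matchVec]
  push_cast
  congr 1
  refine Finset.prod_congr rfl fun p _ => ?_
  rw [Matrix.det_fin_two]
  simp only [Matrix.of_apply]
  generalize f (E (Sum.inl (p, 0))) = a
  generalize f (E (Sum.inl (p, 1))) = b
  fin_cases a <;> fin_cases b <;> simp

section TwoRows

variable {k : ℕ}

theorem mem_diagram_two_rows (hlam : lam.parts = {k, k - 1}) (a b : ℕ) :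
    (a, b) ∈ diagram lam ↔ a = 0 ∧ b < k ∨ a = 1 ∧ b < k - 1 := by
  rw [mem_diagram_iff (w := [k, k - 1]) (by simp) hlam]
  rcases a with _ | _ | a <;> simp

theorem mem_diagram_two_columns (hk : 1 ≤ k)
    (hlam : lam.parts = Multiset.replicate (k - 1) 2 + {1}) (a b : ℕ) :
    (a, b) ∈ diagram lam ↔ b = 0 ∧ a < k ∨ b = 1 ∧ a < k - 1 := by
  rw [mem_diagram_iff (w := List.replicate (k - 1) 2 ++ [1])
    (by simp [List.pairwise_append, List.pairwise_replicate, List.mem_replicate]) (by rw [hlam]; rfl)]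
  constructor
  · rintro ⟨h1, h2⟩
    simp only [List.length_append, List.length_replicate, List.length_singleton] at h1
    rw [List.getElem_append] at h2
    split_ifs at h2 with h3 <;> simp at h2 h3 <;> omega
  · intro h
    refine ⟨by simp; omega, ?_⟩
    rw [List.getElem_append]
    split_ifs with h3 <;> simp at h3 ⊢ <;> omega

/-- The tensors of the matchings with one unmatched point are polytabloids of shape `(k, k - 1)`. -/
theorem exists_polytabloid_eq (hn : n + 1 = 2 * k) (hlam : lam.parts = {k, k - 1})
    {v : (Fin n → Fin 2) → ℤ} (hv : IsMatching 1 (Fin n) v) :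
    ∃ T : Tableau lam, polytabloid T = ∑ f, Finsupp.single (fun i => (f i : ℕ)) (v f : ℂ) := by
  classical
  obtain ⟨P, S, _, _, E, hS, rfl⟩ := hv
  have hcard := Fintype.card_congr E
  simp only [Fintype.card_sum, Fintype.card_prod, Fintype.card_fin, hS] at hcard
  have hP : Fintype.card P = k - 1 := by omega
  have hsub : Subsingleton S := Fintype.card_le_one_iff_subsingleton.1 hS.le
  let ip : P ≃ Fin (k - 1) := Fintype.equivFinOfCardEq hP
  let row : Fin n → ℕ := fun i => Sum.elim (fun x => (x.2 : ℕ)) (fun _ => 0) (E.symm i)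
  let col : Fin n → ℕ := fun i => Sum.elim (fun x => (ip x.1 : ℕ)) (fun _ => k - 1) (E.symm i)
  have hr : ∀ p e, row (E (.inl (p, e))) = (e : ℕ) := fun p e => by simp [row]
  have hr' : ∀ j, row (E (.inr j)) = 0 := fun p => by simp [row]
  have hc : ∀ p e, col (E (.inl (p, e))) = ip p := fun p e => by simp [col]
  have hc' : ∀ j, col (E (.inr j)) = k - 1 := fun p => by simp [col]
  have hD : IsDiagram row col := by
    constructor
    · intro i j hij
      obtain ⟨x, rfl⟩ := E.surjective i
      obtain ⟨y, rfl⟩ := E.surjective j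
      have h1 := congrArg Prod.fst hij
      have h2 := congrArg Prod.snd hij
      rcases x with ⟨p, e⟩ | s <;> rcases y with ⟨p', e'⟩ | s'
      · simp only [hr, hc] at h1 h2
        rw [Fin.ext h1, ip.injective (Fin.ext h2)]
      · simp only [hc, hc'] at h2
        exact absurd h2 (ip p).2.ne
      · simp only [hc, hc'] at h2
        exact absurd h2 (ip p').2.ne'
      · rw [Subsingleton.elim s s']
    · intro i r hri
      obtain ⟨x, rfl⟩ := E.surjective i
      rcases x with ⟨p, e⟩ | s
      · rw [hr] at hri
        refine ⟨E (.inl (p, ⟨r, by omega⟩)), by rw [hr], by rw [hc, hc]⟩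
      · rw [hr'] at hri
        omega
  obtain ⟨T, hT1, hT2⟩ := exists_tableau (lam := lam) hD
    (fun i => by
      obtain ⟨x, rfl⟩ := E.surjective i
      rw [mem_diagram_two_rows hlam]
      rcases x with ⟨p, e⟩ | s
      · rw [hr, hc]
        have := (ip p).2
        omega
      · rw [hr', hc']
        omega)
    (fun a b hab => by
      rw [mem_diagram_two_rows hlam] at hab
      by_cases hb : b < k - 1
      · refine ⟨E (.inl (ip.symm ⟨b, hb⟩, ⟨a, by omega⟩)), by rw [hr], by rw [hc]; simp⟩
      · obtain ⟨s⟩ : Nonempty S := Fintype.card_pos_iff.1 (by omega)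
        exact ⟨E (.inr s), by rw [hr']; omega, by rw [hc']; omega⟩)
  refine ⟨T, ?_⟩
  ext w
  rw [polytabloid_apply, Finsupp.finsetSum_apply, hT1, hT2]
  by_cases hw : ∃ f : Fin n → Fin 2, w = fun i => (f i : ℕ)
  · obtain ⟨f, rfl⟩ := hw
    rw [det_matching E hr hr' hc hc' (Fin.val_injective.comp ip.injective) (fun p => (ip p).2.ne)]
    rw [Finset.sum_eq_single f]
    · rw [Finsupp.single_eq_same]
    · intro f' _ hf'
      rw [Finsupp.single_eq_of_ne]
      intro h
      exact hf' (funext fun i => (Fin.ext (congrFun h i)).symm)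
    · simp
  · have hex : ∃ i, 2 ≤ w i := by
      by_contra! hcon
      exact hw ⟨fun i => ⟨w i, hcon i⟩, rfl⟩
    obtain ⟨i, hi⟩ := hex
    rw [Matrix.det_eq_zero_of_row_eq_zero i, Finset.sum_eq_zero]
    · intro f _
      rw [Finsupp.single_eq_of_ne]
      rintro rfl
      exact hw ⟨f, rfl⟩
    · intro j
      have hj : row j ≠ w i := by
        obtain ⟨x, rfl⟩ := E.surjective j
        rcases x with ⟨p, e⟩ | s
        · rw [hr]; omega
        · rw [hr']; omega
      simp [hj]

theorem spechtChar_two_columns (hk : 1 ≤ k) {lam' : n.Partition} (hlam : lam.parts = {k, k - 1})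
    (hlam' : lam'.parts = Multiset.replicate (k - 1) 2 + {1}) (T : Tableau lam) (g) :
    spechtChar lam' g = ((Equiv.Perm.sign g : ℤ) : ℂ) * spechtChar lam g :=
  spechtChar_transpose (fun a b => by
    rw [mem_diagram_two_rows hlam, mem_diagram_two_columns hk hlam']) T g

end TwoRows

end Specht

end

/-! ### Upper bound -/

section

open Finset Representation
open scoped TensorProduct

section Upper

variable {n : ℕ}

/-- Detection of the representations occurring in words over `c` letters: it suffices to consider the
Young symmetrizers of the diagrams with at most `c` rows, for one choice of diagrams. -/
theorem exists_acts_of_embeds {c : ℕ} {X : Type} [AddCommGroup X] [Module ℂ X]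
    {ω : Representation ℂ (Equiv.Perm (Fin n)) X}
    (H : ∀ mu : n.Partition, (∀ p ∈ mu.parts, p ≤ c) →
      ∃ (κ : Type) (_ : DecidableEq κ) (row : Fin n → ℕ) (col : Fin n → κ), IsDiagram row col ∧
        (∀ r, #{i | row i = r} = rowLength mu.parts r) ∧ Acts ω (youngSym row col))
    {U : Type} [AddCommGroup U] [Module ℂ U] [FiniteDimensional ℂ U]
    {τ : Representation ℂ (Equiv.Perm (Fin n)) U} [τ.IsIrreducible]
    (f : IntertwiningMap τ (wordRep (Fin n) (Fin c))) (hf : Function.Injective f) :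
    ∃ e, IsRankOne ℂ e ∧ Acts τ e ∧ Acts ω e := by
  -- The diagrams with more than `c` rows play no role, and any choice will do.
  have H' : ∀ mu : n.Partition, ∃ (κ : Type) (_ : DecidableEq κ) (row : Fin n → ℕ) (col : Fin n → κ),
      IsDiagram row col ∧ (∀ r, #{i | row i = r} = rowLength mu.parts r) ∧
      ((∀ p ∈ mu.parts, p ≤ c) → Acts ω (youngSym row col)) := by
    intro mu
    by_cases hmu : ∀ p ∈ mu.parts, p ≤ c
    · obtain ⟨κ, i, row, col, h1, h2, h3⟩ := H mu hmu
      exact ⟨κ, i, row, col, h1, h2, fun _ => h3⟩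
    · obtain ⟨κ, i, row, col, h1, h2, -⟩ :=
        (hasConfig_anyTensor (h := n + 2) (by omega) mu.parts (fun p hp => by
          have := Multiset.le_sum_of_mem hp
          rw [mu.parts_sum] at this
          omega)).exists_fin (fun _ _ => True.intro) mu.parts_sum
      exact ⟨κ, i, row, col, h1, h2, fun h => absurd h hmu⟩
  choose κ _ row col hD hrow hact using H'
  obtain ⟨mu, hmu⟩ := exists_acts_youngSym row col hD hrow τ
  refine ⟨_, (hD mu).isRankOne_youngSym, hmu, hact mu fun p hp => ?_⟩
  by_contra! hlt
  have hpos : 0 < rowLength mu.parts c :=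
    Multiset.card_pos_iff_exists_mem.2 ⟨p, Multiset.mem_filter.2 ⟨hp, hlt⟩⟩
  rw [← hrow] at hpos
  obtain ⟨i, hi⟩ := Finset.card_pos.1 hpos
  have h1 := row_lt_card_of_acts_wordRep (hD mu) (hmu.of_injective f hf) i
  rw [(mem_filter.1 hi).2, Fintype.card_fin] at h1
  exact h1.false

/-- Every irreducible representation of `S_n` occurs in the words over at least `n` letters. -/
theorem exists_injective_wordRep {c : ℕ} (hc : n ≤ c) {U : Type} [AddCommGroup U] [Module ℂ U]
    [FiniteDimensional ℂ U] (τ : Representation ℂ (Equiv.Perm (Fin n)) U) [τ.IsIrreducible] :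
    ∃ f : IntertwiningMap τ (wordRep (Fin n) (Fin c)), Function.Injective f := by
  have H : ∀ mu : n.Partition, ∃ (κ : Type) (_ : DecidableEq κ) (row : Fin n → ℕ) (col : Fin n → κ),
      IsDiagram row col ∧ (∀ r, #{i | row i = r} = rowLength mu.parts r) := by
    intro mu
    obtain ⟨κ, i, row, col, h1, h2, -⟩ :=
      (hasConfig_anyTensor (h := n + 2) (by omega) mu.parts (fun p hp => by
        have := Multiset.le_sum_of_mem hp
        rw [mu.parts_sum] at this
        omega)).exists_fin (fun _ _ => True.intro) mu.parts_sum
    exact ⟨κ, i, row, col, h1, h2⟩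
  choose κ _ row col hD hrow using H
  obtain ⟨mu, hmu⟩ := exists_acts_youngSym row col hD hrow τ
  exact (hD mu).isRankOne_youngSym.exists_injective hmu
    (acts_wordRep_of_injective (hD mu) (Fin.castLE_injective hc))

variable {k : ℕ} {lam : n.Partition}

theorem exists_spechtInclusion_eq (hn : n + 1 = 2 * k) (hlam : lam.parts = {k, k - 1})
    {v : (Fin n → Fin 2) → ℤ} (hv : IsMatching 1 (Fin n) v) :
    ∃ u, spechtInclusion lam u = ∑ f, Finsupp.single (fun i => (f i : ℕ)) (v f : ℂ) := by
  obtain ⟨T, hT⟩ := exists_polytabloid_eq hn hlam hv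
  exact ⟨⟨polytabloid T, Submodule.subset_span ⟨T, rfl⟩⟩, hT⟩

/-- Young symmetrizers of suitable diagrams with at most `2h` rows act nontrivially on the product of the Specht module with words
over `h` letters. -/
theorem exists_acts_tprod_wordRep (hn : n + 1 = 2 * k) (hlam : lam.parts = {k, k - 1}) {h : ℕ}
    (hh : 2 ≤ h) (mu : n.Partition) (hmu : ∀ p ∈ mu.parts, p ≤ 2 * h) :
    ∃ (κ : Type) (_ : DecidableEq κ) (row : Fin n → ℕ) (col : Fin n → κ), IsDiagram row col ∧
      (∀ r, #{i | row i = r} = rowLength mu.parts r) ∧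
      Acts (tprod (spechtAction lam) (wordRep (Fin n) (Fin h))) (youngSym row col) := by
  obtain ⟨κ, i, row, col, h1, h2, v, y, hv, -, z, hz⟩ :=
    (hasConfig_anyTensor hh mu.parts hmu).exists_fin (fun _ _ => True.intro) mu.parts_sum
  refine ⟨κ, i, row, col, h1, h2, ?_⟩
  rw [mu.parts_sum, show n % 2 = 1 by omega] at hv
  exact acts_tprod_of_minorSum_ne_zero (spechtInclusion lam) (IntertwiningMap.id _)
    (ι₁ := Fin.val) (π₁ := Fin.ofNat 2) (ι₂ := id) (π₂ := id) (fun x => by simp) (fun _ => rfl)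
    (exists_spechtInclusion_eq hn hlam hv) ⟨_, rfl⟩ hz

/-- Young symmetrizers of suitable diagrams with at most four rows act nontrivially on the square of the Specht module. -/
theorem exists_acts_tprod_self (hn : n + 1 = 2 * k) (hlam : lam.parts = {k, k - 1})
    (mu : n.Partition) (hmu : ∀ p ∈ mu.parts, p ≤ 4) :
    ∃ (κ : Type) (_ : DecidableEq κ) (row : Fin n → ℕ) (col : Fin n → κ), IsDiagram row col ∧
      (∀ r, #{i | row i = r} = rowLength mu.parts r) ∧
      Acts (tprod (spechtAction lam) (spechtAction lam)) (youngSym row col) := by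
  obtain ⟨κ, i, row, col, h1, h2, v, y, hv, hy, z, hz⟩ :=
    (hasConfig_isMatching mu.parts (fun p hp => ⟨mu.parts_pos hp, hmu p hp⟩)
      (by rw [mu.parts_sum]; exact ⟨k - 1, by omega⟩)).exists_fin IsMatching.equiv mu.parts_sum
  exact ⟨κ, i, row, col, h1, h2, acts_tprod_of_minorSum_ne_zero (spechtInclusion lam)
    (spechtInclusion lam) (ι₁ := Fin.val) (π₁ := Fin.ofNat 2) (ι₂ := Fin.val) (π₂ := Fin.ofNat 2)
    (fun x => by simp) (fun x => by simp) (exists_spechtInclusion_eq hn hlam hv)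
    (exists_spechtInclusion_eq hn hlam hy) hz⟩

/-- The `m`-th power of the character contains all irreducible constituents of the words over `2 ^ m`
letters. -/
theorem exists_power_covering (hn : n + 1 = 2 * k) (hlam : lam.parts = {k, k - 1}) {m : ℕ}
    (hm : 2 ≤ m) : ∃ (X : Type) (_ : AddCommGroup X) (_ : Module ℂ X) (_ : FiniteDimensional ℂ X)
      (ρ : Representation ℂ (Equiv.Perm (Fin n)) X), ρ.character = spechtChar lam ^ m ∧
      ∀ (U : Type) [AddCommGroup U] [Module ℂ U] [FiniteDimensional ℂ U]
        (τ : Representation ℂ (Equiv.Perm (Fin n)) U) [τ.IsIrreducible]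
        (f : IntertwiningMap τ (wordRep (Fin n) (Fin (2 ^ m)))), Function.Injective f →
        ∃ g : IntertwiningMap τ ρ, Function.Injective g := by
  induction m, hm using Nat.le_induction with
  | base =>
    refine ⟨SpechtModule lam ⊗[ℂ] SpechtModule lam, inferInstance, inferInstance, inferInstance,
      tprod (spechtAction lam) (spechtAction lam), ?_, ?_⟩
    · rw [char_tensor, character_spechtAction, sq]
    · intro U _ _ _ τ _ f hf
      obtain ⟨e, he, h1, h2⟩ := exists_acts_of_embeds (exists_acts_tprod_self hn hlam) f hf
      exact he.exists_injective h1 h2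
  | succ m hm ih =>
    obtain ⟨X, _, _, _, ρ, hρ, hX⟩ := ih
    refine ⟨SpechtModule lam ⊗[ℂ] X, inferInstance, inferInstance, inferInstance,
      tprod (spechtAction lam) ρ, ?_, ?_⟩
    · rw [char_tensor, character_spechtAction, hρ, pow_succ']
    · intro U _ _ _ τ _ f hf
      have h4 : 2 ≤ 2 ^ m := (Nat.le_self_pow (by omega) 2)
      obtain ⟨e, he, h1, h2⟩ := exists_acts_of_embeds
        (fun mu hmu => exists_acts_tprod_wordRep hn hlam h4 mu (by rwa [pow_succ'] at hmu)) f hf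
      obtain ⟨S, hS, hSe⟩ := exists_irreducible_sub_tprod h2
      obtain ⟨g, hg⟩ := hX S.toSubmodule S.toRepresentation (subtypeMap S) (subtypeMap_injective S)
      refine he.exists_injective h1 (hSe.of_injective ((IntertwiningMap.id _).tensor g) ?_)
      exact TensorProduct.map_injective_of_flat_flat' _ _ Function.injective_id hg

theorem irr_subset_constituents (hn : n + 1 = 2 * k) (hlam : lam.parts = {k, k - 1}) {m : ℕ}
    (hm : 2 ≤ m) (hnm : n ≤ 2 ^ m) :
    Irr (Equiv.Perm (Fin n)) ⊆ constituents (spechtChar lam ^ m) := by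
  intro φ hφ
  refine ⟨hφ, ?_⟩
  obtain ⟨U, _, _, _, τ, hτ, rfl⟩ := hφ
  obtain ⟨X, _, _, _, ρ, hρ, hX⟩ := exists_power_covering hn hlam hm
  obtain ⟨f, hf⟩ := exists_injective_wordRep hnm τ
  obtain ⟨g, hg⟩ := hX U τ f hf
  rw [← hρ]
  exact charInner_ne_zero_of_injective g hg

end Upper

/-! ### Lower bound -/

section Lower

variable {I : Type} [Fintype I] [DecidableEq I]

/-- Substitution of letters. -/
def wordMap {C D : Type} (φ : C → D) : IntertwiningMap (wordRep I C) (wordRep I D) where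
  toLinearMap := Finsupp.lmapDomain ℂ ℂ fun f i => φ (f i)
  isIntertwining' g := by
    ext f : 2
    simp [wordRep_single, Finsupp.mapDomain_single]

theorem wordMap_single {C D : Type} (φ : C → D) (f : I → C) (r : ℂ) :
    wordMap φ (Finsupp.single f r) = Finsupp.single (fun i => φ (f i)) r :=
  Finsupp.mapDomain_single

/-- A pair of words is a word in pairs of letters. -/
def wordTensor (C D : Type) : IntertwiningMap (tprod (wordRep I C) (wordRep I D))
    (wordRep I (C × D)) where
  toLinearMap := (Finsupp.domLCongr (Equiv.arrowProdEquivProdArrow I (fun _ => C) (fun _ => D)).symm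
    : _ ≃ₗ[ℂ] _).toLinearMap ∘ₗ (finsuppTensorFinsupp' ℂ (I → C) (I → D)).toLinearMap
  isIntertwining' g := by
    ext f c : 5
    simp [wordRep_single]
    rfl

theorem wordTensor_injective (C D : Type) : Function.Injective (wordTensor (I := I) C D) :=
  (Finsupp.domLCongr (Equiv.arrowProdEquivProdArrow I (fun _ => C) (fun _ => D)).symm :
    _ ≃ₗ[ℂ] (I → C × D) →₀ ℂ).injective.comp (finsuppTensorFinsupp' ℂ (I → C) (I → D)).injective

theorem isIrreducible_trivial (G : Type) [Group G] : (trivial ℂ G ℂ).IsIrreducible := by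
  have hinj : Function.Injective (Subrepresentation.toSubmodule : Subrepresentation (trivial ℂ G ℂ) → _) :=
    Subrepresentation.toSubmodule_injective
  have hnt : Nontrivial (Subrepresentation (trivial ℂ G ℂ)) :=
    ⟨⊥, ⊤, fun h => bot_ne_top (α := Submodule ℂ ℂ) (congrArg Subrepresentation.toSubmodule h)⟩
  exact ⟨fun S => (eq_bot_or_eq_top S.toSubmodule).imp (fun h => hinj h) (fun h => hinj h)⟩

/-- A vector of the word module on which the group acts by the sign involves only words without
repeated letters: its coefficient at a word with a repeated letter changes sign under the swap. -/
theorem exists_injective_word {C : Type} (f : IntertwiningMap (signTwist (trivial ℂ (Equiv.Perm I) ℂ))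
    (wordRep I C)) (hf : Function.Injective f) : ∃ w : I → C, Function.Injective w := by
  have hne : f 1 ≠ 0 := fun h => one_ne_zero (hf (h.trans (map_zero f).symm))
  obtain ⟨w, hw⟩ := Finsupp.ne_iff.1 hne
  refine ⟨w, fun i j hij => ?_⟩
  by_contra hne
  apply hw
  have h1 := LinearMap.congr_fun (f.isIntertwining' (Equiv.swap i j)) (1 : ℂ)
  simp only [LinearMap.comp_apply, signTwist_apply, Equiv.Perm.sign_swap hne] at h1
  have h2 := DFunLike.congr_fun h1 w
  have h3 : (wordRep I C (Equiv.swap i j) (f 1)) (fun x => w ((Equiv.swap i j)⁻¹ x)) = f 1 w :=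
    Finsupp.mapDomain_apply (f := fun (f : I → C) x => f ((Equiv.swap i j)⁻¹ x))
      (fun a b hab => funext fun x => by simpa using congrFun hab (Equiv.swap i j x)) _ _
  have h4 : (fun x => w ((Equiv.swap i j)⁻¹ x)) = w := by
    rw [Equiv.swap_inv]
    exact funext (swap_preserves hij)
  rw [h4] at h3
  have h5 : f.toLinearMap (((-1 : ℤˣ) : ℤ) • trivial ℂ (Equiv.Perm I) ℂ (Equiv.swap i j) (1 : ℂ))
      = -f 1 := by
    rw [Representation.trivial_apply, Units.val_neg, Units.val_one, neg_one_zsmul, map_neg]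
    rfl
  have h6 : (((-1 : ℤˣ) : ℤ) : ℂ) • trivial ℂ (Equiv.Perm I) ℂ (Equiv.swap i j) (1 : ℂ)
      = ((-1 : ℤˣ) : ℤ) • trivial ℂ (Equiv.Perm I) ℂ (Equiv.swap i j) (1 : ℂ) := by
    simp
  rw [h6, h5] at h2
  exact self_eq_neg.1 (h3.symm.trans h2.symm)

variable {n k : ℕ} {lam : n.Partition}

theorem exists_tableau_of_matching (hn : n + 1 = 2 * k) (hlam : lam.parts = {k, k - 1}) :
    ∃ (T : Tableau lam) (v : (Fin n → Fin 2) → ℤ), v ≠ 0 ∧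
      polytabloid T = ∑ f, Finsupp.single (fun i => (f i : ℕ)) (v f : ℂ) := by
  obtain ⟨κ, i, row, col, -, -, v, y, hv, -, z, hz⟩ :=
    (hasConfig_isMatching (Multiset.replicate n 1) (fun p hp => by
      rw [Multiset.eq_of_mem_replicate hp]; omega)
      (by simp only [Multiset.sum_replicate, smul_eq_mul, mul_one]
          exact ⟨k - 1, by omega⟩)).exists_fin IsMatching.equiv
      (n := n) (by simp)
  obtain ⟨T, hT⟩ := exists_polytabloid_eq hn hlam hv
  refine ⟨T, v, ?_, hT⟩
  rintro rfl
  simp [minorSum] at hz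

/-- The Specht module of a shape with two rows embeds in the words over two letters. -/
theorem exists_injective_binary (hn : n + 1 = 2 * k) (hlam : lam.parts = {k, k - 1}) :
    ∃ f : IntertwiningMap (spechtAction lam) (wordRep (Fin n) (Fin 2)), Function.Injective f := by
  obtain ⟨T, v, hv, hT⟩ := exists_tableau_of_matching hn hlam
  have := (isIrreducible_spechtAction T).1
  -- The polytabloids only use the rows `0` and `1`, so reducing the letters mod `2` does not kill them.
  refine ⟨(wordMap (Fin.ofNat 2)).comp (spechtInclusion lam),
    (IsIrreducible.injective_or_eq_zero _).resolve_right fun h0 => hv ?_⟩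
  let u : SpechtModule lam := ⟨polytabloid T, Submodule.subset_span ⟨T, rfl⟩⟩
  have h1 : wordMap (Fin.ofNat 2) (polytabloid T) = 0 :=
    congrArg (fun g : IntertwiningMap (spechtAction lam) (wordRep (Fin n) (Fin 2)) => g u) h0
  rw [hT, map_sum] at h1
  funext f
  have h2 := DFunLike.congr_fun h1 f
  simp only [wordMap_single, Finsupp.finsetSum_apply] at h2
  rw [Finset.sum_eq_single f] at h2
  · simpa using h2
  · intro f' _ hf'
    exact Finsupp.single_eq_of_ne fun h => hf' (by simpa using h.symm)
  · simp

/-- The powers of the character live in words over `2 ^ j` letters. -/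
theorem exists_power_words (hn : n + 1 = 2 * k) (hlam : lam.parts = {k, k - 1}) (j : ℕ) :
    ∃ (X : Type) (_ : AddCommGroup X) (_ : Module ℂ X) (_ : FiniteDimensional ℂ X)
      (ρ : Representation ℂ (Equiv.Perm (Fin n)) X) (C : Type) (_ : Fintype C)
      (f : IntertwiningMap ρ (wordRep (Fin n) C)),
      ρ.character = spechtChar lam ^ j ∧ Fintype.card C = 2 ^ j ∧ Function.Injective f := by
  induction j with
  | zero =>
    refine ⟨ℂ, inferInstance, inferInstance, inferInstance, trivial ℂ _ ℂ, Unit, inferInstance,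
      ⟨Finsupp.lsingle fun _ => (), fun g => ?_⟩, ?_, rfl, Finsupp.single_injective _⟩
    · ext
      simp [wordRep_single]
    · ext g
      simp [character]
  | succ j ih =>
    obtain ⟨X, _, _, _, ρ, C, _, f, hρ, hC, hf⟩ := ih
    obtain ⟨b, hb⟩ := exists_injective_binary hn hlam
    refine ⟨SpechtModule lam ⊗[ℂ] X, inferInstance, inferInstance, inferInstance,
      tprod (spechtAction lam) ρ, Fin 2 × C, inferInstance, (wordTensor _ _).comp (b.tensor f),
      ?_, ?_, ?_⟩
    · rw [char_tensor, character_spechtAction, hρ, pow_succ']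
    · rw [Fintype.card_prod, hC, Fintype.card_fin, pow_succ']
    · exact (wordTensor_injective _ _).comp (TensorProduct.map_injective_of_flat_flat' _ _ hb hf)

theorem le_two_pow_of_constituents (hn : n + 1 = 2 * k) (hlam : lam.parts = {k, k - 1}) {j : ℕ}
    (h : Irr (Equiv.Perm (Fin n)) ⊆ constituents (spechtChar lam ^ j)) : n ≤ 2 ^ j := by
  obtain ⟨X, _, _, _, ρ, C, _, f, hρ, hC, hf⟩ := exists_power_words hn hlam j
  have hirr := isIrreducible_signTwist (isIrreducible_trivial (Equiv.Perm (Fin n)))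
  obtain ⟨-, hsgn⟩ := h ⟨ℂ, inferInstance, inferInstance, inferInstance, _, hirr, rfl⟩
  rw [← hρ] at hsgn
  obtain ⟨g, hg⟩ := exists_injective_of_charInner_ne_zero hsgn
  obtain ⟨w, hw⟩ := exists_injective_word (f.comp g) (hf.comp hg)
  have := Fintype.card_le_of_injective w hw
  rwa [Fintype.card_fin, hC] at this

end Lower

/-! ### Covering numbers -/

section Covering

variable {n k : ℕ}

/-- The covering property of `χ ^ j` does not change if `χ` is multiplied by the sign. -/
theorem irr_subset_constituents_sign {χ χ' : Equiv.Perm (Fin n) → ℂ}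
    (hχ : ∀ g, χ' g = ((Equiv.Perm.sign g : ℤ) : ℂ) * χ g) {j : ℕ}
    (h : Irr (Equiv.Perm (Fin n)) ⊆ constituents (χ ^ j)) :
    Irr (Equiv.Perm (Fin n)) ⊆ constituents (χ' ^ j) := by
  have hmem : ∀ (i : ℕ) (φ : Equiv.Perm (Fin n) → ℂ), φ ∈ Irr (Equiv.Perm (Fin n)) →
      (fun g => ((Equiv.Perm.sign g : ℤ) : ℂ) ^ i * φ g) ∈ Irr (Equiv.Perm (Fin n)) := by
    intro i φ hφ
    induction i with
    | zero => simpa using hφ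
    | succ i ih =>
      convert sign_mul_mem_irr ih using 2 with g
      ring
  intro φ hφ
  refine ⟨hφ, ?_⟩
  have h1 := (h (hmem j φ hφ)).2
  convert h1 using 1
  unfold charInner
  congr 1
  refine Finset.sum_congr rfl fun g _ => ?_
  simp only [Pi.pow_apply, hχ, Equiv.Perm.sign_inv]
  ring

/-- A character whose powers satisfy both bounds has the rounded logarithm as covering number. -/
theorem isCoveringNumber_clog {χ : Equiv.Perm (Fin n) → ℂ} (hn : 5 ≤ n)
    (hup : ∀ m, 2 ≤ m → n ≤ 2 ^ m → Irr (Equiv.Perm (Fin n)) ⊆ constituents (χ ^ m))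
    (hlow : ∀ j, Irr (Equiv.Perm (Fin n)) ⊆ constituents (χ ^ j) → n ≤ 2 ^ j) :
    IsCoveringNumber χ ⌈Real.logb 2 (n : ℝ)⌉₊ := by
  have hceil : ⌈Real.logb 2 (n : ℝ)⌉₊ = Nat.clog 2 n := by
    exact_mod_cast Real.natCeil_logb_natCast 2 n
  rw [hceil]
  have h1 : n ≤ 2 ^ Nat.clog 2 n := Nat.le_pow_clog (by norm_num) n
  have h2 : 2 ≤ Nat.clog 2 n := by
    by_contra! hlt
    have : 2 ^ Nat.clog 2 n ≤ 2 ^ 1 := Nat.pow_le_pow_right (by norm_num) (by omega)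
    omega
  refine ⟨⟨by omega, Set.Subset.antisymm (fun φ hφ => hφ.1) (hup _ h2 h1)⟩, ?_⟩
  rintro j ⟨-, hj⟩
  exact Nat.clog_le_of_le_pow (hlow j hj.ge)

end Covering

end

end CharCovering

end

theorem theorem2 (n k : ℕ) (hn : 5 ≤ n) (hodd : Odd n) (hk : k = (n + 1) / 2)
    (lam lam' : n.Partition) (hlam : lam.parts = {k, k - 1})
    (hlam' : lam'.parts = Multiset.replicate (k - 1) 2 + {1}) :
    CharCovering.IsCoveringNumber (CharCovering.spechtChar lam) ⌈Real.logb 2 (n : ℝ)⌉₊ ∧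
      CharCovering.IsCoveringNumber (CharCovering.spechtChar lam') ⌈Real.logb 2 (n : ℝ)⌉₊ := by
  have hnk : n + 1 = 2 * k := by
    obtain ⟨r, hr⟩ := hodd
    omega
  have hup := fun m h2 hm => CharCovering.irr_subset_constituents (m := m) hnk hlam h2 hm
  have hlow := fun j h => CharCovering.le_two_pow_of_constituents (j := j) hnk hlam h
  obtain ⟨T, -⟩ := CharCovering.exists_tableau_of_matching hnk hlam
  have hχ := CharCovering.spechtChar_two_columns (by omega) hlam hlam' T
  have hχ' : ∀ g, CharCovering.spechtChar lam g
      = ((Equiv.Perm.sign g : ℤ) : ℂ) * CharCovering.spechtChar lam' g := fun g => by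
    rw [hχ, ← mul_assoc, CharCovering.sign_mul_sign, one_mul]
  exact ⟨CharCovering.isCoveringNumber_clog hn hup hlow,
    CharCovering.isCoveringNumber_clog hn
      (fun m h2 hm => CharCovering.irr_subset_constituents_sign hχ (hup m h2 hm))
      (fun j h => hlow j (CharCovering.irr_subset_constituents_sign hχ' h))⟩
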